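/- **Setting.** Let $\Omega\subset\mathbb R^2$ be a bounded Lipschitz domain with $\partial\Omega=\overline{\Gamma_C}\cup\overline{\Gamma_N}\cup\overline{\Gamma_D}\cup\overline{\Gamma}$, $\Gamma_C\cap\Gamma_N\cap\Gamma_D\cap\Gamma=\emptyset$, where $\Gamma_D$ has positive length; let $\nu$ and $\tau$ be the outward unit normal and a unit tangent on $\partial\Omega$, and $v_\nu=v\cdot\nu$, $v_\tau=v\cdot\tau$. Let $\mathbb C=(C_{ijkl})$ be a bounded measurable elasticity tensor on $\Omega$ with $C_{ijkl}=C_{jikl}=C_{klij}$ and $(\mathbb C(x)E):E\ge m|E|^2$ for all symmetric $E$ and a.e. $x$, with some $m>0$; put $\varepsilon(u)=\frac12(\nabla u+\nabla u^T)$, $\sigma(u)=\mathbb C\varepsilon(u)$. Let $g_N\in L^2(\Gamma_N;\mathbb R^2)$, and let $j_\tau:\Gamma_C\times\mathbb R\to\mathbb R$ be measurable in $x$ with $j_\tau(\cdot,z_0(\cdot))\in L^1(\Gamma_C)$ for some $z_0\in L^2(\Gamma_C)$, and, for a.e. $x$, locally Lipschitz in $z$ with Clarke subdifferential bounded by $\bar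 c_0+\bar c_1|z|$ and with Clarke directional derivative satisfying $j_\tau^0(z_1;z_2-z_1)+j_\tau^0(z_2;z_1-z_2)\le\alpha|z_1-z_2|^2$ for all $z_1,z_2$, with constants $\bar c_0,\bar c_1,\alpha\ge0$. Let $R>0$, $B_R=B_R(\hat x)$ with $\overline{B_R}\subset\Omega$, $\Gamma_R=\partial B_R$, $\Omega_R=\Omega\setminus\overline{B_R}$, and $$V_1^R=\{v\in H^1(\Omega_R;\mathbb R^2):\ v=0\text{ on }\Gamma_D,\ v_\nu=0\text{ on }\Gamma_C\}.$$ Let $r>0$ and, for $0<\zeta<R$, let $r_\zeta=r$ in $B_\zeta(\hat x)$ and $r_\zeta=1$ elsewhere. Let $\mathscr A,\mathscr A_\zeta: H^{1/2}(\Gamma_R;\mathbb R^2)\to H^{-1/2}(\Gamma_R;\mathbb R^2)$ be the Steklov–Poincaré operators $\mathscr A\psi=\sigma(w)n$, $\mathscr A_\zeta\psi=r_\zeta\sigma(w_\zeta)n$, where $n$ is the outward unit normal to $\Gamma_R$ and $w,w_\zeta\in H^1(B_R;\mathbb R^2)$ are the weak solutions of $-\operatorname{div}\sigma(w)=0$,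 respectively $-\operatorname{div}(r_\zeta\sigma(w_\zeta))=0$, in $B_R$ with $w=w_\zeta=\psi$ on $\Gamma_R$. Let $u^R$ and, for each $0<\zeta<R$, $u^R_\zeta$ be elements $u$ of $V_1^R$ solving, with $\mathscr S=\mathscr A$ and $\mathscr S=\mathscr A_\zeta$ respectively, $$\int_{\Omega_R}\sigma(u):\varepsilon(v-u)-\int_{\Gamma_N}g_N\cdot(v-u)+\int_{\Gamma_C}\bigl(j_\tau(v_\tau)-j_\tau(u_\tau)\bigr)+\int_{\Gamma_R}\mathscr S(u)\cdot(v-u)\ \ge 0\qquad\forall v\in V_1^R,$$ the last integral being the duality pairing between $H^{-1/2}(\Gamma_R;\mathbb R^2)$ and $H^{1/2}(\Gamma_R;\mathbb R^2)$. **Theorem.** Assume that $$\mathscr A_\zeta=\mathscr A-\zeta^2\mathscr B+\mathscr R_\zeta\qquad(0<\zeta<R)$$ with a bounded linear operator $\mathscr B$ and bounded linear operators $\mathscr R_\zeta$ from $H^{1/2}(\Gamma_R;\mathbb R^2)$ to $H^{-1/2}(\Gamma_R;\mathbb R^2)$ such that $\|\mathscr R_\zeta\|_{\mathscr L(H^{1/2}(\Gamma_R;\mathbb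 R^2);H^{-1/2}(\Gamma_R;\mathbb R^2))}=o(\zeta^2)$ as $\zeta\to0^+$. Then there is a constant $C_0>0$, independent of $\zeta$, such that $$\|u^R_\zeta-u^R\|_{H^1(\Omega_R;\mathbb R^2)}\le C_0\,\zeta^2\qquad\text{for all }0<\zeta<R.$$ -/

import Mathlib

open MeasureTheory Filter Topology Set
open scoped ContDiff ENNReal

noncomputable section

namespace Contact

/-- The Euclidean plane. -/
abbrev Plane := EuclideanSpace ℝ (Fin 2)

/-- Values of the gradient of a planar vector field, with the Frobenius norm; the entry `(i, j)` is
`∂ⱼ uᵢ`. -/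
abbrev GradVal := EuclideanSpace ℝ (Fin 2 × Fin 2)

/-! ### Sobolev space `H¹(U; ℝ²)` -/

/-- `L²(U; ℝ²) × L²(U; ℝ²ˣ²)` with the Hilbert norm `(‖u‖² + ‖G‖²)^{1/2}`. -/
abbrev L2Pair (U : Set Plane) :=
  WithLp 2 (Lp Plane 2 (volume.restrict U) × Lp GradVal 2 (volume.restrict U))

/-- `G` is the weak gradient of `u` on `U`: for every `φ ∈ C_c^∞(U)` and all `i, j`,
`∫_U uᵢ ∂ⱼφ = - ∫_U Gᵢⱼ φ`. -/
def IsWeakGradient (U : Set Plane) (u : Plane → Plane) (G : Plane → GradVal) : Prop :=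
  ∀ φ : Plane → ℝ, ContDiff ℝ ∞ φ → HasCompactSupport φ → tsupport φ ⊆ U →
    ∀ i j : Fin 2,
      ∫ x in U, u x i * fderiv ℝ φ x (EuclideanSpace.single j 1) = - ∫ x in U, G x (i, j) * φ x

lemma integrable_coord_mul {ι : Type*} [Fintype ι] {μ : Measure Plane}
    [IsFiniteMeasureOnCompacts μ] (f : Lp (EuclideanSpace ℝ ι) 2 μ) (i : ι) {φ : Plane → ℝ}
    (hφ : Continuous φ) (hc : HasCompactSupport φ) : Integrable (fun x => f x i * φ x) μ :=
  MemLp.integrable_mul (p := 2) (q := 2)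
    ((EuclideanSpace.proj (𝕜 := ℝ) i).comp_memLp' (Lp.memLp f)) (hφ.memLp_of_hasCompactSupport hc)

/-- `H¹(U; ℝ²)`, as the space of pairs (function, weak gradient). Its norm is
`(‖u‖²_{L²(U)} + ‖∇u‖²_{L²(U)})^{1/2}`. -/
def H1 (U : Set Plane) : Submodule ℝ (L2Pair U) where
  carrier := {p | IsWeakGradient U p.fst p.snd}
  zero_mem' := by
    intro φ _ _ _ i j
    have h1 : ∀ᵐ x ∂(volume.restrict U), (⇑(0 : L2Pair U).fst : Plane → Plane) x = 0 :=
      Lp.coeFn_zero Plane 2 (volume.restrict U)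
    have h2 : ∀ᵐ x ∂(volume.restrict U), (⇑(0 : L2Pair U).snd : Plane → GradVal) x = 0 :=
      Lp.coeFn_zero GradVal 2 (volume.restrict U)
    rw [integral_eq_zero_of_ae, integral_eq_zero_of_ae, neg_zero]
    · filter_upwards [h2] with x hx
      rw [hx]
      simp
    · filter_upwards [h1] with x hx
      rw [hx]
      simp
  add_mem' := by
    intro p q hp hq φ hφ hc hs i j
    have hd : Continuous fun x => fderiv ℝ φ x (EuclideanSpace.single j 1) :=
      (hφ.continuous_fderiv (by simp)).clm_apply continuous_const
    have hdc : HasCompactSupport fun x => fderiv ℝ φ x (EuclideanSpace.single j 1) :=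
      hc.fderiv_apply ℝ _
    have h1 : ∀ᵐ x ∂(volume.restrict U),
        (⇑(p + q).fst : Plane → Plane) x = p.fst x + q.fst x := Lp.coeFn_add p.fst q.fst
    have h2 : ∀ᵐ x ∂(volume.restrict U),
        (⇑(p + q).snd : Plane → GradVal) x = p.snd x + q.snd x := Lp.coeFn_add p.snd q.snd
    have e1 : ∫ x in U, (p + q).fst x i * fderiv ℝ φ x (EuclideanSpace.single j 1)
        = ∫ x in U, (p.fst x i * fderiv ℝ φ x (EuclideanSpace.single j 1)
          + q.fst x i * fderiv ℝ φ x (EuclideanSpace.single j 1)) := by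
      refine integral_congr_ae ?_
      filter_upwards [h1] with x hx
      rw [hx, PiLp.add_apply, add_mul]
    have e2 : ∫ x in U, (p + q).snd x (i, j) * φ x
        = ∫ x in U, (p.snd x (i, j) * φ x + q.snd x (i, j) * φ x) := by
      refine integral_congr_ae ?_
      filter_upwards [h2] with x hx
      rw [hx, PiLp.add_apply, add_mul]
    rw [e1, e2, integral_add (integrable_coord_mul _ _ hd hdc) (integrable_coord_mul _ _ hd hdc),
      integral_add (integrable_coord_mul _ _ hφ.continuous hc)
        (integrable_coord_mul _ _ hφ.continuous hc), hp φ hφ hc hs i j, hq φ hφ hc hs i j]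
    ring
  smul_mem' := by
    intro c p hp φ hφ hc hs i j
    have h1 : ∀ᵐ x ∂(volume.restrict U),
        (⇑(c • p).fst : Plane → Plane) x = c • p.fst x := Lp.coeFn_smul c p.fst
    have h2 : ∀ᵐ x ∂(volume.restrict U),
        (⇑(c • p).snd : Plane → GradVal) x = c • p.snd x := Lp.coeFn_smul c p.snd
    have e1 : ∫ x in U, (c • p).fst x i * fderiv ℝ φ x (EuclideanSpace.single j 1)
        = ∫ x in U, c * (p.fst x i * fderiv ℝ φ x (EuclideanSpace.single j 1)) := by
      refine integral_congr_ae ?_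
      filter_upwards [h1] with x hx
      rw [hx, PiLp.smul_apply, smul_eq_mul, mul_assoc]
    have e2 : ∫ x in U, (c • p).snd x (i, j) * φ x
        = ∫ x in U, c * (p.snd x (i, j) * φ x) := by
      refine integral_congr_ae ?_
      filter_upwards [h2] with x hx
      rw [hx, PiLp.smul_apply, smul_eq_mul, mul_assoc]
    rw [e1, e2, integral_const_mul, integral_const_mul, hp φ hφ hc hs i j]
    ring

/-- The underlying function of an element of `H¹(U; ℝ²)`. -/
def fieldOf {U : Set Plane} (u : H1 U) : Plane → Plane := u.1.fst

/-- The weak gradient of an element of `H¹(U; ℝ²)`. -/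
def gradOf {U : Set Plane} (u : H1 U) : Plane → GradVal := u.1.snd

/-! ### Traces -/

/-- Arc length on the boundary of `U`. -/
abbrev bdryMeasure (U : Set Plane) : Measure Plane :=
  (Measure.hausdorffMeasure 1).restrict (frontier U)

/-- `L²(∂U; ℝ²)` with respect to arc length. -/
abbrev L2Bdry (U : Set Plane) := Lp Plane 2 (bdryMeasure U)

/-- The pairs `(φ|_U, φ|_{∂U})` with `φ : ℝ² → ℝ²` smooth. -/
def smoothTracePairs (U : Set Plane) : Submodule ℝ (H1 U × L2Bdry U) where
  carrier := {p | ∃ φ : Plane → Plane, ContDiff ℝ ∞ φ ∧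
    fieldOf p.1 =ᵐ[volume.restrict U] φ ∧ p.2 =ᵐ[bdryMeasure U] φ}
  zero_mem' := ⟨0, contDiff_const, Lp.coeFn_zero Plane 2 (volume.restrict U),
    Lp.coeFn_zero Plane 2 (bdryMeasure U)⟩
  add_mem' := by
    rintro p q ⟨φ, hφ, h1, h2⟩ ⟨χ, hχ, k1, k2⟩
    exact ⟨φ + χ, hφ.add hχ, (Lp.coeFn_add p.1.1.fst q.1.1.fst).trans (h1.add k1),
      (Lp.coeFn_add p.2 q.2).trans (h2.add k2)⟩
  smul_mem' := by
    rintro c p ⟨φ, hφ, h1, h2⟩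
    exact ⟨c • φ, contDiff_const.smul hφ, (Lp.coeFn_smul c p.1.1.fst).trans (h1.const_smul c),
      (Lp.coeFn_smul c p.2).trans (h2.const_smul c)⟩

/-- The graph of the trace operator `H¹(U; ℝ²) → L²(∂U; ℝ²)`, i.e. the closure in
`H¹(U) × L²(∂U)` of the graph of the restriction map on smooth functions. For a bounded Lipschitz
domain every `u ∈ H¹(U)` is the first component of exactly one pair `(u, u|_{∂U})` in it. -/
def traceGraph (U : Set Plane) : Submodule ℝ (H1 U × L2Bdry U) :=
  (smoothTracePairs U).topologicalClosure

/-- The fields in `H¹(U; ℝ²)` with zero trace on `∂U`. -/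
def traceKer (U : Set Plane) : Submodule ℝ (H1 U) :=
  (traceGraph U).comap (LinearMap.inl ℝ (H1 U) (L2Bdry U))

instance isClosed_traceKer (U : Set Plane) : IsClosed (traceKer U : Set (H1 U)) :=
  (smoothTracePairs U).isClosed_topologicalClosure.preimage
    (f := fun u : H1 U => ((u, 0) : H1 U × L2Bdry U)) (by fun_prop)

/-- `H^{1/2}(∂U; ℝ²)`, the trace space of `H¹(U; ℝ²)`: a boundary datum is identified with the
class of all `w ∈ H¹(U; ℝ²)` having it as trace, and its norm is the infimum of
`‖w‖_{H¹(U)}` over that class. -/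
def HalfSpace (U : Set Plane) := H1 U ⧸ traceKer U

instance (U : Set Plane) : NormedAddCommGroup (HalfSpace U) :=
  inferInstanceAs (NormedAddCommGroup (H1 U ⧸ traceKer U))

instance (U : Set Plane) : NormedSpace ℝ (HalfSpace U) :=
  inferInstanceAs (NormedSpace ℝ (H1 U ⧸ traceKer U))

/-- The boundary datum of a field `w ∈ H¹(U; ℝ²)`, i.e. the trace `H¹(U) → H^{1/2}(∂U)`. -/
def halfTrace (U : Set Plane) : H1 U →ₗ[ℝ] HalfSpace U := (traceKer U).mkQ

/-- `H^{-1/2}(∂U; ℝ²)`, the dual of `H^{1/2}(∂U; ℝ²)` with the dual norm. -/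
abbrev NegHalfSpace (U : Set Plane) := StrongDual ℝ (HalfSpace U)

/-- `ψ ∈ H^{1/2}(∂U; ℝ²)` is the boundary datum given almost everywhere on `∂U` by the function
`g`. -/
def IsHalfDatum (U : Set Plane) (g : Plane → Plane) (ψ : HalfSpace U) : Prop :=
  ∃ (w : H1 U) (h : L2Bdry U), (w, h) ∈ traceGraph U ∧ h =ᵐ[bdryMeasure U] g ∧
    halfTrace U w = ψ

open Classical in
/-- The element of `H^{1/2}(∂U; ℝ²)` given by a function `g` on `∂U` (zero if `g` does not belong
to that space). -/
def halfDatum (U : Set Plane) (g : Plane → Plane) : HalfSpace U :=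
  if h : ∃ ψ, IsHalfDatum U g ψ then h.choose else 0

/-! ### Domains -/

/-- Bounded Lipschitz domains: non-empty bounded connected open sets which near each boundary point
are, in suitable Cartesian coordinates, the strict epigraph of a Lipschitz function. -/
structure IsLipschitzDomain (Ω : Set Plane) : Prop where
  isOpen : IsOpen Ω
  isConnected : IsConnected Ω
  isBounded : Bornology.IsBounded Ω
  graph : ∀ x ∈ frontier Ω, ∃ (L : Plane ≃ₗᵢ[ℝ] Plane) (K : NNReal) (γ : ℝ → ℝ),
    LipschitzWith K γ ∧ ∀ᶠ y in 𝓝 x, (y ∈ Ω ↔ γ (L y 0) < L y 1)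

/-- `n` is the outward unit normal to `Ω` at the boundary point `x`. -/
def IsOuterNormal (Ω : Set Plane) (x n : Plane) : Prop :=
  ‖n‖ = 1 ∧ ∀ ε > 0, ∀ᶠ y in 𝓝 x,
    (inner ℝ (y - x) n < -ε * ‖y - x‖ → y ∈ Ω) ∧ (ε * ‖y - x‖ < inner ℝ (y - x) n → y ∉ Ω)

open Classical in
/-- The outward unit normal to `Ω` (zero where there is none; on a Lipschitz boundary it exists
almost everywhere). -/
def normal (Ω : Set Plane) (x : Plane) : Plane :=
  if h : ∃ n, IsOuterNormal Ω x n then h.choose else 0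

/-- The unit tangent to `∂Ω`: the normal turned by a quarter of a turn. -/
def tangent (Ω : Set Plane) (x : Plane) : Plane := !₂[-(normal Ω x 1), normal Ω x 0]

/-- Decomposition of `∂Ω` into the contact part, the loaded part, the clamped part and the free
part, the clamped part having positive length. -/
structure IsBoundaryDecomposition (Ω ΓC ΓN ΓD Γ : Set Plane) : Prop where
  measC : MeasurableSet ΓC
  measN : MeasurableSet ΓN
  measD : MeasurableSet ΓD
  measF : MeasurableSet Γ
  cover : frontier Ω = closure ΓC ∪ closure ΓN ∪ closure ΓD ∪ closure Γ
  inter : ΓC ∩ ΓN ∩ ΓD ∩ Γ = ∅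
  clamped : 0 < Measure.hausdorffMeasure 1 ΓD

/-! ### Elasticity -/

/-- Fourth-order tensor fields `C_{ijkl}(x)`. -/
abbrev TensorField := Plane → Fin 2 → Fin 2 → Fin 2 → Fin 2 → ℝ

/-- `(ℂ(x) E)_{ij} = ∑ C_{ijkl}(x) E_{kl}`. -/
def TensorField.app (C : TensorField) (x : Plane) (E : Matrix (Fin 2) (Fin 2) ℝ) :
    Matrix (Fin 2) (Fin 2) ℝ :=
  fun i j => ∑ k, ∑ l, C x i j k l * E k l

/-- `T : U = ∑ T_{ij} U_{ij}`. -/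
def ddot (T U : Matrix (Fin 2) (Fin 2) ℝ) : ℝ := ∑ i, ∑ j, T i j * U i j

/-- The elasticity tensor is symmetric, measurable and bounded, and pointwise stable on `Ω`. -/
structure IsElasticityTensor (Ω : Set Plane) (C : TensorField) : Prop where
  meas : ∀ i j k l, AEStronglyMeasurable (fun x => C x i j k l) (volume.restrict Ω)
  symm : ∀ᵐ x ∂(volume.restrict Ω), ∀ i j k l, C x i j k l = C x j i k l ∧ C x i j k l = C x k l i j
  bounded : ∃ M : ℝ, ∀ᵐ x ∂(volume.restrict Ω), ∀ i j k l, |C x i j k l| ≤ M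
  stable : ∃ m : ℝ, 0 < m ∧ ∀ᵐ x ∂(volume.restrict Ω), ∀ E : Matrix (Fin 2) (Fin 2) ℝ,
    E.IsSymm → m * ddot E E ≤ ddot (C.app x E) E

/-- The strain `ε = (G + Gᵀ) / 2` of a displacement gradient `G`. -/
def strain (G : GradVal) : Matrix (Fin 2) (Fin 2) ℝ := fun i j => (G (i, j) + G (j, i)) / 2

/-- `∫_U ρ σ(u) : ε(v)` with `σ(u) = ℂ ε(u)`. -/
def elasticForm (C : TensorField) (ρ : Plane → ℝ) {U : Set Plane} (u v : H1 U) : ℝ :=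
  ∫ x in U, ρ x * ddot (C.app x (strain (gradOf u x))) (strain (gradOf v x))

/-! ### Steklov–Poincaré operators -/

/-- `w ∈ H¹(U; ℝ²)` is the weak solution of `-div (ρ σ(w)) = 0` in `U`, `w = ψ` on `∂U`. For
piecewise constant `ρ` this contains the transmission conditions on the interface. -/
def IsDirichletSolution (C : TensorField) (ρ : Plane → ℝ) (U : Set Plane) (ψ : HalfSpace U)
    (w : H1 U) : Prop :=
  halfTrace U w = ψ ∧ ∀ φ ∈ traceKer U, elasticForm C ρ w φ = 0

/-- `A` is the operator `ψ ↦ ρ σ(w) n`, `w` being the solution with boundary datum `ψ`; the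
traction `ρ σ(w) n ∈ H^{-1/2}(∂U)` is defined by Green's formula
`⟨ρ σ(w) n, φ|_{∂U}⟩ = ∫_U ρ σ(w) : ε(φ)` for `φ ∈ H¹(U; ℝ²)`. -/
def IsSteklovPoincare (C : TensorField) (ρ : Plane → ℝ) (U : Set Plane)
    (A : HalfSpace U →L[ℝ] NegHalfSpace U) : Prop :=
  ∀ ψ : HalfSpace U, ∃ w : H1 U, IsDirichletSolution C ρ U ψ w ∧
    ∀ φ : H1 U, A ψ (halfTrace U φ) = elasticForm C ρ w φ

open Classical in
/-- The Steklov–Poincaré operator `H^{1/2}(∂U; ℝ²) → H^{-1/2}(∂U; ℝ²)`. -/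
def steklovPoincare (C : TensorField) (ρ : Plane → ℝ) (U : Set Plane) :
    HalfSpace U →L[ℝ] NegHalfSpace U :=
  if h : ∃ A, IsSteklovPoincare C ρ U A then h.choose else 0

open Classical in
/-- The contrast function `r_ζ`: equal to `r` in the ball `B_ζ(x₀)` and to `1` elsewhere. -/
def contrast (x₀ : Plane) (r ζ : ℝ) (x : Plane) : ℝ := if x ∈ Metric.ball x₀ ζ then r else 1

/-! ### Friction -/

/-- The generalized (Clarke) directional derivative `ψ⁰(z; w)`. -/
def clarkeDeriv (ψ : ℝ → ℝ) (z w : ℝ) : ℝ :=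
  limsup (fun p : ℝ × ℝ => (ψ (p.1 + p.2 * w) - ψ p.1) / p.2) (𝓝 z ×ˢ 𝓝[>] 0)

/-- The Clarke subdifferential `∂ψ(z)`. -/
def clarkeSubdiff (ψ : ℝ → ℝ) (z : ℝ) : Set ℝ := {ξ | ∀ w, ξ * w ≤ clarkeDeriv ψ z w}

/-- The assumptions on the friction potential `j_τ : Γ_C × ℝ → ℝ`. -/
structure IsFrictionPotential (ΓC : Set Plane) (j : Plane → ℝ → ℝ) : Prop where
  meas : ∀ z, AEStronglyMeasurable (fun x => j x z) ((Measure.hausdorffMeasure 1).restrict ΓC)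
  integrable : ∃ z₀ : Plane → ℝ, MemLp z₀ 2 ((Measure.hausdorffMeasure 1).restrict ΓC) ∧
    IntegrableOn (fun x => j x (z₀ x)) ΓC (Measure.hausdorffMeasure 1)
  locLip : ∀ᵐ x ∂((Measure.hausdorffMeasure 1).restrict ΓC), LocallyLipschitz (j x)
  growth : ∃ c₀ c₁ : ℝ, 0 ≤ c₀ ∧ 0 ≤ c₁ ∧ ∀ᵐ x ∂((Measure.hausdorffMeasure 1).restrict ΓC),
    ∀ z, ∀ ξ ∈ clarkeSubdiff (j x) z, |ξ| ≤ c₀ + c₁ * |z|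
  relaxed : ∃ α : ℝ, 0 ≤ α ∧ ∀ᵐ x ∂((Measure.hausdorffMeasure 1).restrict ΓC), ∀ z₁ z₂,
    clarkeDeriv (j x) z₁ (z₂ - z₁) + clarkeDeriv (j x) z₂ (z₁ - z₂) ≤ α * |z₁ - z₂| ^ 2

/-! ### The inequality on the truncated domain -/

/-- `Ω_R = Ω ∖ closure B_R(x₀)`. -/
def truncated (Ω : Set Plane) (x₀ : Plane) (R : ℝ) : Set Plane := Ω \ Metric.closedBall x₀ R

/-- `V₁(Ω_R)`: the fields `v ∈ H¹(Ω_R; ℝ²)` with `v = 0` on `Γ_D` and `v·ν = 0` on `Γ_C`, each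
listed together with its trace on `∂Ω_R` (as a pair `(v, v|_{∂Ω_R})`). -/
def V1 (Ω ΓC ΓD : Set Plane) (x₀ : Plane) (R : ℝ) :
    Set (H1 (truncated Ω x₀ R) × L2Bdry (truncated Ω x₀ R)) :=
  {v | v ∈ traceGraph (truncated Ω x₀ R) ∧
    (∀ᵐ x ∂((Measure.hausdorffMeasure 1).restrict ΓD), v.2 x = 0) ∧
    (∀ᵐ x ∂((Measure.hausdorffMeasure 1).restrict ΓC), inner ℝ (v.2 x) (normal Ω x) = 0)}

/-- `u` solves: `u ∈ V₁(Ω_R)` and for all `v ∈ V₁(Ω_R)`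
`∫_{Ω_R} σ(u):ε(v-u) - ∫_{Γ_N} g·(v-u) + ∫_{Γ_C} (j(v_τ) - j(u_τ)) + ⟨A u, v-u⟩_{Γ_R} ≥ 0`. -/
def IsSolution (Ω ΓC ΓN ΓD : Set Plane) (x₀ : Plane) (R : ℝ) (C : TensorField)
    (j : Plane → ℝ → ℝ) (g : Plane → Plane)
    (A : HalfSpace (Metric.ball x₀ R) →L[ℝ] NegHalfSpace (Metric.ball x₀ R))
    (u : H1 (truncated Ω x₀ R) × L2Bdry (truncated Ω x₀ R)) : Prop :=
  u ∈ V1 Ω ΓC ΓD x₀ R ∧ ∀ v ∈ V1 Ω ΓC ΓD x₀ R,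
    0 ≤ elasticForm C (fun _ => 1) u.1 (v.1 - u.1)
      - ∫ x in ΓN, inner ℝ (g x) (v.2 x - u.2 x) ∂(Measure.hausdorffMeasure 1)
      + ∫ x in ΓC, (j x (inner ℝ (v.2 x) (tangent Ω x)) - j x (inner ℝ (u.2 x) (tangent Ω x)))
          ∂(Measure.hausdorffMeasure 1)
      + A (halfDatum (Metric.ball x₀ R) u.2)
          (halfDatum (Metric.ball x₀ R) v.2 - halfDatum (Metric.ball x₀ R) u.2)

end Contact

end

open Contact

/-! The estimate is a comparison of two variational inequalities. Let `A` and `A'` be two boundary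
operators with solutions `u` and `u'`, and let `ψ` and `ψ'` be the boundary data of these solutions
on the circle. Testing each inequality with the other solution and adding makes the load terms and
the friction terms cancel exactly. What is left is that the elastic energy of `u' - u` plus `A' (ψ'
- ψ) (ψ' - ψ)` is at most `-((A' - A) ψ (ψ' - ψ))`. A Steklov–Poincaré operator is nonnegative,
because its quadratic form is the energy of the Dirichlet solution, so its term can be dropped
(`elasticForm_sub_le`). Korn's inequality bounds the energy from below by the square of the `H¹`
norm (`exists_coercive`), and boundary data on the circle are bounded by the `H¹` norm outside it
(`exists_norm_halfDatum_le`). Hence `‖u' - u‖ ≤ K ‖A' - A‖ ‖u‖` (`exists_norm_sub_le`).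

It remains to bound the difference of the operators by a multiple of `ζ²` on the whole interval.
Near zero this is the assumed expansion. Away from zero it suffices that the operators are bounded
uniformly in `ζ`, which follows from the Dirichlet principle and Cauchy–Schwarz for the energy
(`exists_norm_steklovPoincare_le`, `exists_norm_sub_le_sq`). The factor `‖u‖` is harmless because
the comparison with `A' = A` shows that `u` is unique.

Most of the work is Korn's inequality on a Lipschitz domain, proved for smooth fields and then
passed to the closure (`exists_korn_traceGraph`). In the interior, the derivative of a field along a
segment, paired with the direction of the segment, involves only the strain. Averaging over segments
gives Korn–Poincaré estimates, and a cutoff argument gives gradients (`exists_rigid_sqInt_le`,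
`exists_sqInt_grad_sub_skew_le`). Near a Lipschitz graph, the gradient at a point is compared with
the gradient at a slightly higher point. On balls of radius proportional to the height the two
differ by the strain alone, and since lifting contracts the integral of the gradient, that integral
can be absorbed (`exists_sqInt_grad_column_le`). A rigid displacement is finally fixed by its values
on the clamped part, which has positive length and no atoms (`exists_rigid_le`).

Boundary data are moved from the truncated domain to the ball by inversion in the circle, multiplied
by a cutoff that removes the centre (`exists_smooth_extension`). -/

noncomputable section

namespace Contact

/-! ### Square integrals -/

/-- `∫_S ‖f‖²` as an extended nonnegative number. -/
def sqInt {E : Type*} [NormedAddCommGroup E] (S : Set Plane) (f : Plane → E) : ℝ≥0∞ :=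
  ∫⁻ x in S, ‖f x‖ₑ ^ 2

lemma sqInt_mono_set {E : Type*} [NormedAddCommGroup E] {S T : Set Plane} (h : S ⊆ T)
    (f : Plane → E) : sqInt S f ≤ sqInt T f :=
  lintegral_mono_set h

lemma add_sq_le_two_mul (a b : ℝ≥0∞) : (a + b) ^ 2 ≤ 2 * a ^ 2 + 2 * b ^ 2 := by
  by_cases ha : a = ⊤
  · simp [ha]
  by_cases hb : b = ⊤
  · simp [hb]
  lift a to NNReal using ha
  lift b to NNReal using hb
  norm_cast
  rw [← NNReal.coe_le_coe]
  push_cast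
  nlinarith [sq_nonneg ((a : ℝ) - b)]

lemma enorm_add_sq_le {E : Type*} [NormedAddCommGroup E] (a b : E) :
    ‖a + b‖ₑ ^ 2 ≤ 2 * ‖a‖ₑ ^ 2 + 2 * ‖b‖ₑ ^ 2 :=
  (pow_le_pow_left₀ (zero_le) (enorm_add_le a b) 2).trans (add_sq_le_two_mul _ _)

lemma enorm_sq_eq_ofReal {E : Type*} [NormedAddCommGroup E] (a : E) :
    ‖a‖ₑ ^ 2 = ENNReal.ofReal (‖a‖ ^ 2) := by
  rw [← ofReal_norm, ENNReal.ofReal_pow (norm_nonneg _)]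

lemma sqInt_add_le {E : Type*} [NormedAddCommGroup E] {S : Set Plane} {f g : Plane → E}
    (hf : Continuous f) :
    sqInt S (f + g) ≤ 2 * sqInt S f + 2 * sqInt S g := by
  unfold sqInt
  rw [← lintegral_const_mul' 2 _ (by simp), ← lintegral_const_mul' 2 _ (by simp),
    ← lintegral_add_left ((hf.enorm.measurable.pow_const 2).const_mul 2)]
  exact lintegral_mono fun x => enorm_add_sq_le _ _

lemma sqInt_lt_top {E : Type*} [NormedAddCommGroup E] {S : Set Plane}
    (hS : Bornology.IsBounded S) {f : Plane → E} (hf : Continuous f) : sqInt S f < ⊤ := by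
  have hK : IsCompact (closure S) := hS.isCompact_closure
  obtain ⟨M, hM⟩ := hK.exists_bound_of_continuousOn hf.continuousOn
  calc sqInt S f ≤ ∫⁻ _ in closure S, ENNReal.ofReal M ^ 2 := by
        refine (sqInt_mono_set subset_closure f).trans ?_
        refine setLIntegral_mono measurable_const fun x hx => ?_
        gcongr
        rw [← ofReal_norm]
        exact ENNReal.ofReal_le_ofReal (hM x hx)
    _ < ⊤ := by
        rw [setLIntegral_const]
        exact ENNReal.mul_lt_top (by simp) hK.measure_lt_top

lemma lintegral_sq_le {α : Type*} [MeasurableSpace α] (μ : Measure α) {f : α → ℝ≥0∞}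
    (hf : AEMeasurable f μ) : (∫⁻ x, f x ∂μ) ^ 2 ≤ μ univ * ∫⁻ x, f x ^ 2 ∂μ := by
  have h := ENNReal.lintegral_mul_le_Lp_mul_Lq μ Real.HolderConjugate.two_two
    (f := fun _ => 1) (g := f) aemeasurable_const hf
  simp only [Pi.mul_apply, one_mul, lintegral_const, ENNReal.rpow_two,
    one_pow] at h
  calc (∫⁻ x, f x ∂μ) ^ 2 ≤ ((μ univ) ^ (1 / 2 : ℝ) * (∫⁻ x, f x ^ 2 ∂μ) ^ (1 / 2 : ℝ)) ^ 2 := by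
        gcongr
    _ = _ := by
        rw [mul_pow, ← ENNReal.rpow_natCast, ← ENNReal.rpow_natCast, ← ENNReal.rpow_mul,
          ← ENNReal.rpow_mul]
        norm_num

lemma lintegral_comp_add_smul (c : Plane) {t : ℝ} (ht : t ≠ 0) {f : Plane → ℝ≥0∞}
    (hf : Measurable f) :
    ∫⁻ x, f (c + t • x) = ENNReal.ofReal (t ^ 2)⁻¹ * ∫⁻ x, f x := by
  have h1 : ∫⁻ x, f (c + t • x) = ∫⁻ y, f (c + y) ∂(Measure.map (t • ·) (volume : Measure Plane)) := by
    rw [lintegral_map (by fun_prop) (by fun_prop)]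
  rw [h1, Measure.map_addHaar_smul _ ht, lintegral_smul_measure, smul_eq_mul,
    lintegral_add_left_eq_self, finrank_euclideanSpace_fin, abs_of_nonneg (by positivity)]

/-! ### Gradients and strains of smooth fields -/

/-- The classical gradient of a vector field. -/
def grad (φ : Plane → Plane) (x : Plane) : GradVal :=
  WithLp.toLp 2 fun p => fderiv ℝ φ x (EuclideanSpace.single p.2 1) p.1

lemma grad_apply (φ : Plane → Plane) (x : Plane) (i j : Fin 2) :
    grad φ x (i, j) = fderiv ℝ φ x (EuclideanSpace.single j 1) i := rfl

/-- The symmetric part of a gradient. -/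
def symPart : GradVal →L[ℝ] GradVal :=
  LinearMap.toContinuousLinearMap
    { toFun := fun G => WithLp.toLp 2 fun p => strain G p.1 p.2
      map_add' := by
        intro G H
        ext p
        simp [strain]
        ring
      map_smul' := by
        intro c G
        ext p
        simp [strain]
        ring }

lemma symPart_apply (G : GradVal) (i j : Fin 2) : symPart G (i, j) = (G (i, j) + G (j, i)) / 2 := rfl

lemma norm_gradVal_sq (G : GradVal) :
    ‖G‖ ^ 2 = G (0, 0) ^ 2 + G (0, 1) ^ 2 + G (1, 0) ^ 2 + G (1, 1) ^ 2 := by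
  rw [EuclideanSpace.norm_sq_eq, Fintype.sum_prod_type]
  simp [Fin.sum_univ_two]
  ring

lemma norm_plane_sq (v : Plane) : ‖v‖ ^ 2 = v 0 ^ 2 + v 1 ^ 2 := by
  rw [EuclideanSpace.norm_sq_eq]
  simp [Fin.sum_univ_two]

lemma inner_plane (v w : Plane) : inner ℝ v w = v 0 * w 0 + v 1 * w 1 := by
  simp [PiLp.inner_apply, Fin.sum_univ_two]
  ring

lemma norm_symPart_sq (G : GradVal) :
    ‖symPart G‖ ^ 2 = G (0, 0) ^ 2 + (G (0, 1) + G (1, 0)) ^ 2 / 2 + G (1, 1) ^ 2 := by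
  rw [norm_gradVal_sq]
  simp only [symPart_apply]
  ring

lemma ddot_strain_self (G : GradVal) : ddot (strain G) (strain G) = ‖symPart G‖ ^ 2 := by
  rw [norm_symPart_sq]
  simp [ddot, strain, Fin.sum_univ_two]
  ring

lemma norm_symPart_le (G : GradVal) : ‖symPart G‖ ≤ ‖G‖ := by
  refine abs_le_of_sq_le_sq' ?_ (norm_nonneg _) |>.2
  rw [norm_symPart_sq, norm_gradVal_sq]
  nlinarith [sq_nonneg (G (0, 1) - G (1, 0))]

lemma plane_eq_sum (e : Plane) :
    e = e 0 • EuclideanSpace.single 0 1 + e 1 • EuclideanSpace.single 1 1 := by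
  ext i
  fin_cases i <;> simp

lemma fderiv_apply_eq (φ : Plane → Plane) (x e : Plane) (i : Fin 2) :
    fderiv ℝ φ x e i = grad φ x (i, 0) * e 0 + grad φ x (i, 1) * e 1 := by
  conv_lhs => rw [plane_eq_sum e]
  simp only [map_add, map_smul, PiLp.add_apply, PiLp.smul_apply, smul_eq_mul, grad_apply]
  ring

/-- The skew part of a gradient drops out of its quadratic form. The rest is Cauchy–Schwarz for the
pairing of the strain with `e ⊗ e`. -/
lemma abs_inner_fderiv_le (φ : Plane → Plane) (x e : Plane) :
    |inner ℝ (fderiv ℝ φ x e) e| ≤ ‖symPart (grad φ x)‖ * ‖e‖ ^ 2 := by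
  refine abs_le_of_sq_le_sq ?_ (by positivity)
  rw [mul_pow, norm_symPart_sq, norm_plane_sq, inner_plane, fderiv_apply_eq, fderiv_apply_eq]
  set a := grad φ x (0, 0)
  set b := grad φ x (0, 1)
  set c := grad φ x (1, 0)
  set d := grad φ x (1, 1)
  set p := e 0
  set q := e 1
  -- Lagrange's identity: the squares are the two-by-two minors of the strain entries against those
  -- of `e ⊗ e`.
  nlinarith [sq_nonneg (a * p * q - (b + c) / 2 * p ^ 2), sq_nonneg (a * q ^ 2 - d * p ^ 2),
    sq_nonneg ((b + c) / 2 * q ^ 2 - d * p * q)]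

lemma continuous_grad {φ : Plane → Plane} (hφ : ContDiff ℝ 1 φ) : Continuous (grad φ) := by
  have h := hφ.continuous_fderiv (by simp)
  unfold grad
  fun_prop

lemma norm_fderiv_apply_le (φ : Plane → Plane) (x e : Plane) :
    ‖fderiv ℝ φ x e‖ ≤ ‖grad φ x‖ * ‖e‖ := by
  refine abs_le_of_sq_le_sq' ?_ (by positivity) |>.2
  rw [mul_pow, norm_gradVal_sq, norm_plane_sq, norm_plane_sq, fderiv_apply_eq, fderiv_apply_eq]
  set a := grad φ x (0, 0)
  set b := grad φ x (0, 1)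
  set c := grad φ x (1, 0)
  set d := grad φ x (1, 1)
  nlinarith [sq_nonneg (a * e 1 - b * e 0), sq_nonneg (c * e 1 - d * e 0)]

lemma grad_add {φ χ : Plane → Plane} (hφ : ContDiff ℝ 1 φ) (hχ : ContDiff ℝ 1 χ) :
    grad (φ + χ) = grad φ + grad χ := by
  funext x
  ext p
  simp only [grad]
  rw [fderiv_add (hφ.differentiable (by simp) x) (hχ.differentiable (by simp) x)]
  rfl

lemma grad_sub {φ χ : Plane → Plane} (hφ : ContDiff ℝ 1 φ) (hχ : ContDiff ℝ 1 χ) :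
    grad (φ - χ) = grad φ - grad χ := by
  funext x
  ext p
  simp only [grad]
  rw [fderiv_sub (hφ.differentiable (by simp) x) (hχ.differentiable (by simp) x)]
  rfl

/-! ### Rigid displacements -/

/-- Rotation by a quarter of a turn. -/
def quarterTurn : Plane →L[ℝ] Plane :=
  LinearMap.toContinuousLinearMap
    { toFun := fun x => !₂[-x 1, x 0]
      map_add' := by
        intro x y
        ext i
        fin_cases i <;> simp
        ring
      map_smul' := by
        intro c x
        ext i
        fin_cases i <;> simp }

@[simp] lemma quarterTurn_zero (x : Plane) : quarterTurn x 0 = -x 1 := rfl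

@[simp] lemma quarterTurn_one (x : Plane) : quarterTurn x 1 = x 0 := rfl

lemma norm_quarterTurn (x : Plane) : ‖quarterTurn x‖ = ‖x‖ := by
  refine (sq_eq_sq₀ (norm_nonneg _) (norm_nonneg _)).1 ?_
  rw [norm_plane_sq, norm_plane_sq]
  simp
  ring

/-- The infinitesimal rigid displacement `x ↦ A + θ x^⊥`. -/
def rigid (A : Plane) (θ : ℝ) (x : Plane) : Plane := A + θ • quarterTurn x

lemma contDiff_rigid (A : Plane) (θ : ℝ) {n : WithTop ℕ∞} : ContDiff ℝ n (rigid A θ) := by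
  unfold rigid
  fun_prop

/-- The gradient of `x ↦ x^⊥`. -/
def skewUnit : GradVal :=
  WithLp.toLp 2 fun p => quarterTurn (EuclideanSpace.single p.2 1) p.1

lemma grad_rigid (A : Plane) (θ : ℝ) (x : Plane) : grad (rigid A θ) x = θ • skewUnit := by
  have h : HasFDerivAt (rigid A θ) (θ • quarterTurn) x :=
    (quarterTurn.hasFDerivAt.const_smul θ).const_add A
  ext p
  simp only [grad, h.fderiv]
  rfl

lemma symPart_skewUnit : symPart skewUnit = 0 := by
  ext ⟨i, j⟩
  rw [symPart_apply]
  fin_cases i <;> fin_cases j <;> simp [skewUnit]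

lemma symPart_grad_sub_rigid {φ : Plane → Plane} (hφ : ContDiff ℝ 1 φ) (A : Plane) (θ : ℝ)
    (x : Plane) : symPart (grad (φ - rigid A θ) x) = symPart (grad φ x) := by
  rw [grad_sub hφ (contDiff_rigid A θ), Pi.sub_apply, grad_rigid, map_sub, map_smul,
    symPart_skewUnit, smul_zero, sub_zero]

/-! ### Korn–Poincaré estimates on convex sets -/

/-- The strain of a vector field. -/
def strainField (u : Plane → Plane) (x : Plane) : GradVal := symPart (grad u x)

lemma continuous_strainField {u : Plane → Plane} (hu : ContDiff ℝ 1 u) :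
    Continuous (strainField u) :=
  symPart.continuous.comp (continuous_grad hu)

/-- The mean of `‖ε(u)‖²` over the segment from `a` to `x`. -/
def segStrain (u : Plane → Plane) (a x : Plane) : ℝ≥0∞ :=
  ∫⁻ t in Ioc (0 : ℝ) 1, ‖strainField u (a + t • (x - a))‖ₑ ^ 2

lemma measurable_segStrain {u : Plane → Plane} (hu : ContDiff ℝ 1 u) :
    Measurable (Function.uncurry (segStrain u)) := by
  have h : Measurable fun p : (Plane × Plane) × ℝ =>
      ‖strainField u (p.1.1 + p.2 • (p.1.2 - p.1.1))‖ₑ ^ 2 := by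
    have := continuous_strainField hu
    exact Continuous.measurable (by fun_prop)
  exact h.lintegral_prod_right'

lemma measurable_segStrain_comp {u : Plane → Plane} (hu : ContDiff ℝ 1 u) {p q : Plane → Plane}
    (hp : Continuous p) (hq : Continuous q) : Measurable fun a => segStrain u (p a) (q a) := by
  have h : Measurable fun z : Plane × ℝ =>
      ‖strainField u (p z.1 + z.2 • (q z.1 - p z.1))‖ₑ ^ 2 := by
    have := continuous_strainField hu
    exact Continuous.measurable (by fun_prop)
  exact h.lintegral_prod_right'

/-- Along the segment, the derivative of `u` paired with the direction `x - a` sees only the strain.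
The bound is the fundamental theorem of calculus followed by Cauchy–Schwarz in the parameter. -/
lemma enorm_inner_sub_sq_le {u : Plane → Plane} (hu : ContDiff ℝ 1 u) (a x : Plane) :
    ‖inner ℝ (u x - u a) (x - a)‖ₑ ^ 2 ≤ ‖x - a‖ₑ ^ 4 * segStrain u a x := by
  have hd : ∀ t : ℝ, HasDerivAt (fun t : ℝ => inner ℝ (u (a + t • (x - a))) (x - a))
      (inner ℝ (fderiv ℝ u (a + t • (x - a)) (x - a)) (x - a)) t := by
    intro t
    have h1 : HasDerivAt (fun t : ℝ => a + t • (x - a)) (x - a) t := by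
      simpa using ((hasDerivAt_id t).smul_const (x - a)).const_add a
    have h2 := (hu.differentiable (by simp) (a + t • (x - a))).hasFDerivAt.comp_hasDerivAt t h1
    simpa using h2.inner ℝ (hasDerivAt_const t (x - a))
  have hc : Continuous fun t : ℝ => inner ℝ (fderiv ℝ u (a + t • (x - a)) (x - a)) (x - a) := by
    have := hu.continuous_fderiv (by simp)
    fun_prop
  have hint := intervalIntegral.integral_eq_sub_of_hasDerivAt (a := 0) (b := 1)
    (fun t _ => hd t) (hc.intervalIntegrable _ _)
  have he : inner ℝ (u x - u a) (x - a)
      = ∫ t in Ioc (0 : ℝ) 1, inner ℝ (fderiv ℝ u (a + t • (x - a)) (x - a)) (x - a) := by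
    rw [← intervalIntegral.integral_of_le zero_le_one, hint, inner_sub_left]
    simp
  have hb : ‖inner ℝ (u x - u a) (x - a)‖ₑ
      ≤ ∫⁻ t in Ioc (0 : ℝ) 1, ‖x - a‖ₑ ^ 2 * ‖strainField u (a + t • (x - a))‖ₑ := by
    rw [he]
    refine (enorm_integral_le_lintegral_enorm _).trans (lintegral_mono fun t => ?_)
    rw [← ofReal_norm, ← ofReal_norm, ← ofReal_norm, ← ENNReal.ofReal_pow (norm_nonneg _),
      ← ENNReal.ofReal_mul (by positivity), mul_comm]
    exact ENNReal.ofReal_le_ofReal (abs_inner_fderiv_le _ _ _)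
  have hm : Continuous fun t : ℝ => ‖strainField u (a + t • (x - a))‖ₑ := by
    have := continuous_strainField hu
    fun_prop
  rw [lintegral_const_mul _ hm.measurable] at hb
  calc ‖inner ℝ (u x - u a) (x - a)‖ₑ ^ 2
      ≤ (‖x - a‖ₑ ^ 2 * ∫⁻ t in Ioc (0 : ℝ) 1, ‖strainField u (a + t • (x - a))‖ₑ) ^ 2 := by
        gcongr
    _ = ‖x - a‖ₑ ^ 4 * (∫⁻ t in Ioc (0 : ℝ) 1, ‖strainField u (a + t • (x - a))‖ₑ) ^ 2 := by
        rw [mul_pow, ← pow_mul]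
    _ ≤ _ := by
        gcongr
        refine (lintegral_sq_le _ hm.measurable.aemeasurable).trans ?_
        simp [segStrain]

/-- By convexity the contraction towards `a` maps `D` into itself. Its Jacobian is `t²`, which is at
least `1/4` in this range. -/
lemma setLIntegral_lineMap_le {D : Set Plane} (hD : Convex ℝ D) (hm : MeasurableSet D)
    {f : Plane → ℝ≥0∞} (hf : Measurable f) {t : ℝ} (ht : t ∈ Icc (1 / 2 : ℝ) 1) {a : Plane}
    (ha : a ∈ D) : ∫⁻ x in D, f (a + t • (x - a)) ≤ 4 * ∫⁻ x in D, f x := by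
  have ht0 : 0 < t := by linarith [ht.1]
  calc ∫⁻ x in D, f (a + t • (x - a))
      ≤ ∫⁻ x in D, D.indicator f ((a - t • a) + t • x) := by
        refine setLIntegral_mono' hm fun x hx => ?_
        have h1 : a + t • (x - a) = (a - t • a) + t • x := by
          rw [smul_sub]
          abel
        have h2 : (a - t • a) + t • x ∈ D := by
          have h3 := hD ha hx (show 0 ≤ 1 - t by linarith [ht.2]) ht0.le (by ring)
          rwa [sub_smul, one_smul] at h3
        rw [h1, indicator_of_mem h2]
    _ ≤ ∫⁻ x, D.indicator f ((a - t • a) + t • x) := setLIntegral_le_lintegral _ _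
    _ = ENNReal.ofReal (t ^ 2)⁻¹ * ∫⁻ x in D, f x := by
        rw [lintegral_comp_add_smul _ ht0.ne' (hf.indicator hm), lintegral_indicator hm]
    _ ≤ 4 * ∫⁻ x in D, f x := by
        gcongr
        rw [show (4 : ℝ≥0∞) = ENNReal.ofReal 4 by norm_num]
        refine ENNReal.ofReal_le_ofReal (inv_le_of_inv_le₀ (by norm_num) ?_)
        nlinarith [ht.1]

/-- The contraction towards one endpoint degenerates as `t` tends to zero, but then the contraction
towards the other endpoint does not. Each `t` is handled from the endpoint whose Jacobian is at
least `1/4`. -/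
lemma lintegral_segment_le {D : Set Plane} (hD : Convex ℝ D) (hm : MeasurableSet D)
    {f : Plane → ℝ≥0∞} (hf : Measurable f) :
    ∫⁻ a in D, ∫⁻ x in D, ∫⁻ t in Ioc (0 : ℝ) 1, f (a + t • (x - a))
      ≤ 4 * volume D * ∫⁻ x in D, f x := by
  have hmeas : Measurable fun p : (Plane × ℝ) × Plane => f (p.1.1 + p.1.2 • (p.2 - p.1.1)) :=
    hf.comp (Continuous.measurable (by fun_prop))
  have h1 : ∀ a, ∫⁻ x in D, ∫⁻ t in Ioc (0 : ℝ) 1, f (a + t • (x - a))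
      = ∫⁻ t in Ioc (0 : ℝ) 1, ∫⁻ x in D, f (a + t • (x - a)) := by
    intro a
    refine lintegral_lintegral_swap (Measurable.aemeasurable ?_)
    exact hf.comp (Continuous.measurable (by fun_prop))
  simp_rw [h1]
  rw [lintegral_lintegral_swap (Measurable.aemeasurable hmeas.lintegral_prod_right')]
  have h2 : ∀ t ∈ Ioc (0 : ℝ) 1, ∫⁻ a in D, ∫⁻ x in D, f (a + t • (x - a))
      ≤ 4 * volume D * ∫⁻ x in D, f x := by
    intro t ht
    have key : ∀ s ∈ Icc (1 / 2 : ℝ) 1, ∫⁻ a in D, ∫⁻ x in D, f (a + s • (x - a))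
        ≤ 4 * volume D * ∫⁻ x in D, f x := by
      intro s hs
      calc ∫⁻ a in D, ∫⁻ x in D, f (a + s • (x - a)) ≤ ∫⁻ _ in D, 4 * ∫⁻ x in D, f x :=
            setLIntegral_mono measurable_const fun a ha =>
              setLIntegral_lineMap_le hD hm hf hs ha
        _ = _ := by
            rw [setLIntegral_const]
            ring
    rcases le_total (1 / 2) t with h | h
    · exact key t ⟨h, ht.2⟩
    -- For `t` below one half, exchanging the two integrations turns `t` into `1 - t`.
    · rw [lintegral_lintegral_swap]
      · refine le_trans (le_of_eq ?_) (key (1 - t) ⟨by linarith, by linarith [ht.1]⟩)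
        refine lintegral_congr fun a => lintegral_congr fun x => ?_
        congr 1
        module
      · exact (hf.comp (Continuous.measurable (by fun_prop))).aemeasurable
  calc ∫⁻ t in Ioc (0 : ℝ) 1, ∫⁻ a in D, ∫⁻ x in D, f (a + t • (x - a))
      ≤ ∫⁻ _ in Ioc (0 : ℝ) 1, 4 * volume D * ∫⁻ x in D, f x :=
        setLIntegral_mono measurable_const h2
    _ = _ := by simp

lemma lintegral_segStrain_le {D : Set Plane} (hD : Convex ℝ D) (hm : MeasurableSet D)
    {u : Plane → Plane} (hu : ContDiff ℝ 1 u) :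
    ∫⁻ a in D, ∫⁻ x in D, segStrain u a x ≤ 4 * volume D * sqInt D (strainField u) :=
  lintegral_segment_le hD hm ((continuous_strainField hu).enorm.measurable.pow_const 2)

lemma setLIntegral_comp_add_le {A B : Set Plane} (hA : MeasurableSet A) (hB : MeasurableSet B)
    {g : Plane → ℝ≥0∞} (v : Plane) (h : ∀ a ∈ A, a + v ∈ B) :
    ∫⁻ a in A, g (a + v) ≤ ∫⁻ b in B, g b := by
  calc ∫⁻ a in A, g (a + v) ≤ ∫⁻ a in A, B.indicator g (a + v) := by
        refine setLIntegral_mono' hA fun a ha => ?_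
        rw [indicator_of_mem (h a ha)]
    _ ≤ ∫⁻ a, B.indicator g (a + v) := setLIntegral_le_lintegral _ _
    _ = _ := by rw [lintegral_add_right_eq_self, lintegral_indicator hB]

/-- The `k`-th unit vector. -/
abbrev unitVec (k : Fin 2) : Plane := EuclideanSpace.single k 1

lemma inner_unitVec (v : Plane) (k : Fin 2) : inner ℝ v (unitVec k) = v k := by
  fin_cases k <;> simp [inner_plane, unitVec]

lemma enorm_inner_sq_le (v w : Plane) {d : NNReal} (h : ‖w‖ ≤ d) :
    ‖inner ℝ v w‖ₑ ^ 2 ≤ d ^ 2 * ‖v‖ₑ ^ 2 := by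
  rw [← mul_pow]
  gcongr
  rw [← ofReal_norm, ← ofReal_norm, ← ENNReal.ofReal_coe_nnreal (p := d),
    ← ENNReal.ofReal_mul d.coe_nonneg]
  refine ENNReal.ofReal_le_ofReal ((norm_inner_le_norm v w).trans ?_)
  rw [mul_comm]
  gcongr

lemma add_four_sq_le (a b c d : ℝ≥0∞) :
    (a + b + (c + d)) ^ 2 ≤ 4 * (a ^ 2 + b ^ 2 + (c ^ 2 + d ^ 2)) := by
  calc (a + b + (c + d)) ^ 2 ≤ 2 * (2 * a ^ 2 + 2 * b ^ 2) + 2 * (2 * c ^ 2 + 2 * d ^ 2) :=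
        (add_sq_le_two_mul _ _).trans (by gcongr <;> exact add_sq_le_two_mul _ _)
    _ = _ := by ring

/-- The components of `u(x)` are controlled by the values of `u` at two points `a`, `a + h e_k` and
by the strain along the segments joining them to `x`. -/
lemma enorm_coord_sq_le {u : Plane → Plane} (hu : ContDiff ℝ 1 u) (x a : Plane) (h : ℝ) (k : Fin 2)
    {d : NNReal} (ha : ‖x - a‖ ≤ d) (hb : ‖x - (a + h • unitVec k)‖ ≤ d) :
    ‖h‖ₑ ^ 2 * ‖u x k‖ₑ ^ 2 ≤ 4 * (d ^ 4 * segStrain u a x + d ^ 4 * segStrain u (a + h • unitVec k) x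
      + (d ^ 2 * ‖u a‖ₑ ^ 2 + d ^ 2 * ‖u (a + h • unitVec k)‖ₑ ^ 2)) := by
  set b := a + h • unitVec k with hbdef
  -- Since `b - a = (x - a) - (x - b)`, the `k`-th component of `u x` is a combination of its
  -- components along the two segments ending at `x`. Along each of them the increment of `u` is
  -- governed by strain.
  have e1 : h * u x k = inner ℝ (u x - u a) (x - a) + - inner ℝ (u x - u b) (x - b)
      + (inner ℝ (u a) (x - a) + - inner ℝ (u b) (x - b)) := by
    have e2 : h * u x k = inner ℝ (u x) (b - a) := by
      rw [hbdef, add_sub_cancel_left, inner_smul_right, inner_unitVec]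
    rw [e2]
    simp only [inner_sub_left, inner_sub_right]
    ring
  have hseg : ∀ c : Plane, ‖x - c‖ ≤ d →
      ‖inner ℝ (u x - u c) (x - c)‖ₑ ^ 2 ≤ d ^ 4 * segStrain u c x := by
    intro c hc
    refine (enorm_inner_sub_sq_le hu c x).trans ?_
    gcongr
    rw [← ofReal_norm, ← ENNReal.ofReal_coe_nnreal (p := d)]
    exact ENNReal.ofReal_le_ofReal hc
  rw [← mul_pow, ← enorm_mul, e1]
  calc _ ≤ (‖inner ℝ (u x - u a) (x - a)‖ₑ + ‖inner ℝ (u x - u b) (x - b)‖ₑ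
        + (‖inner ℝ (u a) (x - a)‖ₑ + ‖inner ℝ (u b) (x - b)‖ₑ)) ^ 2 := by
        gcongr
        refine (enorm_add_le _ _).trans ?_
        gcongr
        · refine (enorm_add_le _ _).trans ?_
          rw [enorm_neg]
        · refine (enorm_add_le _ _).trans ?_
          rw [enorm_neg]
    _ ≤ _ := add_four_sq_le _ _ _ _
    _ ≤ _ := by
        gcongr
        · exact hseg a ha
        · exact hseg b hb
        · exact enorm_inner_sq_le _ _ ha
        · exact enorm_inner_sq_le _ _ hb

lemma enorm_plane_sq (v : Plane) : ‖v‖ₑ ^ 2 = ‖v 0‖ₑ ^ 2 + ‖v 1‖ₑ ^ 2 := by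
  simp only [enorm_sq_eq_ofReal]
  rw [← ENNReal.ofReal_add (by positivity) (by positivity), norm_plane_sq]
  simp

lemma sqInt_eq_coord (S : Set Plane) {u : Plane → Plane} (hu : Continuous u) :
    sqInt S u = sqInt S (fun x => u x 0) + sqInt S (fun x => u x 1) := by
  unfold sqInt
  rw [← lintegral_add_left]
  · simp_rw [enorm_plane_sq]
  · exact Continuous.measurable (by fun_prop)

/-- The pointwise bound is integrated over `x` in `D` and over base points `a` in the ball of half
the radius. With the step `s / 2`, the second point `a + v` still lies in the ball of radius `s`. -/
lemma sqInt_coord_le_of_ball_subset {D : Set Plane} (hD : Convex ℝ D) (hm : MeasurableSet D)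
    {d : NNReal} (hd : ∀ x ∈ D, ∀ y ∈ D, ‖x - y‖ ≤ d) {y : Plane} {s : ℝ}
    (hs : 0 < s) (hsub : Metric.ball y s ⊆ D) {u : Plane → Plane} (hu : ContDiff ℝ 1 u)
    (k : Fin 2) :
    volume (Metric.ball y (s / 2)) * (‖s / 2‖ₑ ^ 2 * sqInt D (fun x => u x k)) ≤
      4 * (8 * d ^ 4 * volume D * sqInt D (strainField u)
        + 2 * d ^ 2 * volume D * sqInt (Metric.ball y s) u) := by
  set A := Metric.ball y (s / 2)
  set B := Metric.ball y s
  set v : Plane := (s / 2) • unitVec k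
  have hv : ‖v‖ = s / 2 := by
    simp only [v, norm_smul, unitVec, PiLp.norm_single]
    simp [abs_of_pos hs]
  have hAB : A ⊆ B := Metric.ball_subset_ball (by linarith)
  have hAv : ∀ a ∈ A, a + v ∈ B := by
    intro a ha
    have : dist a y < s / 2 := ha
    have h2 := dist_triangle (a + v) a y
    have h3 : dist (a + v) a = s / 2 := by rw [dist_eq_norm, add_sub_cancel_left, hv]
    exact Metric.mem_ball.2 (by linarith)
  have mA : MeasurableSet A := measurableSet_ball
  have mB : MeasurableSet B := measurableSet_ball
  have hseg := measurable_segStrain hu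
  have hsa : ∀ a, Measurable (segStrain u a) := fun a => hseg.of_uncurry_left
  have hcu : Continuous u := hu.continuous
  -- integrate in `x`
  have h1 : ∀ a ∈ A, ‖s / 2‖ₑ ^ 2 * sqInt D (fun x => u x k) ≤
      4 * (d ^ 4 * (∫⁻ x in D, segStrain u a x) + d ^ 4 * (∫⁻ x in D, segStrain u (a + v) x)
        + (d ^ 2 * volume D * ‖u a‖ₑ ^ 2 + d ^ 2 * volume D * ‖u (a + v)‖ₑ ^ 2)) := by
    intro a ha
    calc ‖s / 2‖ₑ ^ 2 * sqInt D (fun x => u x k)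
        = ∫⁻ x in D, ‖s / 2‖ₑ ^ 2 * ‖u x k‖ₑ ^ 2 := by
          rw [lintegral_const_mul _ (Continuous.measurable (by fun_prop))]
          rfl
      _ ≤ ∫⁻ x in D, 4 * (d ^ 4 * segStrain u a x + d ^ 4 * segStrain u (a + v) x
            + (d ^ 2 * ‖u a‖ₑ ^ 2 + d ^ 2 * ‖u (a + v)‖ₑ ^ 2)) :=
          setLIntegral_mono' hm fun x hx => enorm_coord_sq_le hu x a (s / 2) k
            (hd x hx a (hsub (hAB ha))) (hd x hx _ (hsub (hAv a ha)))
      _ = _ := by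
          rw [lintegral_const_mul' _ _ (by simp),
            lintegral_add_right _ measurable_const,
            lintegral_add_left ((hsa a).const_mul _), lintegral_const_mul _ (hsa a),
            lintegral_const_mul _ (hsa _), setLIntegral_const]
          ring
  have hS : Measurable fun a => ∫⁻ x in D, segStrain u a x := hseg.lintegral_prod_right'
  have hSv : Measurable fun a => ∫⁻ x in D, segStrain u (a + v) x := hS.comp (measurable_add_const v)
  have hU : Measurable fun a => ‖u a‖ₑ ^ 2 := Continuous.measurable (by fun_prop)
  have hUv : Measurable fun a => ‖u (a + v)‖ₑ ^ 2 := hU.comp (measurable_add_const v)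
  calc volume A * (‖s / 2‖ₑ ^ 2 * sqInt D (fun x => u x k))
      = ∫⁻ _ in A, ‖s / 2‖ₑ ^ 2 * sqInt D (fun x => u x k) := by
        rw [setLIntegral_const, mul_comm]
    _ ≤ ∫⁻ a in A, 4 * (d ^ 4 * (∫⁻ x in D, segStrain u a x)
        + d ^ 4 * (∫⁻ x in D, segStrain u (a + v) x)
        + (d ^ 2 * volume D * ‖u a‖ₑ ^ 2 + d ^ 2 * volume D * ‖u (a + v)‖ₑ ^ 2)) :=
        setLIntegral_mono' mA h1
    _ = 4 * (d ^ 4 * (∫⁻ a in A, ∫⁻ x in D, segStrain u a x)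
        + d ^ 4 * (∫⁻ a in A, ∫⁻ x in D, segStrain u (a + v) x)
        + (d ^ 2 * volume D * (∫⁻ a in A, ‖u a‖ₑ ^ 2)
          + d ^ 2 * volume D * ∫⁻ a in A, ‖u (a + v)‖ₑ ^ 2)) := by
        rw [lintegral_const_mul' _ _ (by simp), lintegral_add_left (by fun_prop),
          lintegral_add_left (by fun_prop), lintegral_add_left (by fun_prop),
          lintegral_const_mul _ hS, lintegral_const_mul _ hSv, lintegral_const_mul _ hU,
          lintegral_const_mul _ hUv]
    _ ≤ 4 * (d ^ 4 * (∫⁻ a in D, ∫⁻ x in D, segStrain u a x)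
        + d ^ 4 * (∫⁻ a in D, ∫⁻ x in D, segStrain u a x)
        + (d ^ 2 * volume D * (∫⁻ a in B, ‖u a‖ₑ ^ 2)
          + d ^ 2 * volume D * ∫⁻ a in B, ‖u a‖ₑ ^ 2)) := by
        gcongr 4 * (_ * ?_ + _ * ?_ + (_ * ?_ + _ * ?_))
        · exact lintegral_mono_set (hAB.trans hsub)
        · exact setLIntegral_comp_add_le (g := fun a => ∫⁻ x in D, segStrain u a x) mA hm v
            fun a ha => hsub (hAv a ha)
        · exact lintegral_mono_set hAB
        · exact setLIntegral_comp_add_le (g := fun a => ‖u a‖ₑ ^ 2) mA mB v hAv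
    _ ≤ 4 * (d ^ 4 * (4 * volume D * sqInt D (strainField u))
        + d ^ 4 * (4 * volume D * sqInt D (strainField u))
        + (d ^ 2 * volume D * sqInt B u + d ^ 2 * volume D * sqInt B u)) := by
        gcongr 4 * (_ * ?_ + _ * ?_ + _) <;> exact lintegral_segStrain_le hD hm hu
    _ = _ := by ring

/-- On a bounded convex set, a field is controlled in `L²` by its strain and by its values in a
small ball. -/
lemma exists_sqInt_le_of_ball_subset {D : Set Plane} (hD : Convex ℝ D) (hm : MeasurableSet D)
    (hb : Bornology.IsBounded D) {y : Plane} {s : ℝ} (hs : 0 < s) (hsub : Metric.ball y s ⊆ D) :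
    ∃ C : NNReal, ∀ u : Plane → Plane, ContDiff ℝ 1 u →
      sqInt D u ≤ C * (sqInt D (strainField u) + sqInt (Metric.ball y s) u) := by
  obtain ⟨d, hd⟩ := Metric.isBounded_iff_nndist.1 hb
  have hd' : ∀ x ∈ D, ∀ y ∈ D, ‖x - y‖ ≤ d := by
    intro x hx z hz
    rw [← dist_eq_norm, ← coe_nndist]
    exact_mod_cast hd hx hz
  set q : ℝ≥0∞ := volume (Metric.ball y (s / 2)) * ‖s / 2‖ₑ ^ 2 with hq
  have hq0 : q ≠ 0 := by
    refine mul_ne_zero (Metric.measure_ball_pos volume y (by positivity)).ne' ?_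
    simp [hs.ne']
  have hqt : q ≠ ⊤ := ENNReal.mul_ne_top measure_ball_lt_top.ne (by simp)
  have hDt : volume D ≠ ⊤ := hb.measure_lt_top.ne
  set M : ℝ≥0∞ := 4 * (8 * d ^ 4 * volume D + 2 * d ^ 2 * volume D) with hM
  have hMt : M ≠ ⊤ := by
    refine ENNReal.mul_ne_top (by simp) (ENNReal.add_ne_top.2 ⟨?_, ?_⟩) <;>
      refine ENNReal.mul_ne_top (ENNReal.mul_ne_top (by simp) (by simp)) hDt
  have hCt : 2 * (q⁻¹ * M) ≠ ⊤ :=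
    ENNReal.mul_ne_top (by simp) (ENNReal.mul_ne_top (ENNReal.inv_ne_top.2 hq0) hMt)
  refine ⟨(2 * (q⁻¹ * M)).toNNReal, fun u hu => ?_⟩
  rw [ENNReal.coe_toNNReal hCt]
  have hk : ∀ k, sqInt D (fun x => u x k)
      ≤ q⁻¹ * M * (sqInt D (strainField u) + sqInt (Metric.ball y s) u) := by
    intro k
    have h := sqInt_coord_le_of_ball_subset hD hm hd' hs hsub hu k
    rw [← mul_assoc, ← hq] at h
    rw [mul_assoc, ← ENNReal.div_eq_inv_mul, ENNReal.le_div_iff_mul_le (Or.inl hq0) (Or.inl hqt),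
      mul_comm]
    refine h.trans ?_
    rw [hM, mul_assoc 4, add_mul]
    gcongr 4 * (_ * ?_ + _ * ?_)
    · exact le_self_add
    · exact le_add_self
  rw [sqInt_eq_coord D hu.continuous, mul_assoc, two_mul]
  exact add_le_add (hk 0) (hk 1)

lemma strainField_sub_rigid {u : Plane → Plane} (hu : ContDiff ℝ 1 u) (A : Plane) (θ : ℝ) :
    strainField (u - rigid A θ) = strainField u :=
  funext fun x => symPart_grad_sub_rigid hu A θ x

lemma norm_unitVec (k : Fin 2) : ‖unitVec k‖ = 1 := by
  rw [unitVec, PiLp.norm_single]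
  simp

/-- For a fixed parameter on the segment, the point is a translate of `a` by a vector of norm at
most one. The unit ball is therefore moved inside the ball of radius two. -/
lemma lintegral_segStrain_add_le {u : Plane → Plane} (hu : ContDiff ℝ 1 u) {p q : Plane}
    (hp : ‖p‖ ≤ 1) (hq : ‖q‖ ≤ 1) :
    ∫⁻ a in Metric.ball (0 : Plane) 1, segStrain u (a + p) (a + q)
      ≤ sqInt (Metric.ball (0 : Plane) 2) (strainField u) := by
  have hc := continuous_strainField hu
  unfold segStrain
  rw [lintegral_lintegral_swap]
  · calc _ ≤ ∫⁻ _ in Ioc (0 : ℝ) 1, sqInt (Metric.ball (0 : Plane) 2) (strainField u) := by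
          refine setLIntegral_mono measurable_const fun t ht => ?_
          have hn : ‖p + t • (q - p)‖ ≤ 1 := by
            have h := (convex_closedBall (0 : Plane) 1) (mem_closedBall_zero_iff.2 hp)
              (mem_closedBall_zero_iff.2 hq) (show 0 ≤ 1 - t by linarith [ht.2]) ht.1.le (by ring)
            rw [mem_closedBall_zero_iff] at h
            rwa [show p + t • (q - p) = (1 - t) • p + t • q by module]
          refine le_trans (le_of_eq ?_) (setLIntegral_comp_add_le
            (g := fun x => ‖strainField u x‖ₑ ^ 2) measurableSet_ball measurableSet_ball
            (p + t • (q - p)) (A := Metric.ball 0 1) fun a ha => ?_)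
          · refine lintegral_congr fun a => ?_
            rw [add_sub_add_left_eq_sub, add_assoc]
          · rw [mem_ball_zero_iff] at ha ⊢
            linarith [norm_add_le a (p + t • (q - p))]
      _ = _ := by simp
  · exact (Continuous.measurable (by fun_prop)).aemeasurable

/-- The strains that control the distance of a field in `ball 0 2` to the rigid displacement
fitted at the points `a`, `a + e₀`, `a + e₁`. -/
def fitError (u : Plane → Plane) (a : Plane) : ℝ≥0∞ :=
  ((∫⁻ x in Metric.ball (0 : Plane) 2, segStrain u a x)
    + (∫⁻ x in Metric.ball (0 : Plane) 2, segStrain u (a + unitVec 0) x)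
    + ∫⁻ x in Metric.ball (0 : Plane) 2, segStrain u (a + unitVec 1) x)
  + (segStrain u a (a + unitVec 0) + segStrain u a (a + unitVec 1)
    + segStrain u (a + unitVec 0) (a + unitVec 1))

/-- Some point does not exceed the mean of `fitError` over the unit ball, and every term of that
mean is bounded by the total strain. -/
lemma exists_fitError_le : ∃ C : NNReal, ∀ u : Plane → Plane, ContDiff ℝ 1 u →
    ∃ a ∈ Metric.ball (0 : Plane) 1,
      fitError u a ≤ C * sqInt (Metric.ball (0 : Plane) 2) (strainField u) := by
  have hV : volume (Metric.ball (0 : Plane) 1) ≠ 0 :=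
    (Metric.measure_ball_pos volume _ one_pos).ne'
  have hV' : volume (Metric.ball (0 : Plane) 1) ≠ ⊤ := measure_ball_lt_top.ne
  obtain ⟨V, hVd⟩ : ∃ V : NNReal, (V : ℝ≥0∞) = volume (Metric.ball (0 : Plane) 2) :=
    ⟨_, ENNReal.coe_toNNReal measure_ball_lt_top.ne⟩
  -- The three double integrals contribute `4 * V` each, and the three edges of the triangle
  -- contribute one each.
  refine ⟨((volume (Metric.ball (0 : Plane) 1))⁻¹).toNNReal * (12 * V + 3), fun u hu => ?_⟩
  obtain ⟨I, hI⟩ : ∃ I, I = sqInt (Metric.ball (0 : Plane) 2) (strainField u) := ⟨_, rfl⟩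
  have hseg := measurable_segStrain hu
  have hS : Measurable fun a => ∫⁻ x in Metric.ball (0 : Plane) 2, segStrain u a x :=
    hseg.lintegral_prod_right'
  have m1 : ∀ v, Measurable fun a => ∫⁻ x in Metric.ball (0 : Plane) 2, segStrain u (a + v) x :=
    fun v => hS.comp (measurable_add_const v)
  have m2 : ∀ p q : Plane, Measurable fun a => segStrain u (a + p) (a + q) := fun p q =>
    measurable_segStrain_comp hu (by fun_prop) (by fun_prop)
  have m3 : ∀ q : Plane, Measurable fun a => segStrain u a (a + q) := fun q =>
    measurable_segStrain_comp hu (by fun_prop) (by fun_prop)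
  have hmeas : Measurable (fitError u) :=
    ((hS.add (m1 _)).add (m1 _)).add (((m3 _).add (m3 _)).add (m2 _ _))
  obtain ⟨a, ha, h⟩ := exists_le_setLAverage hV hV' hmeas.aemeasurable
  refine ⟨a, ha, h.trans ?_⟩
  have hx : ∀ v : Plane, ‖v‖ ≤ 1 → ∫⁻ a in Metric.ball (0 : Plane) 1,
      (∫⁻ x in Metric.ball (0 : Plane) 2, segStrain u (a + v) x) ≤ 4 * V * I := by
    intro v hv
    rw [hI, hVd]
    refine le_trans ?_ (lintegral_segStrain_le (convex_ball 0 2) measurableSet_ball hu)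
    refine setLIntegral_comp_add_le
      (g := fun a => ∫⁻ x in Metric.ball (0 : Plane) 2, segStrain u a x)
      measurableSet_ball measurableSet_ball v fun a ha => ?_
    rw [mem_ball_zero_iff] at ha ⊢
    linarith [norm_add_le a v]
  have h0 := hx 0 (by simp)
  have h1 := hx (unitVec 0) (norm_unitVec 0).le
  have h2 := hx (unitVec 1) (norm_unitVec 1).le
  have k0 := lintegral_segStrain_add_le hu (p := 0) (q := unitVec 0) (by simp) (norm_unitVec 0).le
  have k1 := lintegral_segStrain_add_le hu (p := 0) (q := unitVec 1) (by simp) (norm_unitVec 1).le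
  have k2 := lintegral_segStrain_add_le hu (p := unitVec 0) (q := unitVec 1)
    (norm_unitVec 0).le (norm_unitVec 1).le
  simp only [add_zero] at h0 k0 k1
  rw [setLAverage_eq, ENNReal.div_eq_inv_mul, ENNReal.coe_mul,
    ENNReal.coe_toNNReal (ENNReal.inv_ne_top.2 hV), mul_assoc]
  gcongr
  calc ∫⁻ a in Metric.ball (0 : Plane) 1, fitError u a
      ≤ (4 * V * I + 4 * V * I + 4 * V * I) + (I + I + I) := by
        unfold fitError
        have n0 := m1 (unitVec 0)
        have n1 := m1 (unitVec 1)
        have n2 := m3 (unitVec 0)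
        have n3 := m3 (unitVec 1)
        rw [lintegral_add_left (by fun_prop), lintegral_add_left (by fun_prop),
          lintegral_add_left hS, lintegral_add_left (by fun_prop), lintegral_add_left n2]
        rw [← hI] at k0 k1 k2
        gcongr
    _ = _ := by
        rw [← hI]
        push_cast
        ring

/-- The three parameters of a rigid displacement cancel both components at the first vertex and the
transversal component at the second. The three components that remain are measured by the strain
along the three edges of the triangle. -/
lemma exists_rigid_segStrain_le {u : Plane → Plane} (hu : ContDiff ℝ 1 u) (a : Plane) :
    ∃ (A : Plane) (θ : ℝ), (u - rigid A θ) a = 0 ∧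
      ‖(u - rigid A θ) (a + unitVec 0)‖ₑ ^ 2 ≤ segStrain u a (a + unitVec 0) ∧
      ‖(u - rigid A θ) (a + unitVec 1)‖ₑ ^ 2 ≤ 17 * (segStrain u a (a + unitVec 0)
        + segStrain u a (a + unitVec 1) + segStrain u (a + unitVec 0) (a + unitVec 1)) := by
  set b := a + unitVec 0 with hb
  set c := a + unitVec 1 with hc
  set θ : ℝ := u b 1 - u a 1 with hθ
  set A : Plane := u a - θ • quarterTurn a with hA
  refine ⟨A, θ, ?_⟩
  set w := u - rigid A θ with hw
  have hwc : ContDiff ℝ 1 w := hu.sub (contDiff_rigid A θ)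
  have hseg : ∀ p q, segStrain w p q = segStrain u p q := by
    intro p q
    simp only [segStrain, hw, strainField_sub_rigid hu]
  have wa : w a = 0 := by
    simp [hw, rigid, hA]
  have wb1 : w b 1 = 0 := by
    simp only [hw, rigid, hA, Pi.sub_apply, PiLp.sub_apply, PiLp.add_apply, PiLp.smul_apply,
      quarterTurn_one, smul_eq_mul]
    have : b 0 = a 0 + 1 := by simp [hb]
    rw [this, hθ]
    ring
  have s0 : ‖w b 0‖ₑ ^ 2 ≤ segStrain u a b := by
    have h := enorm_inner_sub_sq_le hwc a b
    have hba : b - a = unitVec 0 := by simp [hb]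
    rw [wa, sub_zero, hba, inner_unitVec, hseg, ← ofReal_norm (unitVec 0), norm_unitVec] at h
    simpa using h
  have s1 : ‖w c 1‖ₑ ^ 2 ≤ segStrain u a c := by
    have h := enorm_inner_sub_sq_le hwc a c
    have hca : c - a = unitVec 1 := by simp [hc]
    rw [wa, sub_zero, hca, inner_unitVec, hseg, ← ofReal_norm (unitVec 1), norm_unitVec] at h
    simpa using h
  have s2 : ‖inner ℝ (w c - w b) (c - b)‖ₑ ^ 2 ≤ 4 * segStrain u b c := by
    have h := enorm_inner_sub_sq_le hwc b c
    rw [hseg] at h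
    refine h.trans ?_
    gcongr
    have hcb : ‖c - b‖ₑ ^ 2 = 2 := by
      rw [enorm_sq_eq_ofReal, norm_plane_sq]
      norm_num [hb, hc]
    calc ‖c - b‖ₑ ^ 4 = (‖c - b‖ₑ ^ 2) ^ 2 := by rw [← pow_mul]
      _ ≤ 4 := by
        rw [hcb]
        norm_num
  refine ⟨wa, ?_, ?_⟩
  · rw [enorm_plane_sq, wb1]
    simpa using s0
  -- The hypotenuse has direction `(-1, 1)`, so the increment along it determines the last unknown
  -- component `w c 0` from `w c 1` and `w b 0`.
  · have e : w c 0 = w c 1 + w b 0 + (-inner ℝ (w c - w b) (c - b) + 0) := by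
      rw [inner_plane]
      have h0 : (c - b) 0 = -1 := by simp [hb, hc]
      have h1 : (c - b) 1 = 1 := by simp [hb, hc]
      rw [h0, h1]
      simp only [PiLp.sub_apply, wb1]
      ring
    have s3 : ‖w c 0‖ₑ ^ 2 ≤ 4 * (segStrain u a c + segStrain u a b + (4 * segStrain u b c + 0)) := by
      rw [e]
      calc _ ≤ (‖w c 1‖ₑ + ‖w b 0‖ₑ + (‖inner ℝ (w c - w b) (c - b)‖ₑ + 0)) ^ 2 := by
            gcongr
            refine (enorm_add_le _ _).trans ?_
            gcongr
            · exact enorm_add_le _ _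
            · rw [add_zero, add_zero, enorm_neg]
        _ ≤ _ := add_four_sq_le _ _ _ _
        _ ≤ _ := by
            simp only [ne_eq, OfNat.ofNat_ne_zero, not_false_eq_true, zero_pow]
            gcongr
    rw [enorm_plane_sq]
    calc ‖w c 0‖ₑ ^ 2 + ‖w c 1‖ₑ ^ 2 ≤ 4 * (segStrain u a c + segStrain u a b
          + (4 * segStrain u b c + 0)) + segStrain u a c := add_le_add s3 s1
      _ = 4 * segStrain u a b + 5 * segStrain u a c + 16 * segStrain u b c := by ring
      _ ≤ 17 * segStrain u a b + 17 * segStrain u a c + 17 * segStrain u b c := by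
          gcongr <;> norm_num
      _ = _ := by ring

/-- Korn–Poincaré inequality in the ball of radius two. -/
lemma exists_rigid_sqInt_le : ∃ C : NNReal, ∀ u : Plane → Plane, ContDiff ℝ 1 u →
    ∃ (A : Plane) (θ : ℝ), sqInt (Metric.ball (0 : Plane) 2) (u - rigid A θ)
      ≤ C * sqInt (Metric.ball (0 : Plane) 2) (strainField u) := by
  obtain ⟨C, hC⟩ := exists_fitError_le
  obtain ⟨V, hVd⟩ : ∃ V : NNReal, (V : ℝ≥0∞) = volume (Metric.ball (0 : Plane) 2) :=
    ⟨_, ENNReal.coe_toNNReal measure_ball_lt_top.ne⟩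
  refine ⟨(2 * (4 * (256 + 16 * V * 17))) * C, fun u hu => ?_⟩
  obtain ⟨a, ha, hF⟩ := hC u hu
  obtain ⟨A, θ, wa, wb, wc⟩ := exists_rigid_segStrain_le hu a
  refine ⟨A, θ, ?_⟩
  obtain ⟨w, hw⟩ : ∃ w, w = u - rigid A θ := ⟨_, rfl⟩
  rw [← hw] at wa wb wc ⊢
  have hwc : ContDiff ℝ 1 w := hw ▸ hu.sub (contDiff_rigid A θ)
  have hsegw : segStrain w = segStrain u := by
    funext p q
    simp only [segStrain, hw, strainField_sub_rigid hu]
  have hsa : ∀ p, Measurable (segStrain u p) := fun p => (measurable_segStrain hu).of_uncurry_left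
  have hball : ∀ k : Fin 2, a + (1 : ℝ) • unitVec k ∈ Metric.ball (0 : Plane) 2 := by
    intro k
    rw [mem_ball_zero_iff] at ha ⊢
    rw [one_smul]
    linarith [norm_add_le a (unitVec k), norm_unitVec k]
  have hdist : ∀ x ∈ Metric.ball (0 : Plane) 2, ∀ y ∈ Metric.ball (0 : Plane) 2,
      ‖x - y‖ ≤ (4 : NNReal) := by
    intro x hx y hy
    rw [mem_ball_zero_iff] at hx hy
    push_cast
    linarith [norm_sub_le x y]
  have ha' : a ∈ Metric.ball (0 : Plane) 2 := Metric.ball_subset_ball (by norm_num) ha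
  have hwk : ∀ k : Fin 2, ‖w (a + unitVec k)‖ₑ ^ 2 ≤ 17 * (segStrain u a (a + unitVec 0)
        + segStrain u a (a + unitVec 1) + segStrain u (a + unitVec 0) (a + unitVec 1)) := by
    intro k
    fin_cases k
    · refine wb.trans ?_
      rw [add_assoc]
      calc _ = 1 * segStrain u a (a + unitVec 0) := (one_mul _).symm
        _ ≤ _ := by
          gcongr
          · norm_num
          · exact le_self_add
    · exact wc
  have hFk : ∀ k : Fin 2, (∫⁻ x in Metric.ball (0 : Plane) 2, segStrain u a x)
      + (∫⁻ x in Metric.ball (0 : Plane) 2, segStrain u (a + unitVec k) x) ≤ fitError u a := by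
    intro k
    unfold fitError
    refine le_trans ?_ le_self_add
    fin_cases k
    · exact le_self_add
    · rw [add_assoc, add_comm (∫⁻ x in Metric.ball (0 : Plane) 2, segStrain u (a + unitVec 0) x),
        ← add_assoc]
      exact le_self_add
  have hk : ∀ k : Fin 2, sqInt (Metric.ball (0 : Plane) 2) (fun x => w x k)
      ≤ 4 * (256 + 16 * V * 17) * fitError u a := by
    intro k
    -- Distances in the ball are at most `4`, whence `256 = 4⁴` and `16 = 4²`. The value at `a` does
    -- not appear because `w a = 0`.
    calc sqInt (Metric.ball (0 : Plane) 2) (fun x => w x k)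
        ≤ ∫⁻ x in Metric.ball (0 : Plane) 2, 4 * ((256 * segStrain u a x
          + 256 * segStrain u (a + unitVec k) x) + 16 * ‖w (a + unitVec k)‖ₑ ^ 2) := by
          refine setLIntegral_mono' measurableSet_ball fun x hx => ?_
          have h := enorm_coord_sq_le hwc x a 1 k (hdist x hx a ha') (hdist x hx _ (hball k))
          rw [wa, hsegw, one_smul] at h
          simp only [enorm_one, one_pow, one_mul, enorm_zero, ENNReal.coe_ofNat] at h
          refine h.trans (le_of_eq ?_)
          norm_num
      _ = 4 * (256 * ((∫⁻ x in Metric.ball (0 : Plane) 2, segStrain u a x)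
          + (∫⁻ x in Metric.ball (0 : Plane) 2, segStrain u (a + unitVec k) x))
          + 16 * V * ‖w (a + unitVec k)‖ₑ ^ 2) := by
          rw [lintegral_const_mul' _ _ (by simp), lintegral_add_right _ measurable_const,
            lintegral_add_left ((hsa a).const_mul _), lintegral_const_mul _ (hsa a),
            lintegral_const_mul _ (hsa _), setLIntegral_const, hVd]
          ring
      _ ≤ 4 * (256 * fitError u a + 16 * V * (17 * fitError u a)) := by
          gcongr 4 * (256 * ?_ + 16 * V * ?_)
          · exact hFk k
          · refine (hwk k).trans ?_
            gcongr
            exact le_add_self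
      _ = _ := by ring
  rw [sqInt_eq_coord _ hwc.continuous]
  calc _ ≤ 4 * (256 + 16 * V * 17) * fitError u a + 4 * (256 + 16 * V * 17) * fitError u a :=
        add_le_add (hk 0) (hk 1)
    _ ≤ 4 * (256 + 16 * V * 17) * (C * sqInt (Metric.ball (0 : Plane) 2) (strainField u))
        + 4 * (256 + 16 * V * 17) * (C * sqInt (Metric.ball (0 : Plane) 2) (strainField u)) := by
        gcongr
    _ = _ := by
        push_cast
        ring

/-! ### Korn's inequality in the interior -/

/-- Integrating by parts, both sides equal minus the integral of a mixed second derivative of `f`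
against `g`, and mixed derivatives commute. -/
lemma integral_fderiv_mul_fderiv_comm {f g : Plane → ℝ} (hf : ContDiff ℝ ∞ f)
    (hg : ContDiff ℝ ∞ g) (hgc : HasCompactSupport g) (a b : Plane) :
    ∫ x, fderiv ℝ f x a * fderiv ℝ g x b = ∫ x, fderiv ℝ f x b * fderiv ℝ g x a := by
  have hf' : ContDiff ℝ ∞ (fderiv ℝ f) := hf.fderiv_right (by simp)
  have hd : ∀ e : Plane, ContDiff ℝ ∞ fun x => fderiv ℝ f x e := fun e =>
    hf'.clm_apply contDiff_const
  have hg' : Continuous (fderiv ℝ g) := hg.continuous_fderiv (by simp)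
  have key : ∀ a b : Plane, ∫ x, fderiv ℝ f x a * fderiv ℝ g x b
      = -∫ x, fderiv ℝ (fderiv ℝ f) x b a * g x := by
    intro a b
    have e1 : ∀ x, fderiv ℝ (fun y => fderiv ℝ f y a) x b = fderiv ℝ (fderiv ℝ f) x b a := by
      intro x
      rw [fderiv_clm_apply (hf'.differentiable (by simp) x) (differentiableAt_const a)]
      simp
    have hc1 : Continuous fun x => fderiv ℝ (fun y => fderiv ℝ f y a) x b :=
      ((hd a).continuous_fderiv (by simp)).clm_apply continuous_const
    rw [integral_mul_fderiv_eq_neg_fderiv_mul_of_integrable]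
    · simp_rw [e1]
    · exact (hc1.mul hg.continuous).integrable_of_hasCompactSupport hgc.mul_left
    · exact ((hd a).continuous.mul (hg'.clm_apply continuous_const)).integrable_of_hasCompactSupport
        (hgc.fderiv_apply ℝ b).mul_left
    · exact ((hd a).continuous.mul hg.continuous).integrable_of_hasCompactSupport hgc.mul_left
    · exact fun x _ => (hd a).differentiable (by simp) x
    · exact fun x _ => hg.differentiable (by simp) x
  rw [key a b, key b a]
  congr 2
  funext x
  have hs : IsSymmSndFDerivAt ℝ f x :=
    hf.contDiffAt.isSymmSndFDerivAt (by
      simpa using WithTop.coe_le_coe.2 (le_top : (2 : ℕ∞) ≤ ⊤))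
  rw [hs b a]

lemma contDiff_coord {v : Plane → Plane} {n : WithTop ℕ∞} (hv : ContDiff ℝ n v) (i : Fin 2) :
    ContDiff ℝ n fun x => v x i :=
  (EuclideanSpace.proj (𝕜 := ℝ) i).contDiff.comp hv

lemma grad_apply_eq_fderiv_coord {v : Plane → Plane} {x : Plane} (hv : DifferentiableAt ℝ v x)
    (i j : Fin 2) : grad v x (i, j) = fderiv ℝ (fun y => v y i) x (unitVec j) := by
  have h : HasFDerivAt (fun y => v y i) ((EuclideanSpace.proj (𝕜 := ℝ) i).comp (fderiv ℝ v x)) x :=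
    (EuclideanSpace.proj (𝕜 := ℝ) i).hasFDerivAt.comp x hv.hasFDerivAt
  rw [h.fderiv]
  rfl

/-- Korn's inequality for smooth fields with compact support. -/
lemma sqInt_grad_le_of_hasCompactSupport {v : Plane → Plane} (hv : ContDiff ℝ ∞ v)
    (hc : HasCompactSupport v) : sqInt univ (grad v) ≤ 2 * sqInt univ (strainField v) := by
  have hv1 : ContDiff ℝ 1 v := hv.of_le (by simp)
  have hg := continuous_grad hv1
  have hs := continuous_strainField hv1
  have hgc : HasCompactSupport (grad v) := by
    refine (hc.fderiv ℝ).mono fun x hx => ?_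
    rw [Function.mem_support] at hx ⊢
    intro h0
    exact hx (by ext p; simp [grad, h0])
  have hsc : HasCompactSupport (strainField v) := hgc.comp_left (g := symPart) (map_zero _)
  have key : ∫ x, ‖grad v x‖ ^ 2 ≤ ∫ x, 2 * ‖strainField v x‖ ^ 2 := by
    have i1 : Integrable fun x => ‖grad v x‖ ^ 2 :=
      Continuous.integrable_of_hasCompactSupport (by fun_prop)
        (hgc.comp_left (g := fun G => ‖G‖ ^ 2) (by simp))
    have i2 : Integrable fun x => 2 * ‖strainField v x‖ ^ 2 :=
      Continuous.integrable_of_hasCompactSupport (by fun_prop)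
        (hsc.comp_left (g := fun G => 2 * ‖G‖ ^ 2) (by simp))
    have i3 : Integrable fun x => grad v x (0, 1) * grad v x (1, 0) :=
      Continuous.integrable_of_hasCompactSupport (by fun_prop)
        (hgc.comp_left (g := fun G : GradVal => G (0, 1) * G (1, 0)) (by simp))
    have i4 : Integrable fun x => grad v x (0, 0) * grad v x (1, 1) :=
      Continuous.integrable_of_hasCompactSupport (by fun_prop)
        (hgc.comp_left (g := fun G : GradVal => G (0, 0) * G (1, 1)) (by simp))
    -- The determinant of the gradient of a compactly supported field has integral zero.
    have hdet : ∫ x, grad v x (0, 1) * grad v x (1, 0) = ∫ x, grad v x (0, 0) * grad v x (1, 1) := by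
      simp only [grad_apply_eq_fderiv_coord (hv1.differentiable (by simp) _)]
      exact integral_fderiv_mul_fderiv_comm (contDiff_coord hv 0) (contDiff_coord hv 1)
        (hc.comp_left (g := fun w : Plane => w 1) (by simp)) _ _
    have i5 : Integrable fun x =>
        2 * (grad v x (0, 0) * grad v x (1, 1) - grad v x (0, 1) * grad v x (1, 0)) :=
      (i4.sub i3).const_mul 2
    -- Pointwise, the squared gradient is twice the squared strain plus twice the determinant minus
    -- the squared divergence.
    calc ∫ x, ‖grad v x‖ ^ 2 ≤ ∫ x, (2 * ‖strainField v x‖ ^ 2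
          + 2 * (grad v x (0, 0) * grad v x (1, 1) - grad v x (0, 1) * grad v x (1, 0))) := by
          refine integral_mono i1 (i2.add i5) fun x => ?_
          simp only [strainField, norm_symPart_sq]
          rw [norm_gradVal_sq]
          nlinarith [sq_nonneg (grad v x (0, 0) + grad v x (1, 1))]
      _ = _ := by
          rw [integral_add i2 i5,
            integral_const_mul _ (fun x => grad v x (0, 0) * grad v x (1, 1)
              - grad v x (0, 1) * grad v x (1, 0)), integral_sub i4 i3, hdet, sub_self, mul_zero,
            add_zero]
  unfold sqInt
  rw [← lintegral_const_mul' _ _ (by simp)]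
  simp only [Measure.restrict_univ, enorm_sq_eq_ofReal]
  have h2 : ∀ t : ℝ, 2 * ENNReal.ofReal t = ENNReal.ofReal (2 * t) := fun t => by
    rw [ENNReal.ofReal_mul zero_le_two, ENNReal.ofReal_ofNat]
  rw [← ofReal_integral_eq_lintegral_ofReal]
  · simp_rw [h2]
    rw [← ofReal_integral_eq_lintegral_ofReal]
    · exact ENNReal.ofReal_le_ofReal key
    · exact Continuous.integrable_of_hasCompactSupport (by fun_prop)
        (hsc.comp_left (g := fun G => 2 * ‖G‖ ^ 2) (by simp))
    · exact Eventually.of_forall fun x => by positivity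
  · exact Continuous.integrable_of_hasCompactSupport (by fun_prop)
      (hgc.comp_left (g := fun G => ‖G‖ ^ 2) (by simp))
  · exact Eventually.of_forall fun x => by positivity

/-- The tensor product `u ⊗ ℓ` as a gradient value. -/
def tensor (u : Plane) (l : Plane →L[ℝ] ℝ) : GradVal :=
  WithLp.toLp 2 fun p => u p.1 * l (unitVec p.2)

lemma norm_tensor_le (u : Plane) (l : Plane →L[ℝ] ℝ) : ‖tensor u l‖ ≤ 2 * ‖l‖ * ‖u‖ := by
  have h : ∀ k, l (unitVec k) ^ 2 ≤ ‖l‖ ^ 2 := by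
    intro k
    have := l.le_opNorm (unitVec k)
    rw [norm_unitVec, mul_one, Real.norm_eq_abs] at this
    exact sq_le_sq' (by linarith [neg_abs_le (l (unitVec k))])
      ((le_abs_self _).trans this)
  refine abs_le_of_sq_le_sq' ?_ (by positivity) |>.2
  rw [norm_gradVal_sq, mul_pow, norm_plane_sq]
  have e : ∀ i j, tensor u l (i, j) = u i * l (unitVec j) := fun i j => rfl
  simp only [e]
  nlinarith [mul_le_mul_of_nonneg_left (h 0) (sq_nonneg (u 0)),
    mul_le_mul_of_nonneg_left (h 1) (sq_nonneg (u 0)),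
    mul_le_mul_of_nonneg_left (h 0) (sq_nonneg (u 1)),
    mul_le_mul_of_nonneg_left (h 1) (sq_nonneg (u 1)), sq_nonneg (‖l‖ * u 0), sq_nonneg (‖l‖ * u 1)]

lemma grad_smul {χ : Plane → ℝ} {u : Plane → Plane} {x : Plane} (hχ : DifferentiableAt ℝ χ x)
    (hu : DifferentiableAt ℝ u x) :
    grad (fun y => χ y • u y) x = χ x • grad u x + tensor (u x) (fderiv ℝ χ x) := by
  ext p
  simp only [grad, fderiv_fun_smul hχ hu, tensor]
  simp
  ring

/-- The compactly supported inequality is applied to `χ u`, where the cutoff `χ` equals one on the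
smaller ball. Differentiating the cutoff costs the `L²` norm of `u`. -/
lemma exists_sqInt_grad_ball_le (z : Plane) {ρ : ℝ} (hρ : 0 < ρ) : ∃ C : NNReal,
    ∀ u : Plane → Plane, ContDiff ℝ ∞ u → sqInt (Metric.ball z ρ) (grad u)
      ≤ C * (sqInt (Metric.ball z (2 * ρ)) (strainField u) + sqInt (Metric.ball z (2 * ρ)) u) := by
  let χ : ContDiffBump z := ⟨ρ, 3 / 2 * ρ, hρ, by linarith⟩
  have hχ : ContDiff ℝ ∞ χ := χ.contDiff
  obtain ⟨M, hM⟩ := (hχ.continuous_fderiv (by simp)).bounded_above_of_compact_support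
    (χ.hasCompactSupport.fderiv ℝ)
  have hM0 : 0 ≤ M := (norm_nonneg _).trans (hM 0)
  refine ⟨2 * (2 + 2 * (2 * M.toNNReal) ^ 2), fun u hu => ?_⟩
  have hu1 : ContDiff ℝ 1 u := hu.of_le (by simp)
  set v : Plane → Plane := fun y => χ y • u y with hvdef
  have hv : ContDiff ℝ ∞ v := hχ.smul hu
  have hvc : HasCompactSupport v := χ.hasCompactSupport.smul_right
  have hgv : ∀ x, grad v x = χ x • grad u x + tensor (u x) (fderiv ℝ χ x) := fun x =>
    grad_smul (hχ.differentiable (by simp) x) (hu.differentiable (by simp) x)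
  have h1 : sqInt (Metric.ball z ρ) (grad u) = sqInt (Metric.ball z ρ) (grad v) := by
    refine setLIntegral_congr_fun measurableSet_ball fun x hx => ?_
    have he : (χ : Plane → ℝ) =ᶠ[𝓝 x] fun _ => 1 :=
      χ.eventuallyEq_one_of_mem_ball hx
    have he' : v =ᶠ[𝓝 x] u := by
      filter_upwards [he] with y hy
      simp [hvdef, hy]
    simp only [grad, he'.fderiv_eq]
  have hpt : ∀ x, ‖strainField v x‖ₑ ^ 2
      ≤ 2 * ‖strainField u x‖ₑ ^ 2 + 2 * ((2 * M.toNNReal) ^ 2 * ‖u x‖ₑ ^ 2) := by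
    intro x
    rw [strainField, hgv, map_add, map_smul]
    refine (enorm_add_sq_le _ _).trans ?_
    gcongr
    · rw [enorm_smul]
      calc _ ≤ 1 * ‖strainField u x‖ₑ := by
            gcongr
            · rw [← ofReal_norm, Real.norm_of_nonneg χ.nonneg]
              simpa using χ.le_one
            · exact le_rfl
        _ = _ := one_mul _
    · rw [← mul_pow]
      gcongr
      rw [← ofReal_norm, ← ofReal_norm]
      calc ENNReal.ofReal ‖symPart (tensor (u x) (fderiv ℝ χ x))‖
          ≤ ENNReal.ofReal (2 * M * ‖u x‖) := by
            refine ENNReal.ofReal_le_ofReal ?_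
            refine (norm_symPart_le _).trans ((norm_tensor_le _ _).trans ?_)
            gcongr
            exact hM x
        _ = _ := by
            rw [ENNReal.ofReal_mul (by positivity), ENNReal.ofReal_mul (by norm_num)]
            simp [ENNReal.ofReal]
  have h2 : sqInt univ (strainField v) = sqInt (Metric.ball z (2 * ρ)) (strainField v) := by
    unfold sqInt
    rw [Measure.restrict_univ, ← lintegral_indicator measurableSet_ball]
    refine lintegral_congr fun x => ?_
    by_cases hx : x ∈ Metric.ball z (2 * ρ)
    · rw [indicator_of_mem hx]
    · rw [indicator_of_notMem hx]
      have hx' : x ∉ tsupport (χ : Plane → ℝ) := by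
        rw [χ.tsupport_eq]
        intro h
        refine hx (Metric.mem_ball.2 (lt_of_le_of_lt (Metric.mem_closedBall.1 h) ?_))
        change 3 / 2 * ρ < 2 * ρ
        linarith
      have hx'' : χ x = 0 := image_eq_zero_of_notMem_tsupport hx'
      have hx3 : fderiv ℝ χ x = 0 := by
        refine image_eq_zero_of_notMem_tsupport fun h => hx' (tsupport_fderiv_subset ℝ h)
      have : tensor (u x) 0 = 0 := by
        ext p
        simp [tensor]
      rw [strainField, hgv, hx'', hx3, this]
      simp
  rw [h1]
  calc sqInt (Metric.ball z ρ) (grad v) ≤ sqInt univ (grad v) := sqInt_mono_set (subset_univ _) _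
    _ ≤ 2 * sqInt univ (strainField v) := sqInt_grad_le_of_hasCompactSupport hv hvc
    _ ≤ 2 * (2 * sqInt (Metric.ball z (2 * ρ)) (strainField u)
        + 2 * ((2 * M.toNNReal) ^ 2 * sqInt (Metric.ball z (2 * ρ)) u)) := by
        rw [h2]
        gcongr
        unfold sqInt
        have m1 := ((continuous_strainField hu1).enorm.measurable.pow_const 2).const_mul (2 : ℝ≥0∞)
        rw [← lintegral_const_mul' 2 _ (by simp),
          ← lintegral_const_mul' ((2 * (M.toNNReal : ℝ≥0∞)) ^ 2) _ (by finiteness),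
          ← lintegral_const_mul' 2 _ (by simp), ← lintegral_add_left m1]
        exact lintegral_mono hpt
    _ ≤ 2 * ((2 + 2 * (2 * M.toNNReal) ^ 2) * sqInt (Metric.ball z (2 * ρ)) (strainField u)
        + (2 + 2 * (2 * M.toNNReal) ^ 2) * sqInt (Metric.ball z (2 * ρ)) u) := by
        rw [← mul_assoc 2 ((2 * (M.toNNReal : ℝ≥0∞)) ^ 2)]
        gcongr
        · exact le_self_add
        · exact le_add_self
    _ = _ := by
        push_cast
        ring

lemma sqInt_ball_comp_add_smul {E : Type*} [NormedAddCommGroup E] {F : Plane → E}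
    (hF : Continuous F) (z : Plane) {ρ : ℝ} (hρ : 0 < ρ) (t : ℝ) :
    sqInt (Metric.ball 0 t) (fun y => F (z + ρ • y))
      = ENNReal.ofReal (ρ ^ 2)⁻¹ * sqInt (Metric.ball z (t * ρ)) F := by
  have hm : Measurable fun x => ‖F x‖ₑ ^ 2 := Continuous.measurable (by fun_prop)
  unfold sqInt
  rw [← lintegral_indicator measurableSet_ball, ← lintegral_indicator measurableSet_ball,
    ← lintegral_comp_add_smul z hρ.ne' (hm.indicator measurableSet_ball)]
  refine lintegral_congr fun y => ?_
  have h : z + ρ • y ∈ Metric.ball z (t * ρ) ↔ y ∈ Metric.ball 0 t := by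
    rw [Metric.mem_ball, dist_eq_norm, add_sub_cancel_left, norm_smul, Real.norm_of_nonneg hρ.le,
      mem_ball_zero_iff, mul_comm, mul_lt_mul_iff_left₀ hρ]
  by_cases hy : y ∈ Metric.ball (0 : Plane) t
  · rw [indicator_of_mem hy, indicator_of_mem (h.2 hy)]
  · rw [indicator_of_notMem hy, indicator_of_notMem (fun h' => hy (h.1 h'))]

lemma sqInt_const_smul {E : Type*} [NormedAddCommGroup E] [NormedSpace ℝ E] (S : Set Plane)
    (c : ℝ) (F : Plane → E) : sqInt S (fun x => c • F x) = ‖c‖ₑ ^ 2 * sqInt S F := by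
  unfold sqInt
  rw [← lintegral_const_mul' _ _ (by simp)]
  simp_rw [enorm_smul, mul_pow]

/-- Scale invariant Korn inequality: the gradient is close to a constant skew matrix. -/
lemma exists_sqInt_grad_sub_skew_le : ∃ C : NNReal, ∀ u : Plane → Plane, ContDiff ℝ ∞ u →
    ∀ (z : Plane) (ρ : ℝ), 0 < ρ → ∃ c : ℝ,
      sqInt (Metric.ball z ρ) (fun x => grad u x - c • skewUnit)
        ≤ C * sqInt (Metric.ball z (2 * ρ)) (strainField u) := by
  obtain ⟨C₁, h₁⟩ := exists_sqInt_grad_ball_le 0 one_pos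
  obtain ⟨C₂, h₂⟩ := exists_rigid_sqInt_le
  refine ⟨C₁ * (1 + C₂), fun u hu z ρ hρ => ?_⟩
  have hu1 : ContDiff ℝ 1 u := hu.of_le (by simp)
  -- Rescaling to the unit ball multiplies gradient and strain by the same factor, so the constant
  -- depends neither on the centre nor on the radius.
  set v : Plane → Plane := fun y => u (z + ρ • y) with hv
  have hvs : ContDiff ℝ ∞ v := hu.comp (contDiff_const.add (contDiff_id.const_smul ρ))
  have hv1 : ContDiff ℝ 1 v := hvs.of_le (by simp)
  have hgv : ∀ y, grad v y = ρ • grad u (z + ρ • y) := by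
    intro y
    have hd : HasFDerivAt (fun y : Plane => z + ρ • y) (ρ • ContinuousLinearMap.id ℝ Plane) y :=
      ((hasFDerivAt_id y).const_smul ρ).const_add z
    have hd2 := (hu.differentiable (by simp) (z + ρ • y)).hasFDerivAt.comp y hd
    ext p
    simp only [grad]
    rw [show fderiv ℝ v y = _ from hd2.fderiv]
    simp
  obtain ⟨A, θ, hA⟩ := h₂ v hv1
  -- The gradient of `v` carries a factor `ρ`, which is undone in the rotation fitted to `v`.
  refine ⟨θ / ρ, ?_⟩
  have hr : ContDiff ℝ ∞ (v - rigid A θ) := hvs.sub (contDiff_rigid A θ)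
  have key := h₁ _ hr
  rw [mul_one, strainField_sub_rigid hv1] at key
  have e1 : grad (v - rigid A θ)
      = fun y => ρ • (fun x => grad u x - (θ / ρ) • skewUnit) (z + ρ • y) := by
    funext y
    rw [grad_sub hv1 (contDiff_rigid A θ), Pi.sub_apply, grad_rigid, hgv, smul_sub, smul_smul,
      mul_div_cancel₀ _ hρ.ne']
  have e2 : strainField v = fun y => ρ • strainField u (z + ρ • y) := by
    funext y
    rw [strainField, hgv, map_smul, strainField]
  have hcg := continuous_grad hu1
  have key2 := key.trans (mul_le_mul_right (add_le_add_right hA _) _)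
  rw [e1, sqInt_const_smul,
    sqInt_ball_comp_add_smul (F := fun x => grad u x - (θ / ρ) • skewUnit) (by fun_prop) z hρ,
    one_mul, e2,
    sqInt_const_smul, sqInt_ball_comp_add_smul (continuous_strainField hu1) z hρ, ← mul_assoc,
    ← mul_assoc (‖ρ‖ₑ ^ 2)] at key2
  have hone : ‖ρ‖ₑ ^ 2 * ENNReal.ofReal (ρ ^ 2)⁻¹ = 1 := by
    rw [enorm_sq_eq_ofReal, ← ENNReal.ofReal_mul (by positivity), Real.norm_eq_abs, sq_abs,
      mul_inv_cancel₀ (by positivity), ENNReal.ofReal_one]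
  rw [hone, one_mul, one_mul] at key2
  refine key2.trans (le_of_eq ?_)
  push_cast
  ring

/-! ### Interior estimates on connected sets -/

/-- `∫_S (|u|² + |∇u|²)`. -/
def h1Int (S : Set Plane) (u : Plane → Plane) : ℝ≥0∞ := sqInt S u + sqInt S (grad u)

lemma h1Int_mono_set {S T : Set Plane} (h : S ⊆ T) (u : Plane → Plane) : h1Int S u ≤ h1Int T u :=
  add_le_add (sqInt_mono_set h _) (sqInt_mono_set h _)

lemma sqInt_union_le {E : Type*} [NormedAddCommGroup E] (S T : Set Plane) (f : Plane → E) :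
    sqInt (S ∪ T) f ≤ sqInt S f + sqInt T f :=
  lintegral_union_le _ _ _

lemma h1Int_union_le (S T : Set Plane) (u : Plane → Plane) :
    h1Int (S ∪ T) u ≤ h1Int S u + h1Int T u := by
  unfold h1Int
  calc _ ≤ (sqInt S u + sqInt T u) + (sqInt S (grad u) + sqInt T (grad u)) :=
        add_le_add (sqInt_union_le _ _ _) (sqInt_union_le _ _ _)
    _ = _ := by ring

/-- Values in the small ball and the strain control the field in `L²` on the doubled ball, which by
the cutoff estimate controls the gradient on the ball itself. -/
lemma exists_h1Int_ball_le {U : Set Plane} {x y : Plane} {ρ s : ℝ} (hρ : 0 < ρ) (hs : 0 < s)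
    (hU : Metric.ball x (2 * ρ) ⊆ U) (hy : Metric.ball y s ⊆ Metric.ball x (2 * ρ)) :
    ∃ C : NNReal, ∀ u : Plane → Plane, ContDiff ℝ ∞ u →
      h1Int (Metric.ball x ρ) u ≤ C * (sqInt U (strainField u) + sqInt (Metric.ball y s) u) := by
  obtain ⟨C₁, h₁⟩ := exists_sqInt_le_of_ball_subset (convex_ball x (2 * ρ)) measurableSet_ball
    Metric.isBounded_ball hs hy
  obtain ⟨C₂, h₂⟩ := exists_sqInt_grad_ball_le x hρ
  refine ⟨C₁ + C₂ * (1 + C₁), fun u hu => ?_⟩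
  have k₁ := h₁ u (hu.of_le (by simp))
  have k₂ := h₂ u hu
  set B := sqInt (Metric.ball y s) u
  have hm := sqInt_mono_set hU (strainField u)
  have k₃ : sqInt (Metric.ball x (2 * ρ)) u ≤ C₁ * (sqInt U (strainField u) + B) :=
    k₁.trans (by gcongr)
  calc h1Int (Metric.ball x ρ) u
      ≤ C₁ * (sqInt U (strainField u) + B)
        + C₂ * ((sqInt U (strainField u) + B) + C₁ * (sqInt U (strainField u) + B)) := by
        refine add_le_add ?_ ?_
        · exact (sqInt_mono_set (Metric.ball_subset_ball (by linarith)) u).trans k₃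
        · refine k₂.trans ?_
          gcongr
          exact hm.trans le_self_add
    _ = _ := by
        push_cast
        ring

/-- Propagation by connectedness: the points near which the estimate holds form a set that is open
and relatively closed in `U`, and it contains `p`. -/
lemma exists_h1Int_le_of_mem {U : Set Plane} (hU : IsOpen U) (hc : IsPreconnected U) {p : Plane}
    {ρ₀ : ℝ} (hρ₀ : 0 < ρ₀) (hp : Metric.ball p ρ₀ ⊆ U) {x : Plane} (hx : x ∈ U) :
    ∃ ρ > 0, ∃ C : NNReal, ∀ u : Plane → Plane, ContDiff ℝ ∞ u → h1Int (Metric.ball x ρ) u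
      ≤ C * (sqInt U (strainField u) + sqInt (Metric.ball p ρ₀) u) := by
  let G : Set Plane := {x | ∃ ρ > 0, ∃ C : NNReal, ∀ u : Plane → Plane, ContDiff ℝ ∞ u →
    h1Int (Metric.ball x ρ) u ≤ C * (sqInt U (strainField u) + sqInt (Metric.ball p ρ₀) u)}
  have hG : IsOpen G := by
    rw [Metric.isOpen_iff]
    rintro x ⟨ρ, hρ, C, h⟩
    refine ⟨ρ, hρ, fun y hy => ⟨ρ - dist y x, sub_pos.2 hy, C, fun u hu => ?_⟩⟩
    exact (h1Int_mono_set (Metric.ball_subset_ball' (by linarith)) u).trans (h u hu)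
  have hpG : p ∈ G := by
    obtain ⟨C, h⟩ := exists_h1Int_ball_le (x := p) (y := p) (half_pos hρ₀) hρ₀
      (U := U) (by rwa [mul_div_cancel₀ _ two_ne_zero]) (by rw [mul_div_cancel₀ _ two_ne_zero])
    exact ⟨ρ₀ / 2, half_pos hρ₀, C, h⟩
  refine hc.subset_of_closure_inter_subset hG ⟨p, hp (Metric.mem_ball_self hρ₀), hpG⟩ ?_ hx
  rintro x ⟨hxc, hxU⟩
  obtain ⟨r, hr, hrU⟩ := Metric.isOpen_iff.1 hU x hxU
  -- A good point `y` close to a limit point `x` has a small ball of control inside the ball of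
  -- radius `r` about `x`. That ball serves as the reference ball for `x`.
  obtain ⟨y, ⟨ρ, hρ, C, h⟩, hxy⟩ := Metric.mem_closure_iff.1 hxc (r / 2) (half_pos hr)
  have hs : 0 < min ρ (r / 2) := lt_min hρ (half_pos hr)
  obtain ⟨C', h'⟩ := exists_h1Int_ball_le (x := x) (y := y) (half_pos hr) hs
    (U := U) (by rwa [mul_div_cancel₀ _ two_ne_zero]) (by
      rw [mul_div_cancel₀ _ two_ne_zero]
      refine Metric.ball_subset_ball' ?_
      rw [dist_comm]
      linarith [min_le_right ρ (r / 2)])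
  refine ⟨r / 2, half_pos hr, C' * (1 + C), fun u hu => (h' u hu).trans ?_⟩
  have h1 : sqInt (Metric.ball y (min ρ (r / 2))) u
      ≤ C * (sqInt U (strainField u) + sqInt (Metric.ball p ρ₀) u) :=
    le_trans (le_trans (sqInt_mono_set (Metric.ball_subset_ball (min_le_left _ _)) u) le_self_add)
      (h u hu)
  calc _ ≤ C' * ((sqInt U (strainField u) + sqInt (Metric.ball p ρ₀) u)
        + C * (sqInt U (strainField u) + sqInt (Metric.ball p ρ₀) u)) := by
        gcongr
        exact le_self_add
    _ = _ := by
        push_cast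
        ring

/-- On compact subsets of a connected open set `U`, a field is controlled in `H¹` by its strain in
`U` and its values in a fixed ball. -/
lemma exists_h1Int_compact_le {U K : Set Plane} (hU : IsOpen U) (hc : IsPreconnected U)
    {p : Plane} {ρ₀ : ℝ} (hρ₀ : 0 < ρ₀) (hp : Metric.ball p ρ₀ ⊆ U) (hK : IsCompact K)
    (hKU : K ⊆ U) :
    ∃ C : NNReal, ∀ u : Plane → Plane, ContDiff ℝ ∞ u → h1Int K u
      ≤ C * (sqInt U (strainField u) + sqInt (Metric.ball p ρ₀) u) := by
  refine hK.induction_on (p := fun S => ∃ C : NNReal, ∀ u : Plane → Plane, ContDiff ℝ ∞ u →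
    h1Int S u ≤ C * (sqInt U (strainField u) + sqInt (Metric.ball p ρ₀) u)) ?_ ?_ ?_ ?_
  · exact ⟨0, fun u _ => by simp [h1Int, sqInt]⟩
  · rintro S T hST ⟨C, h⟩
    exact ⟨C, fun u hu => (h1Int_mono_set hST u).trans (h u hu)⟩
  · rintro S T ⟨C, h⟩ ⟨C', h'⟩
    refine ⟨C + C', fun u hu => (h1Int_union_le S T u).trans ?_⟩
    rw [ENNReal.coe_add, add_mul]
    exact add_le_add (h u hu) (h' u hu)
  · intro x hx
    obtain ⟨ρ, hρ, h⟩ := exists_h1Int_le_of_mem hU hc hρ₀ hp (hKU hx)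
    exact ⟨_, mem_nhdsWithin_of_mem_nhds (Metric.ball_mem_nhds x hρ), h⟩

/-! ### Coordinates above a Lipschitz graph -/

section Chart

variable (L : Plane ≃ₗᵢ[ℝ] Plane) (γ : ℝ → ℝ)

/-- The height of a point above the graph of `γ` in the coordinates given by `L`. -/
def height (y : Plane) : ℝ := L y 1 - γ (L y 0)

/-- The point above `s` at height `h` over the graph of `γ`. -/
def chart (p : ℝ × ℝ) : Plane := L.symm !₂[p.1, γ p.1 + p.2]

/-- The upward direction. -/
def upDir : Plane := L.symm (unitVec 1)

lemma norm_upDir : ‖upDir L‖ = 1 := by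
  rw [upDir, LinearIsometryEquiv.norm_map, norm_unitVec]

@[simp] lemma base_chart (p : ℝ × ℝ) : L (chart L γ p) 0 = p.1 := by simp [chart]

@[simp] lemma height_chart (p : ℝ × ℝ) : height L γ (chart L γ p) = p.2 := by simp [chart, height]

lemma chart_base_height (y : Plane) : chart L γ (L y 0, height L γ y) = y := by
  rw [chart, LinearIsometryEquiv.symm_apply_eq]
  ext i
  fin_cases i <;> simp [height]

lemma chart_add (s h t : ℝ) : chart L γ (s, h + t) = chart L γ (s, h) + t • upDir L := by
  rw [chart, chart, upDir, ← map_smul, ← map_add]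
  congr 1
  ext i
  fin_cases i <;> simp [add_assoc]


variable {γ}

lemma continuous_height (hγ : Continuous γ) : Continuous (height L γ) := by
  unfold height
  fun_prop

lemma continuous_chart (hγ : Continuous γ) : Continuous (chart L γ) := by
  unfold chart
  fun_prop

lemma abs_coord_le (v : Plane) (i : Fin 2) : |v i| ≤ ‖v‖ := by
  simpa using PiLp.norm_apply_le v i

lemma abs_base_sub_le (y z : Plane) : |L y 0 - L z 0| ≤ ‖y - z‖ := by
  have h := abs_coord_le (L (y - z)) 0
  rwa [LinearIsometryEquiv.norm_map, map_sub, PiLp.sub_apply] at h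

lemma abs_height_sub_le {K : NNReal} (hγ : LipschitzWith K γ) (y z : Plane) :
    |height L γ y - height L γ z| ≤ (1 + K) * ‖y - z‖ := by
  have h1 := abs_coord_le (L (y - z)) 1
  rw [LinearIsometryEquiv.norm_map, map_sub, PiLp.sub_apply] at h1
  have h0 := abs_base_sub_le L y z
  have h2 : |γ (L y 0) - γ (L z 0)| ≤ K * ‖y - z‖ := by
    have := hγ.dist_le_mul (L y 0) (L z 0)
    rw [Real.dist_eq, Real.dist_eq] at this
    exact this.trans (by gcongr)
  unfold height
  rw [abs_le] at h1 h2 ⊢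
  constructor <;> linarith

/-- The chart is a vertical shear followed by an isometry. By Fubini the shear preserves area for
merely continuous `γ`, so the graph need not be differentiated. -/
lemma measurePreserving_chart (hγ : Continuous γ) :
    MeasurePreserving (chart L γ) (volume : Measure (ℝ × ℝ)) volume := by
  have h1 : MeasurePreserving (fun p : ℝ × ℝ => (p.1, γ p.1 + p.2)) volume volume := by
    refine MeasurePreserving.skew_product (f := fun s : ℝ => s) (g := fun s t => γ s + t)
      (MeasurePreserving.id _) ?_ ?_
    · exact Continuous.measurable (by fun_prop)
    · exact Eventually.of_forall fun s => map_add_left_eq_self volume (γ s)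
  have h2 : MeasurePreserving (MeasurableEquiv.finTwoArrow (α := ℝ)).symm volume volume :=
    (volume_preserving_finTwoArrow ℝ).symm _
  have h3 := PiLp.volume_preserving_toLp (Fin 2)
  have h4 := (L.symm.measurePreserving.comp h3).comp (h2.comp h1)
  exact h4

lemma lintegral_chart (hγ : Continuous γ) {f : Plane → ℝ≥0∞} (hf : Measurable f) :
    ∫⁻ y, f y = ∫⁻ s : ℝ, ∫⁻ h : ℝ, f (chart L γ (s, h)) := by
  rw [← (measurePreserving_chart L hγ).lintegral_comp hf, Measure.volume_eq_prod, lintegral_prod]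
  exact (hf.comp (continuous_chart L hγ).measurable).aemeasurable

/-- The points above the base set `I` whose height belongs to `J`. -/
def column (L : Plane ≃ₗᵢ[ℝ] Plane) (γ : ℝ → ℝ) (I J : Set ℝ) : Set Plane :=
  {y | L y 0 ∈ I ∧ height L γ y ∈ J}

lemma measurableSet_column (hγ : Continuous γ) {I J : Set ℝ} (hI : MeasurableSet I)
    (hJ : MeasurableSet J) : MeasurableSet (column L γ I J) := by
  have h0 : Continuous fun y => L y 0 := by fun_prop
  exact (h0.measurable hI).inter ((continuous_height L hγ).measurable hJ)

lemma setLIntegral_column (hγ : Continuous γ) {I J : Set ℝ} (hI : MeasurableSet I)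
    (hJ : MeasurableSet J) {f : Plane → ℝ≥0∞} (hf : Measurable f) :
    ∫⁻ y in column L γ I J, f y = ∫⁻ s in I, ∫⁻ h in J, f (chart L γ (s, h)) := by
  have hm := measurableSet_column L hγ hI hJ
  rw [← lintegral_indicator hm, lintegral_chart L hγ (hf.indicator hm), ← lintegral_indicator hI]
  refine lintegral_congr fun s => ?_
  by_cases hs : s ∈ I
  · rw [indicator_of_mem hs, ← lintegral_indicator hJ]
    refine lintegral_congr fun h => ?_
    by_cases hh : h ∈ J
    · rw [indicator_of_mem hh, indicator_of_mem (by simp [column, hs, hh])]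
    · rw [indicator_of_notMem hh, indicator_of_notMem (by simp [column, hh])]
  · rw [indicator_of_notMem hs]
    have : ∀ h, (column L γ I J).indicator f (chart L γ (s, h)) = 0 := fun h =>
      indicator_of_notMem (by simp [column, hs]) _
    simp [this]

/-- Dilation of the height by the factor `l`. -/
def dilate (L : Plane ≃ₗᵢ[ℝ] Plane) (γ : ℝ → ℝ) (l : ℝ) (y : Plane) : Plane :=
  y + ((l - 1) * height L γ y) • upDir L

lemma dilate_chart (l s h : ℝ) : dilate L γ l (chart L γ (s, h)) = chart L γ (s, l * h) := by
  rw [dilate, height_chart, ← chart_add]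
  congr 2
  ring

lemma continuous_dilate (hγ : Continuous γ) (l : ℝ) : Continuous (dilate L γ l) := by
  have := continuous_height L hγ
  unfold dilate
  fun_prop

/-- On each vertical line the dilation is multiplication by `l`. For `l > 1` the resulting factor is
below one, which is what later permits absorption. -/
lemma lintegral_comp_dilate (hγ : Continuous γ) {l : ℝ} (hl : 0 < l) {f : Plane → ℝ≥0∞}
    (hf : Measurable f) : ∫⁻ y, f (dilate L γ l y) = ENNReal.ofReal l⁻¹ * ∫⁻ y, f y := by
  rw [lintegral_chart L hγ (f := fun y => f (dilate L γ l y))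
      (hf.comp (continuous_dilate L hγ l).measurable),
    lintegral_chart L hγ hf, ← lintegral_const_mul' _ _ (by simp)]
  refine lintegral_congr fun s => ?_
  simp_rw [dilate_chart]
  have hg : Measurable fun h => f (chart L γ (s, h)) :=
    hf.comp (Continuous.measurable ((continuous_chart L hγ).comp (by fun_prop)))
  have := lintegral_map (μ := volume) hg (measurable_const_mul l)
  rw [← this, Real.map_volume_mul_left hl.ne', lintegral_smul_measure, smul_eq_mul,
    abs_of_pos (inv_pos.2 hl)]

end Chart

/-! ### Korn's inequality up to a Lipschitz graph -/

section Boundary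

variable (L : Plane ≃ₗᵢ[ℝ] Plane) {γ : ℝ → ℝ}

/-- `∫_P h(z)⁻² 1{|x - z| < c h(z)} dz`, where `h` is the height above the graph of `γ`. -/
def coneWeight (L : Plane ≃ₗᵢ[ℝ] Plane) (γ : ℝ → ℝ) (P : Set Plane) (c : ℝ) (x : Plane) : ℝ≥0∞ :=
  ∫⁻ z in P, {z | dist x z < c * height L γ z}.indicator
    (fun z => ENNReal.ofReal (height L γ z ^ 2)⁻¹) z

/-- Tonelli's theorem. Averaging over balls of radius proportional to the height replaces a Whitney
covering, and `coneWeight` plays the part of its overlap function. -/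
lemma lintegral_ball_height (hγ : Continuous γ) (P : Set Plane) (c : ℝ) {f : Plane → ℝ≥0∞}
    (hf : Measurable f) :
    ∫⁻ z in P, ENNReal.ofReal (height L γ z ^ 2)⁻¹ * ∫⁻ x in Metric.ball z (c * height L γ z), f x
      = ∫⁻ x, f x * coneWeight L γ P c x := by
  have hh := continuous_height L hγ
  have hw : Measurable fun z => ENNReal.ofReal (height L γ z ^ 2)⁻¹ :=
    ENNReal.measurable_ofReal.comp (hh.measurable.pow_const 2).inv
  have hE : MeasurableSet {p : Plane × Plane | dist p.2 p.1 < c * height L γ p.1} :=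
    (isOpen_lt (by fun_prop) (by fun_prop)).measurableSet
  have hF : Measurable fun p : Plane × Plane =>
      {p : Plane × Plane | dist p.2 p.1 < c * height L γ p.1}.indicator
        (fun p => ENNReal.ofReal (height L γ p.1 ^ 2)⁻¹ * f p.2) p :=
    ((hw.comp measurable_fst).mul (hf.comp measurable_snd)).indicator hE
  have e1 : ∀ z, ENNReal.ofReal (height L γ z ^ 2)⁻¹
        * ∫⁻ x in Metric.ball z (c * height L γ z), f x
      = ∫⁻ x, {p : Plane × Plane | dist p.2 p.1 < c * height L γ p.1}.indicator
        (fun p => ENNReal.ofReal (height L γ p.1 ^ 2)⁻¹ * f p.2) (z, x) := by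
    intro z
    rw [← lintegral_indicator measurableSet_ball, ← lintegral_const_mul' _ _ (by simp)]
    refine lintegral_congr fun x => ?_
    by_cases hx : dist x z < c * height L γ z
    · rw [indicator_of_mem (show x ∈ Metric.ball z _ from hx), indicator_of_mem (by exact hx)]
    · rw [indicator_of_notMem (show x ∉ Metric.ball z _ from hx),
        indicator_of_notMem (by exact hx), mul_zero]
  have e2 : ∀ x, f x * coneWeight L γ P c x
      = ∫⁻ z in P, {p : Plane × Plane | dist p.2 p.1 < c * height L γ p.1}.indicator
        (fun p => ENNReal.ofReal (height L γ p.1 ^ 2)⁻¹ * f p.2) (z, x) := by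
    intro x
    have hEx : MeasurableSet {z | dist x z < c * height L γ z} :=
      (isOpen_lt (by fun_prop) (by fun_prop)).measurableSet
    rw [coneWeight, ← lintegral_const_mul _ (hw.indicator hEx)]
    refine lintegral_congr fun z => ?_
    by_cases hx : dist x z < c * height L γ z
    · rw [indicator_of_mem (by exact hx), indicator_of_mem (by exact hx), mul_comm]
    · rw [indicator_of_notMem (by exact hx), indicator_of_notMem (by exact hx), mul_zero]
  simp_rw [e1, e2]
  exact lintegral_lintegral_swap hF.aemeasurable

variable {K : NNReal}

/-- The height is Lipschitz with constant `1 + K`, so with `κ * (1 + K) = 1 / 8` all points of the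
small ball about `x` have height comparable to that of `x`. The integrand is at least `(2h)⁻²` on a
ball of area proportional to `h²`. -/
lemma le_coneWeight (hγ : LipschitzWith K γ) {P : Set Plane} {κ : ℝ} (hκ : 0 < κ)
    (hκK : κ * (1 + K) = 1 / 8) {x : Plane} (hx : 0 < height L γ x)
    (hP : Metric.ball x (κ / 2 * height L γ x) ⊆ P) :
    ENNReal.ofReal (κ ^ 2 / 16) * volume (Metric.ball (0 : Plane) 1) ≤ coneWeight L γ P κ x := by
  set h := height L γ x with hdef
  have hz : ∀ z ∈ Metric.ball x (κ / 2 * h), dist x z < κ * height L γ z ∧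
      0 < height L γ z ∧ height L γ z ≤ 2 * h := by
    intro z hz
    have hd : ‖z - x‖ < κ / 2 * h := by rwa [← dist_eq_norm]
    have h1 := abs_le.1 (abs_height_sub_le L hγ z x)
    have h2 : (1 + (K : ℝ)) * ‖z - x‖ ≤ h / 16 := by
      calc (1 + (K : ℝ)) * ‖z - x‖ ≤ (1 + K) * (κ / 2 * h) := by gcongr
        _ = κ * (1 + K) * h / 2 := by ring
        _ = h / 16 := by rw [hκK]; ring
    have h3 : 15 / 16 * h ≤ height L γ z := by linarith
    refine ⟨?_, by linarith, by linarith⟩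
    rw [dist_comm, dist_eq_norm]
    nlinarith
  calc ENNReal.ofReal (κ ^ 2 / 16) * volume (Metric.ball (0 : Plane) 1)
      = ENNReal.ofReal ((2 * h) ^ 2)⁻¹ * volume (Metric.ball x (κ / 2 * h)) := by
        rw [Measure.addHaar_ball volume x (by positivity), finrank_euclideanSpace_fin, ← mul_assoc,
          ← ENNReal.ofReal_mul (by positivity)]
        congr 2
        field_simp
        ring
    _ = ∫⁻ _ in Metric.ball x (κ / 2 * h), ENNReal.ofReal ((2 * h) ^ 2)⁻¹ := by
        rw [setLIntegral_const]
    _ ≤ ∫⁻ z in Metric.ball x (κ / 2 * h), {z | dist x z < κ * height L γ z}.indicator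
          (fun z => ENNReal.ofReal (height L γ z ^ 2)⁻¹) z := by
        refine setLIntegral_mono' measurableSet_ball fun z hzb => ?_
        obtain ⟨h1, h2, h3⟩ := hz z hzb
        rw [indicator_of_mem (by exact h1)]
        refine ENNReal.ofReal_le_ofReal ?_
        gcongr
    _ ≤ _ := lintegral_mono_set hP

/-- Any centre `z` that reaches `y` has height between `2/3` and twice the height of `y`. It
therefore lies in a ball of radius `8 κ h`, on which the weight is at most `9/4 h⁻²`, and `144 = 64
* 9/4`. No centre reaches a point outside `U`. -/
lemma coneWeight_le (hγ : LipschitzWith K γ) {P U : Set Plane} (hP : MeasurableSet P) {κ : ℝ}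
    (hκ : 0 < κ) (hκK : κ * (1 + K) = 1 / 8) (hP0 : ∀ z ∈ P, 0 < height L γ z)
    (hPU : ∀ z ∈ P, Metric.ball z (4 * κ * height L γ z) ⊆ U) (y : Plane) :
    coneWeight L γ P (4 * κ) y
      ≤ U.indicator (fun _ => ENNReal.ofReal (144 * κ ^ 2) * volume (Metric.ball (0 : Plane) 1)) y := by
  have hz : ∀ z ∈ P, dist y z < 4 * κ * height L γ z →
      2 / 3 * height L γ y ≤ height L γ z ∧ height L γ z ≤ 2 * height L γ y := by
    intro z hzP hz
    have hd : ‖y - z‖ < 4 * κ * height L γ z := by rwa [← dist_eq_norm]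
    have h1 := abs_le.1 (abs_height_sub_le L hγ y z)
    have h2 : (1 + (K : ℝ)) * ‖y - z‖ ≤ height L γ z / 2 := by
      calc (1 + (K : ℝ)) * ‖y - z‖ ≤ (1 + K) * (4 * κ * height L γ z) := by gcongr
        _ = 4 * (κ * (1 + K)) * height L γ z := by ring
        _ = _ := by rw [hκK]; ring
    constructor <;> linarith
  by_cases hy : y ∈ U ∧ 0 < height L γ y
  · rw [indicator_of_mem hy.1]
    set h := height L γ y
    have hh : 0 < h := hy.2
    calc coneWeight L γ P (4 * κ) y
        ≤ ∫⁻ z in P, (Metric.ball y (8 * κ * h)).indicator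
            (fun _ => ENNReal.ofReal (9 / 4 * (h ^ 2)⁻¹)) z := by
          refine setLIntegral_mono' hP fun z hzP => ?_
          by_cases hd : dist y z < 4 * κ * height L γ z
          · obtain ⟨h1, h2⟩ := hz z hzP hd
            have hzb : z ∈ Metric.ball y (8 * κ * h) := by
              rw [Metric.mem_ball, dist_comm]
              nlinarith
            rw [indicator_of_mem (by exact hd), indicator_of_mem hzb]
            refine ENNReal.ofReal_le_ofReal ?_
            calc (height L γ z ^ 2)⁻¹ ≤ ((2 / 3 * h) ^ 2)⁻¹ := by gcongr
              _ = _ := by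
                field_simp
                ring
          · rw [indicator_of_notMem (by exact hd)]
            exact zero_le
      _ ≤ ∫⁻ z, (Metric.ball y (8 * κ * h)).indicator
            (fun _ => ENNReal.ofReal (9 / 4 * (h ^ 2)⁻¹)) z := setLIntegral_le_lintegral _ _
      _ = _ := by
          rw [lintegral_indicator measurableSet_ball, setLIntegral_const,
            Measure.addHaar_ball volume y (by positivity), finrank_euclideanSpace_fin, ← mul_assoc,
            ← ENNReal.ofReal_mul (by positivity)]
          congr 2
          field_simp
          ring
  · have h0 : coneWeight L γ P (4 * κ) y = 0 := by
      refine (setLIntegral_congr_fun hP (g := fun _ => (0 : ℝ≥0∞)) fun z hzP => ?_).trans (by simp)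
      have hn : ¬ dist y z < 4 * κ * height L γ z := fun hd =>
        hy ⟨hPU z hzP hd, by linarith [(hz z hzP hd).2, hP0 z hzP]⟩
      simp [hn]
    rw [h0]
    exact zero_le

/-- Near a point at height `h`, the gradients at `x` and at the dilated point differ by the strain
in a ball of radius comparable to `h`. -/
lemma lintegral_grad_sub_dilate_le {C : NNReal} (hC : ∀ u : Plane → Plane, ContDiff ℝ ∞ u →
    ∀ (z : Plane) (ρ : ℝ), 0 < ρ → ∃ c : ℝ,
      sqInt (Metric.ball z ρ) (fun x => grad u x - c • skewUnit)
        ≤ C * sqInt (Metric.ball z (2 * ρ)) (strainField u))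
    (hγ : LipschitzWith K γ) {κ : ℝ} (hκ : 0 < κ) (hκK : κ * (1 + K) = 1 / 8)
    {u : Plane → Plane} (hu : ContDiff ℝ ∞ u) {z : Plane} (hz : 0 < height L γ z) :
    sqInt (Metric.ball z (κ * height L γ z))
        (fun x => grad u x - grad u (dilate L γ (1 + κ / 2) x))
      ≤ 4 * C * sqInt (Metric.ball z (4 * κ * height L γ z)) (strainField u) := by
  set h := height L γ z with hdef
  -- The ball of radius `2 κ h` contains both the ball of radius `κ h` and its dilated image. One
  -- skew matrix approximates the gradient on both and cancels in the difference.
  obtain ⟨c, hc⟩ := hC u hu z (2 * κ * h) (by positivity)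
  rw [show 2 * (2 * κ * h) = 4 * κ * h by ring] at hc
  have hg := continuous_grad (φ := u) (hu.of_le (by simp))
  have hD := continuous_dilate L hγ.continuous (1 + κ / 2)
  set F : Plane → GradVal := fun x => grad u x - c • skewUnit with hF
  have hFc : Continuous F := by fun_prop
  have e : (fun x => grad u x - grad u (dilate L γ (1 + κ / 2) x))
      = F + fun x => (-F (dilate L γ (1 + κ / 2) x)) := by
    funext x
    simp only [hF, Pi.add_apply]
    abel
  have hin : ∀ x ∈ Metric.ball z (κ * h), dilate L γ (1 + κ / 2) x ∈ Metric.ball z (2 * κ * h) := by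
    intro x hx
    have hd : ‖x - z‖ < κ * h := by rwa [← dist_eq_norm]
    have h1 := abs_le.1 (abs_height_sub_le L hγ x z)
    have h2 : (1 + (K : ℝ)) * ‖x - z‖ ≤ h / 8 := by
      calc (1 + (K : ℝ)) * ‖x - z‖ ≤ (1 + K) * (κ * h) := by gcongr
        _ = κ * (1 + K) * h := by ring
        _ = _ := by rw [hκK]; ring
    have h3 : 0 < height L γ x := by linarith
    have h4 : ‖dilate L γ (1 + κ / 2) x - x‖ ≤ κ * h := by
      rw [dilate, add_sub_cancel_left, norm_smul, norm_upDir, mul_one, Real.norm_of_nonneg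
        (mul_nonneg (by linarith) h3.le)]
      nlinarith
    rw [Metric.mem_ball, dist_eq_norm]
    have h5 := norm_add_le (dilate L γ (1 + κ / 2) x - x) (x - z)
    rw [sub_add_sub_cancel] at h5
    linarith
  have h2 : sqInt (Metric.ball z (κ * h)) (fun x => -F (dilate L γ (1 + κ / 2) x))
      ≤ sqInt (Metric.ball z (2 * κ * h)) F := by
    have hm : Measurable fun x => ‖F x‖ₑ ^ 2 := Continuous.measurable (by fun_prop)
    calc sqInt (Metric.ball z (κ * h)) (fun x => -F (dilate L γ (1 + κ / 2) x))
        ≤ ∫⁻ x in Metric.ball z (κ * h), (Metric.ball z (2 * κ * h)).indicator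
            (fun x => ‖F x‖ₑ ^ 2) (dilate L γ (1 + κ / 2) x) := by
          refine setLIntegral_mono' measurableSet_ball fun x hx => ?_
          rw [indicator_of_mem (hin x hx), enorm_neg]
      _ ≤ _ := setLIntegral_le_lintegral _ _
      _ = ENNReal.ofReal (1 + κ / 2)⁻¹ * sqInt (Metric.ball z (2 * κ * h)) F := by
          rw [lintegral_comp_dilate L hγ.continuous (by positivity)
            (hm.indicator measurableSet_ball), lintegral_indicator measurableSet_ball]
          rfl
      _ ≤ 1 * sqInt (Metric.ball z (2 * κ * h)) F := by
          gcongr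
          rw [ENNReal.ofReal_le_one]
          exact inv_le_one_of_one_le₀ (by linarith)
      _ = _ := one_mul _
  rw [e]
  calc _ ≤ 2 * sqInt (Metric.ball z (κ * h)) F
        + 2 * sqInt (Metric.ball z (κ * h)) (fun x => -F (dilate L γ (1 + κ / 2) x)) :=
        sqInt_add_le hFc
    _ ≤ 2 * sqInt (Metric.ball z (2 * κ * h)) F + 2 * sqInt (Metric.ball z (2 * κ * h)) F := by
        gcongr
        exact sqInt_mono_set (Metric.ball_subset_ball (by nlinarith)) F
    _ = 4 * sqInt (Metric.ball z (2 * κ * h)) F := by ring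
    _ ≤ 4 * (C * sqInt (Metric.ball z (4 * κ * h)) (strainField u)) := by gcongr
    _ = _ := by ring

end Boundary

/-! ### Comparison with the lifted gradient, and absorption -/

section Boundary

variable (L : Plane ≃ₗᵢ[ℝ] Plane) {γ : ℝ → ℝ} {K : NNReal}

lemma ball_subset_column (hγ : LipschitzWith K γ) {s₀ a b H H' ρ : ℝ} {z : Plane}
    (hs : |L z 0 - s₀| < a) (hb : a + ρ ≤ b) (h0 : (1 + K) * ρ ≤ height L γ z)
    (h1 : height L γ z < H) (hH : H + (1 + K) * ρ ≤ H') :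
    Metric.ball z ρ ⊆ column L γ (Ioo (s₀ - b) (s₀ + b)) (Ioo 0 H') := by
  intro y hy
  have hd : ‖y - z‖ < ρ := by rwa [← dist_eq_norm]
  have k1 := abs_le.1 (abs_height_sub_le L hγ y z)
  have k2 := abs_le.1 (abs_base_sub_le L y z)
  have k3 : (1 + (K : ℝ)) * ‖y - z‖ < (1 + K) * ρ := by gcongr
  have k4 := abs_lt.1 hs
  refine ⟨⟨by linarith, by linarith⟩, by linarith, by linarith⟩

/-- The local estimates are integrated over all centres with weight `h⁻²`. The lower bound for
`coneWeight` recovers the integral on the left, and the upper bound limits the overlap on the right.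
Centres range over the column of twice the size, and their balls stay in the one of three times the
size. -/
lemma exists_sqInt_grad_sub_dilate_le (hγ : LipschitzWith K γ) {s₀ a H : ℝ} (hH : 0 < H)
    (hHa : H ≤ a) {U : Set Plane} (hU : MeasurableSet U)
    (hsub : column L γ (Ioo (s₀ - 3 * a) (s₀ + 3 * a)) (Ioo 0 (3 * H)) ⊆ U) {κ : ℝ} (hκ : 0 < κ)
    (hκK : κ * (1 + K) = 1 / 8) :
    ∃ C : NNReal, ∀ u : Plane → Plane, ContDiff ℝ ∞ u →
      sqInt (column L γ (Ioo (s₀ - a) (s₀ + a)) (Ioo 0 H))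
        (fun x => grad u x - grad u (dilate L γ (1 + κ / 2) x)) ≤ C * sqInt U (strainField u) := by
  obtain ⟨C, hC⟩ := exists_sqInt_grad_sub_skew_le
  set V := volume (Metric.ball (0 : Plane) 1) with hV
  have hVt : V ≠ ⊤ := measure_ball_lt_top.ne
  set q : ℝ≥0∞ := ENNReal.ofReal (κ ^ 2 / 16) * V with hq
  have hq0 : q ≠ 0 := mul_ne_zero (by
    rw [Ne, ENNReal.ofReal_eq_zero, not_le]
    positivity)
    (Metric.measure_ball_pos volume _ one_pos).ne'
  have hqt : q ≠ ⊤ := ENNReal.mul_ne_top (by simp) hVt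
  set M : ℝ≥0∞ := 4 * C * (ENNReal.ofReal (144 * κ ^ 2) * V) with hM
  have hMt : M ≠ ⊤ := ENNReal.mul_ne_top (ENNReal.mul_ne_top (by simp) (by simp))
    (ENNReal.mul_ne_top ENNReal.ofReal_ne_top hVt)
  refine ⟨(q⁻¹ * M).toNNReal, fun u hu => ?_⟩
  rw [ENNReal.coe_toNNReal (ENNReal.mul_ne_top (ENNReal.inv_ne_top.2 hq0) hMt), mul_assoc,
    ← ENNReal.div_eq_inv_mul, ENNReal.le_div_iff_mul_le (Or.inl hq0) (Or.inl hqt), mul_comm]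
  have hκ8 : κ ≤ 1 / 8 := by nlinarith [K.coe_nonneg]
  have hKc : ∀ t : ℝ, (1 + (K : ℝ)) * (κ * t) = t / 8 := by
    intro t
    rw [← mul_assoc, mul_comm _ κ, hκK]
    ring
  have hg := continuous_grad (φ := u) (hu.of_le (by simp))
  have hst := continuous_strainField (u := u) (hu.of_le (by simp))
  have hD := continuous_dilate L hγ.continuous (1 + κ / 2)
  set T : Plane → GradVal := fun x => grad u x - grad u (dilate L γ (1 + κ / 2) x) with hT
  have hTm : Measurable fun x => ‖T x‖ₑ ^ 2 := Continuous.measurable (by fun_prop)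
  have hSm : Measurable fun x => ‖strainField u x‖ₑ ^ 2 := Continuous.measurable (by fun_prop)
  set P := column L γ (Ioo (s₀ - 2 * a) (s₀ + 2 * a)) (Ioo 0 (2 * H)) with hP
  have hPm : MeasurableSet P :=
    measurableSet_column L hγ.continuous measurableSet_Ioo measurableSet_Ioo
  have hP0 : ∀ z ∈ P, 0 < height L γ z := fun z hz => hz.2.1
  have hPU : ∀ z ∈ P, Metric.ball z (4 * κ * height L γ z) ⊆ U := by
    intro z hz
    have h1 : height L γ z < 2 * H := hz.2.2
    have h0 := hP0 z hz
    have h2 : |L z 0 - s₀| < 2 * a := abs_lt.2 ⟨by linarith [hz.1.1], by linarith [hz.1.2]⟩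
    have h3 := hKc (4 * height L γ z)
    rw [show κ * (4 * height L γ z) = 4 * κ * height L γ z by ring] at h3
    refine (ball_subset_column L hγ h2 ?_ ?_ h1 ?_).trans hsub
    · nlinarith
    · linarith
    · linarith
  calc q * sqInt (column L γ (Ioo (s₀ - a) (s₀ + a)) (Ioo 0 H)) T
      = ∫⁻ x in column L γ (Ioo (s₀ - a) (s₀ + a)) (Ioo 0 H), ‖T x‖ₑ ^ 2 * q := by
        rw [mul_comm, lintegral_mul_const _ hTm]
        rfl
    _ ≤ ∫⁻ x in column L γ (Ioo (s₀ - a) (s₀ + a)) (Ioo 0 H),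
          ‖T x‖ₑ ^ 2 * coneWeight L γ P κ x := by
        refine setLIntegral_mono' (measurableSet_column L hγ.continuous measurableSet_Ioo
          measurableSet_Ioo) fun x hx => ?_
        gcongr
        have hx0 : 0 < height L γ x := hx.2.1
        have h1 : height L γ x < H := hx.2.2
        have h2 : |L x 0 - s₀| < a := abs_lt.2 ⟨by linarith [hx.1.1], by linarith [hx.1.2]⟩
        have h3 := hKc (height L γ x / 2)
        rw [show κ * (height L γ x / 2) = κ / 2 * height L γ x by ring] at h3
        refine le_coneWeight L hγ hκ hκK hx0 (ball_subset_column L hγ h2 ?_ ?_ h1 ?_)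
        · nlinarith
        · linarith
        · linarith
    _ ≤ ∫⁻ x, ‖T x‖ₑ ^ 2 * coneWeight L γ P κ x := setLIntegral_le_lintegral _ _
    _ = ∫⁻ z in P, ENNReal.ofReal (height L γ z ^ 2)⁻¹
          * sqInt (Metric.ball z (κ * height L γ z)) T :=
        (lintegral_ball_height L hγ.continuous P κ hTm).symm
    _ ≤ ∫⁻ z in P, 4 * C * (ENNReal.ofReal (height L γ z ^ 2)⁻¹
          * sqInt (Metric.ball z (4 * κ * height L γ z)) (strainField u)) := by
        refine setLIntegral_mono' hPm fun z hz => ?_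
        rw [mul_left_comm]
        gcongr
        exact lintegral_grad_sub_dilate_le L hC hγ hκ hκK hu (hP0 z hz)
    _ = 4 * C * ∫⁻ y, ‖strainField u y‖ₑ ^ 2 * coneWeight L γ P (4 * κ) y := by
        rw [lintegral_const_mul' _ _ (ENNReal.mul_ne_top (by simp) (by simp)),
          ← lintegral_ball_height L hγ.continuous P (4 * κ) hSm]
        rfl
    _ ≤ 4 * C * ∫⁻ y, U.indicator
          (fun y => ‖strainField u y‖ₑ ^ 2 * (ENNReal.ofReal (144 * κ ^ 2) * V)) y := by
        gcongr with y
        refine (mul_le_mul_right (coneWeight_le L hγ hPm hκ hκK hP0 hPU y) _).trans (le_of_eq ?_)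
        by_cases hy : y ∈ U
        · rw [indicator_of_mem hy, indicator_of_mem hy]
        · rw [indicator_of_notMem hy, indicator_of_notMem hy, mul_zero]
    _ = M * sqInt U (strainField u) := by
        rw [lintegral_indicator hU, lintegral_mul_const _ hSm, hM, sqInt]
        ring

lemma base_dilate (l : ℝ) (y : Plane) : L (dilate L γ l y) 0 = L y 0 := by
  conv_lhs => rw [← chart_base_height L γ y, dilate_chart, base_chart]

lemma height_dilate (l : ℝ) (y : Plane) : height L γ (dilate L γ l y) = l * height L γ y := by
  conv_lhs => rw [← chart_base_height L γ y, dilate_chart, height_chart]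

/-- Absorption of a term with factor below one. Finiteness of `I` is essential, since the inequality
says nothing when `I = ⊤`. -/
lemma le_of_le_mul_add {I R : ℝ≥0∞} (hI : I ≠ ⊤) {q : ℝ} (hq0 : 0 ≤ q) (hq : q < 1)
    (h : I ≤ ENNReal.ofReal q * I + R) : I ≤ ENNReal.ofReal (1 - q)⁻¹ * R := by
  by_cases hR : R = ⊤
  · rw [hR, ENNReal.mul_top]
    · exact le_top
    · simpa using hq
  lift I to NNReal using hI
  lift R to NNReal using hR
  have hq' : 0 < 1 - q := sub_pos.2 hq
  rw [← ENNReal.ofReal_coe_nnreal (p := I), ← ENNReal.ofReal_coe_nnreal (p := R)] at h ⊢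
  rw [← ENNReal.ofReal_mul hq0, ← ENNReal.ofReal_add (by positivity) (by positivity),
    ENNReal.ofReal_le_ofReal_iff (by positivity)] at h
  rw [← ENNReal.ofReal_mul (by positivity)]
  refine ENNReal.ofReal_le_ofReal ?_
  rw [inv_mul_eq_div, le_div_iff₀ hq']
  linarith

/-- Young's inequality with a coefficient arbitrarily close to one in front of `‖b‖ₑ ^ 2`, so that
the gain from the dilation survives. -/
lemma enorm_sq_le_add_mul {E : Type*} [NormedAddCommGroup E] {η : ℝ} (hη : 0 < η) (a b : E) :
    ‖a‖ₑ ^ 2 ≤ ENNReal.ofReal (1 + η) * ‖b‖ₑ ^ 2 + ENNReal.ofReal (1 + η⁻¹) * ‖a - b‖ₑ ^ 2 := by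
  simp only [enorm_sq_eq_ofReal]
  rw [← ENNReal.ofReal_mul (by positivity), ← ENNReal.ofReal_mul (by positivity),
    ← ENNReal.ofReal_add (by positivity) (by positivity)]
  refine ENNReal.ofReal_le_ofReal ?_
  have h1 : ‖a‖ ≤ ‖b‖ + ‖a - b‖ := by
    have := norm_add_le b (a - b)
    rwa [add_sub_cancel] at this
  have h2 : ‖a‖ ^ 2 ≤ (‖b‖ + ‖a - b‖) ^ 2 := by gcongr
  have h3 : 0 ≤ η⁻¹ * (η * ‖b‖ - ‖a - b‖) ^ 2 := by positivity
  have h4 : η⁻¹ * (η * ‖b‖ - ‖a - b‖) ^ 2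
      = η * ‖b‖ ^ 2 - 2 * ‖b‖ * ‖a - b‖ + η⁻¹ * ‖a - b‖ ^ 2 := by
    field_simp
    ring
  nlinarith

lemma isBounded_column (hγ : Continuous γ) {I J : Set ℝ} (hI : Bornology.IsBounded I)
    (hJ : Bornology.IsBounded J) : Bornology.IsBounded (column L γ I J) := by
  have h : column L γ I J ⊆ chart L γ '' (closure I ×ˢ closure J) := fun y hy =>
    ⟨(L y 0, height L γ y), ⟨subset_closure hy.1, subset_closure hy.2⟩, chart_base_height L γ y⟩
  exact ((hI.isCompact_closure.prod hJ.isCompact_closure).image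
    (continuous_chart L hγ)).isBounded.subset h

/-- Korn's inequality in a layer above a Lipschitz graph. -/
lemma exists_sqInt_grad_column_le (hγ : LipschitzWith K γ) {s₀ a H : ℝ} (hH : 0 < H)
    (hHa : H ≤ a) {U : Set Plane} (hU : MeasurableSet U)
    (hsub : column L γ (Ioo (s₀ - 3 * a) (s₀ + 3 * a)) (Ioo 0 (3 * H)) ⊆ U) :
    ∃ C : NNReal, ∀ u : Plane → Plane, ContDiff ℝ ∞ u →
      sqInt (column L γ (Ioo (s₀ - a) (s₀ + a)) (Ioo 0 H)) (grad u)
        ≤ C * (sqInt U (strainField u)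
          + sqInt (column L γ (Icc (s₀ - a) (s₀ + a)) (Icc H (2 * H))) (grad u)) := by
  obtain ⟨κ, hκdef⟩ : ∃ κ : ℝ, κ = (8 * (1 + (K : ℝ)))⁻¹ := ⟨_, rfl⟩
  have hK : 0 < 1 + (K : ℝ) := by positivity
  have hκ : 0 < κ := by rw [hκdef]; positivity
  have hκK : κ * (1 + K) = 1 / 8 := by
    rw [hκdef]
    field_simp
  have hκ8 : κ ≤ 1 / 8 := by nlinarith [K.coe_nonneg]
  obtain ⟨C, hC⟩ := exists_sqInt_grad_sub_dilate_le L hγ hH hHa hU hsub hκ hκK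
  obtain ⟨l, hl⟩ : ∃ l : ℝ, l = 1 + κ / 2 := ⟨_, rfl⟩
  rw [← hl] at hC
  have hl1 : 1 < l := by linarith
  have hl2 : l < 2 := by linarith
  obtain ⟨η, hη⟩ : ∃ η : ℝ, η = (l - 1) / 2 := ⟨_, rfl⟩
  have hη0 : 0 < η := by linarith
  -- The dilation gains `l⁻¹` and Young's inequality loses `1 + η`. With `η = (l - 1) / 2` the
  -- product stays below one.
  set q : ℝ := (1 + η) * l⁻¹ with hqdef
  have hq0 : 0 ≤ q := by positivity
  have hq1 : q < 1 := by
    rw [hqdef, ← div_eq_mul_inv, div_lt_one (by linarith)]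
    linarith
  refine ⟨(1 - q)⁻¹.toNNReal * (1 + (1 + η⁻¹).toNNReal * C), fun u hu => ?_⟩
  set P := column L γ (Ioo (s₀ - a) (s₀ + a)) (Ioo 0 H) with hP
  set Q := column L γ (Icc (s₀ - a) (s₀ + a)) (Icc H (2 * H)) with hQ
  have hg := continuous_grad (φ := u) (hu.of_le (by simp))
  have hD := continuous_dilate L hγ.continuous l
  have hPm : MeasurableSet P :=
    measurableSet_column L hγ.continuous measurableSet_Ioo measurableSet_Ioo
  have hgm : Measurable fun x => ‖grad u x‖ₑ ^ 2 := Continuous.measurable (by fun_prop)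
  -- Since `l < 2`, the dilated layer exceeds `P` only by points of the higher layer `Q`, which
  -- stays away from the graph.
  have hdil : ∫⁻ x in P, ‖grad u (dilate L γ l x)‖ₑ ^ 2
      ≤ ENNReal.ofReal l⁻¹ * (sqInt P (grad u) + sqInt Q (grad u)) := by
    set P' := column L γ (Ioo (s₀ - a) (s₀ + a)) (Ioo 0 (l * H)) with hP'
    have hPm' : MeasurableSet P' :=
      measurableSet_column L hγ.continuous measurableSet_Ioo measurableSet_Ioo
    calc ∫⁻ x in P, ‖grad u (dilate L γ l x)‖ₑ ^ 2
        ≤ ∫⁻ x in P, P'.indicator (fun x => ‖grad u x‖ₑ ^ 2) (dilate L γ l x) := by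
          refine setLIntegral_mono' hPm fun x hx => ?_
          rw [indicator_of_mem]
          refine ⟨?_, ?_⟩
          · rw [base_dilate]
            exact hx.1
          · rw [height_dilate]
            exact ⟨mul_pos (by linarith) hx.2.1, by nlinarith [hx.2.2]⟩
      _ ≤ _ := setLIntegral_le_lintegral _ _
      _ = ENNReal.ofReal l⁻¹ * sqInt P' (grad u) := by
          rw [lintegral_comp_dilate L hγ.continuous (by linarith) (hgm.indicator hPm'),
            lintegral_indicator hPm']
          rfl
      _ ≤ _ := by
          gcongr
          refine (sqInt_mono_set (fun y hy => ?_) _).trans (sqInt_union_le P Q (grad u))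
          rcases lt_or_ge (height L γ y) H with h | h
          · exact Or.inl ⟨hy.1, hy.2.1, h⟩
          · exact Or.inr ⟨Ioo_subset_Icc_self hy.1, h, by nlinarith [hy.2.2]⟩
  -- The field is smooth on the whole plane and the layer is bounded, so the quantity to be absorbed
  -- is finite.
  have hfin : sqInt P (grad u) ≠ ⊤ := (sqInt_lt_top (isBounded_column L hγ.continuous
    (Metric.isBounded_Ioo _ _) (Metric.isBounded_Ioo _ _)) hg).ne
  have key : sqInt P (grad u) ≤ ENNReal.ofReal q * sqInt P (grad u)
      + (sqInt Q (grad u) + ENNReal.ofReal (1 + η⁻¹) * (C * sqInt U (strainField u))) := by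
    calc sqInt P (grad u) ≤ ∫⁻ x in P, (ENNReal.ofReal (1 + η) * ‖grad u (dilate L γ l x)‖ₑ ^ 2
          + ENNReal.ofReal (1 + η⁻¹) * ‖grad u x - grad u (dilate L γ l x)‖ₑ ^ 2) :=
          lintegral_mono fun x => enorm_sq_le_add_mul hη0 _ _
      _ = ENNReal.ofReal (1 + η) * (∫⁻ x in P, ‖grad u (dilate L γ l x)‖ₑ ^ 2)
          + ENNReal.ofReal (1 + η⁻¹) * sqInt P (fun x => grad u x - grad u (dilate L γ l x)) := by
          rw [lintegral_add_left, lintegral_const_mul' _ _ (by simp),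
            lintegral_const_mul' _ _ (by simp)]
          · rfl
          · exact Measurable.const_mul (Continuous.measurable (by fun_prop)) _
      _ ≤ ENNReal.ofReal (1 + η) * (ENNReal.ofReal l⁻¹ * (sqInt P (grad u) + sqInt Q (grad u)))
          + ENNReal.ofReal (1 + η⁻¹) * (C * sqInt U (strainField u)) := by
          gcongr
          exact hC u hu
      _ = ENNReal.ofReal q * sqInt P (grad u) + (ENNReal.ofReal q * sqInt Q (grad u)
          + ENNReal.ofReal (1 + η⁻¹) * (C * sqInt U (strainField u))) := by
          rw [hqdef, ENNReal.ofReal_mul (by positivity)]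
          ring
      _ ≤ _ := by
          gcongr
          calc _ ≤ 1 * sqInt Q (grad u) := by
                gcongr
                simpa using hq1.le
            _ = _ := one_mul _
  refine (le_of_le_mul_add hfin hq0 hq1 key).trans ?_
  rw [ENNReal.coe_mul, mul_assoc]
  change _ * _ ≤ ENNReal.ofReal (1 - q)⁻¹ * _
  gcongr
  push_cast
  change _ ≤ (1 + ENNReal.ofReal (1 + η⁻¹) * C) * _
  calc _ ≤ (sqInt U (strainField u) + sqInt Q (grad u)) + ENNReal.ofReal (1 + η⁻¹)
        * (C * (sqInt U (strainField u) + sqInt Q (grad u))) := by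
        gcongr
        · exact le_add_self
        · exact le_self_add
    _ = _ := by ring

end Boundary

/-! ### From the gradient to the field and its trace, along vertical lines -/

section Boundary

variable (L : Plane ≃ₗᵢ[ℝ] Plane) {γ : ℝ → ℝ} {K : NNReal}

/-- In the chart, points over a fixed base point form a straight line in the upward direction, so
the fundamental theorem of calculus applies without differentiating `γ`. -/
lemma enorm_chart_sub_le {u : Plane → Plane} (hu : ContDiff ℝ 1 u) (s : ℝ) {H h k : ℝ}
    (hh : h ∈ Icc 0 (2 * H)) (hk : k ∈ Icc 0 (2 * H)) :
    ‖u (chart L γ (s, h)) - u (chart L γ (s, k))‖ₑ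
      ≤ ∫⁻ t in Ioo 0 (2 * H), ‖grad u (chart L γ (s, t))‖ₑ := by
  have hch : ∀ t, chart L γ (s, t) = chart L γ (s, 0) + t • upDir L := by
    intro t
    rw [← chart_add, zero_add]
  have hd : ∀ t : ℝ, HasDerivAt (fun t => u (chart L γ (s, t)))
      (fderiv ℝ u (chart L γ (s, t)) (upDir L)) t := by
    intro t
    have h1 : HasDerivAt (fun t : ℝ => chart L γ (s, t)) (upDir L) t := by
      rw [show (fun t : ℝ => chart L γ (s, t)) = fun t => chart L γ (s, 0) + t • upDir L from
        funext hch]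
      simpa using ((hasDerivAt_id t).smul_const (upDir L)).const_add (chart L γ (s, 0))
    exact (hu.differentiable (by simp) _).hasFDerivAt.comp_hasDerivAt t h1
  have hc : Continuous fun t : ℝ => fderiv ℝ u (chart L γ (s, t)) (upDir L) := by
    have hfd := hu.continuous_fderiv (by simp)
    have hcc : Continuous fun t : ℝ => chart L γ (s, t) := by
      rw [show (fun t : ℝ => chart L γ (s, t)) = fun t => chart L γ (s, 0) + t • upDir L from
        funext hch]
      fun_prop
    fun_prop
  rw [← intervalIntegral.integral_eq_sub_of_hasDerivAt (fun t _ => hd t)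
    (hc.intervalIntegrable _ _), ← ofReal_norm, intervalIntegral.norm_intervalIntegral_eq,
    ofReal_norm]
  refine (enorm_integral_le_lintegral_enorm _).trans ?_
  rw [restrict_Ioo_eq_restrict_Ioc]
  have hsub : uIoc k h ⊆ Ioc 0 (2 * H) := by
    exact Ioc_subset_Ioc (le_min hk.1 hh.1) (max_le hk.2 hh.2)
  refine (lintegral_mono_set hsub).trans (lintegral_mono fun t => ?_)
  rw [← ofReal_norm, ← ofReal_norm]
  refine ENNReal.ofReal_le_ofReal ((norm_fderiv_apply_le _ _ _).trans ?_)
  rw [norm_upDir, mul_one]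

/-- The value at height `h` is compared with all values at heights in `Icc H (2 * H)`, an interval
of length `H`, and the comparison is averaged. The choice `h = 0` later yields the trace. -/
lemma mul_enorm_chart_sq_le {u : Plane → Plane} (hu : ContDiff ℝ 1 u) (hγ : Continuous γ) (s : ℝ)
    {H h : ℝ} (hH : 0 < H) (hh : h ∈ Icc 0 (2 * H)) :
    ENNReal.ofReal H * ‖u (chart L γ (s, h))‖ₑ ^ 2
      ≤ 2 * (∫⁻ t in Icc H (2 * H), ‖u (chart L γ (s, t))‖ₑ ^ 2)
        + ENNReal.ofReal (4 * H ^ 2) * ∫⁻ t in Ioo 0 (2 * H), ‖grad u (chart L γ (s, t))‖ₑ ^ 2 := by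
  have hgc := continuous_grad hu
  have huc := hu.continuous
  have hcc := continuous_chart L hγ
  have hgm : Measurable fun t => ‖grad u (chart L γ (s, t))‖ₑ := Continuous.measurable (by fun_prop)
  set J := ∫⁻ t in Ioo 0 (2 * H), ‖grad u (chart L γ (s, t))‖ₑ ^ 2 with hJ
  have hk : ∀ k ∈ Icc H (2 * H), ‖u (chart L γ (s, h))‖ₑ ^ 2
      ≤ 2 * ‖u (chart L γ (s, k))‖ₑ ^ 2 + 2 * (ENNReal.ofReal (2 * H) * J) := by
    intro k hk
    have h1 := enorm_chart_sub_le L (γ := γ) hu s hh (k := k) ⟨hH.le.trans hk.1, hk.2⟩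
    have h2 := enorm_add_sq_le (u (chart L γ (s, k)))
      (u (chart L γ (s, h)) - u (chart L γ (s, k)))
    rw [add_sub_cancel] at h2
    refine h2.trans ?_
    gcongr
    refine (pow_le_pow_left₀ (zero_le) h1 2).trans ((lintegral_sq_le _ hgm.aemeasurable).trans ?_)
    simp [hJ]
  calc ENNReal.ofReal H * ‖u (chart L γ (s, h))‖ₑ ^ 2
      = ∫⁻ _ in Icc H (2 * H), ‖u (chart L γ (s, h))‖ₑ ^ 2 := by
        rw [setLIntegral_const, Real.volume_Icc, mul_comm]
        congr 2
        ring
    _ ≤ ∫⁻ k in Icc H (2 * H), (2 * ‖u (chart L γ (s, k))‖ₑ ^ 2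
          + 2 * (ENNReal.ofReal (2 * H) * J)) := setLIntegral_mono' measurableSet_Icc hk
    _ = _ := by
        rw [lintegral_add_right _ measurable_const, lintegral_const_mul' _ _ (by simp),
          setLIntegral_const, Real.volume_Icc]
        congr 1
        rw [show (4 : ℝ) * H ^ 2 = 2 * ((2 * H) * (2 * H - H)) by ring,
          ENNReal.ofReal_mul zero_le_two (q := (2 * H) * (2 * H - H)),
          ENNReal.ofReal_mul (p := 2 * H) (by positivity), ENNReal.ofReal_ofNat]
        ring

lemma lintegral_chart_slices {u : Plane → Plane} (hu : ContDiff ℝ 1 u) (hγ : Continuous γ)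
    {I : Set ℝ} (hI : MeasurableSet I) (H : ℝ) :
    ∫⁻ s in I, (2 * (∫⁻ t in Icc H (2 * H), ‖u (chart L γ (s, t))‖ₑ ^ 2)
        + ENNReal.ofReal (4 * H ^ 2) * ∫⁻ t in Ioo 0 (2 * H), ‖grad u (chart L γ (s, t))‖ₑ ^ 2)
      = 2 * sqInt (column L γ I (Icc H (2 * H))) u
        + ENNReal.ofReal (4 * H ^ 2) * sqInt (column L γ I (Ioo 0 (2 * H))) (grad u) := by
  have hgc := continuous_grad hu
  have huc := hu.continuous
  have hcc := continuous_chart L hγ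
  have h1 : Measurable fun s => ∫⁻ t in Icc H (2 * H), ‖u (chart L γ (s, t))‖ₑ ^ 2 := by
    have : Measurable fun p : ℝ × ℝ => ‖u (chart L γ (p.1, p.2))‖ₑ ^ 2 :=
      Continuous.measurable (by fun_prop)
    exact this.lintegral_prod_right'
  unfold sqInt
  rw [setLIntegral_column L hγ hI measurableSet_Icc (Continuous.measurable (by fun_prop)),
    setLIntegral_column L hγ hI measurableSet_Ioo (Continuous.measurable (by fun_prop)),
    lintegral_add_left (h1.const_mul 2), lintegral_const_mul' _ _ (by simp),
    lintegral_const_mul' _ _ ENNReal.ofReal_ne_top]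

lemma sqInt_column_le {u : Plane → Plane} (hu : ContDiff ℝ 1 u) (hγ : Continuous γ)
    {I : Set ℝ} (hI : MeasurableSet I) {H : ℝ} (hH : 0 < H) :
    sqInt (column L γ I (Ioo 0 H)) u ≤ 2 * sqInt (column L γ I (Icc H (2 * H))) u
        + ENNReal.ofReal (4 * H ^ 2) * sqInt (column L γ I (Ioo 0 (2 * H))) (grad u) := by
  have huc := hu.continuous
  have hcc := continuous_chart L hγ
  rw [← lintegral_chart_slices L hu hγ hI]
  unfold sqInt
  rw [setLIntegral_column L hγ hI measurableSet_Ioo (Continuous.measurable (by fun_prop))]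
  refine lintegral_mono fun s => ?_
  have hp : ENNReal.ofReal H ≠ 0 := by simpa using hH
  rw [← ENNReal.mul_le_mul_iff_right hp ENNReal.ofReal_ne_top,
    ← lintegral_const_mul' _ _ (by simp)]
  calc _ ≤ ∫⁻ _ in Ioo 0 H, (2 * (∫⁻ t in Icc H (2 * H), ‖u (chart L γ (s, t))‖ₑ ^ 2)
        + ENNReal.ofReal (4 * H ^ 2)
          * ∫⁻ t in Ioo 0 (2 * H), ‖grad u (chart L γ (s, t))‖ₑ ^ 2) := by
        refine setLIntegral_mono measurable_const fun h hh => ?_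
        exact mul_enorm_chart_sq_le L hu hγ s hH ⟨hh.1.le, by linarith [hh.2]⟩
    _ = _ := by
        rw [setLIntegral_const, Real.volume_Ioo, sub_zero, mul_comm]

lemma lipschitzWith_chart_zero (hγ : LipschitzWith K γ) :
    LipschitzWith (1 + K) fun s => chart L γ (s, 0) := by
  refine LipschitzWith.of_dist_le_mul fun s t => ?_
  rw [chart, chart, LinearIsometryEquiv.dist_map, dist_eq_norm, Real.dist_eq]
  have h := hγ.dist_le_mul s t
  rw [Real.dist_eq, Real.dist_eq] at h
  refine abs_le_of_sq_le_sq' ?_ (by positivity) |>.2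
  rw [norm_plane_sq]
  simp only [PiLp.sub_apply, Matrix.cons_val_zero, Matrix.cons_val_one, add_zero]
  push_cast
  have h2 : (γ s - γ t) ^ 2 ≤ (K * |s - t|) ^ 2 := sq_le_sq' (by linarith [(abs_le.1 h).1])
    (by linarith [(abs_le.1 h).2])
  nlinarith [sq_abs (s - t), sq_nonneg (s - t), K.coe_nonneg,
    mul_nonneg K.coe_nonneg (sq_nonneg (s - t))]

/-- A Lipschitz parametrisation increases length by at most its Lipschitz constant. Only this upper
bound on arc length is needed for the trace estimate. -/
lemma hausdorff_restrict_graph_le (hγ : LipschitzWith K γ) (I : Set ℝ) :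
    (Measure.hausdorffMeasure 1).restrict (column L γ I {0})
      ≤ ((1 + K : NNReal) : ℝ≥0∞) • Measure.map (fun s => chart L γ (s, 0)) (volume.restrict I) := by
  have hl := lipschitzWith_chart_zero L hγ
  have hm : Measurable fun s => chart L γ (s, 0) := hl.continuous.measurable
  refine Measure.le_iff.2 fun E hE => ?_
  rw [Measure.restrict_apply hE, Measure.smul_apply, Measure.map_apply hm hE,
    Measure.restrict_apply (hm hE)]
  have hsub : E ∩ column L γ I {0}
      ⊆ (fun s => chart L γ (s, 0)) '' ((fun s => chart L γ (s, 0)) ⁻¹' E ∩ I) := by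
    rintro y ⟨hyE, hyI, hy0⟩
    have he : chart L γ (L y 0, 0) = y := by
      conv_rhs => rw [← chart_base_height L γ y, show height L γ y = 0 from hy0]
    refine ⟨L y 0, ⟨?_, hyI⟩, he⟩
    rw [mem_preimage, he]
    exact hyE
  refine (measure_mono hsub).trans ?_
  have h := (hl.lipschitzOnWith (s := (fun s => chart L γ (s, 0)) ⁻¹' E ∩ I)).hausdorffMeasure_image_le
    (d := 1) zero_le_one
  rw [hausdorffMeasure_real, ENNReal.rpow_one] at h
  exact h

lemma mul_lintegral_graph_le {u : Plane → Plane} (hu : ContDiff ℝ 1 u) (hγ : LipschitzWith K γ)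
    {I : Set ℝ} (hI : MeasurableSet I) {H : ℝ} (hH : 0 < H) :
    ENNReal.ofReal H * ∫⁻ y in column L γ I {0}, ‖u y‖ₑ ^ 2 ∂(Measure.hausdorffMeasure 1)
      ≤ (1 + K : NNReal) * (2 * sqInt (column L γ I (Icc H (2 * H))) u
        + ENNReal.ofReal (4 * H ^ 2) * sqInt (column L γ I (Ioo 0 (2 * H))) (grad u)) := by
  have huc := hu.continuous
  have hm : Measurable fun s => chart L γ (s, 0) := (lipschitzWith_chart_zero L hγ).continuous.measurable
  rw [← lintegral_chart_slices L hu hγ.continuous hI]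
  calc _ ≤ ENNReal.ofReal H * ∫⁻ y, ‖u y‖ₑ ^ 2 ∂(((1 + K : NNReal) : ℝ≥0∞) •
        Measure.map (fun s => chart L γ (s, 0)) (volume.restrict I)) := by
        gcongr
        exact hausdorff_restrict_graph_le L hγ I
    _ = (1 + K : NNReal) * ∫⁻ s in I, ENNReal.ofReal H * ‖u (chart L γ (s, 0))‖ₑ ^ 2 := by
        rw [lintegral_smul_measure, lintegral_map (Continuous.measurable (by fun_prop)) hm,
          lintegral_const_mul' _ _ (by simp), smul_eq_mul, mul_left_comm]
    _ ≤ _ := by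
        gcongr with s
        exact mul_enorm_chart_sq_le L hu hγ.continuous s hH ⟨le_rfl, by linarith⟩

/-- `H¹` and trace estimates in a layer above a Lipschitz graph. -/
lemma exists_h1Int_column_le (hγ : LipschitzWith K γ) {s₀ a H : ℝ} (hH : 0 < H)
    (hHa : H ≤ a) {U : Set Plane} (hU : MeasurableSet U)
    (hsub : column L γ (Ioo (s₀ - 3 * a) (s₀ + 3 * a)) (Ioo 0 (3 * H)) ⊆ U) :
    ∃ C : NNReal, ∀ u : Plane → Plane, ContDiff ℝ ∞ u →
      h1Int (column L γ (Ioo (s₀ - a) (s₀ + a)) (Ioo 0 H)) u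
        ≤ C * (sqInt U (strainField u)
          + h1Int (column L γ (Icc (s₀ - a) (s₀ + a)) (Icc H (2 * H))) u) ∧
      ∫⁻ y in column L γ (Ioo (s₀ - a) (s₀ + a)) {0}, ‖u y‖ₑ ^ 2 ∂(Measure.hausdorffMeasure 1)
        ≤ C * (sqInt U (strainField u)
          + h1Int (column L γ (Icc (s₀ - a) (s₀ + a)) (Icc H (2 * H))) u) := by
  obtain ⟨C, hC⟩ := exists_sqInt_grad_column_le L hγ hH hHa hU hsub
  set b : NNReal := (4 * H ^ 2).toNNReal with hb
  set M : NNReal := 2 + b * (C + 1) with hM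
  refine ⟨C + M + H⁻¹.toNNReal * ((1 + K) * M), fun u hu => ?_⟩
  have hu1 : ContDiff ℝ 1 u := hu.of_le (by simp)
  set P := column L γ (Ioo (s₀ - a) (s₀ + a)) (Ioo 0 H) with hP
  set Q := column L γ (Icc (s₀ - a) (s₀ + a)) (Icc H (2 * H)) with hQ
  set Z := sqInt U (strainField u) + h1Int Q u with hZ
  have hg : sqInt P (grad u) ≤ C * Z := (hC u hu).trans (by
    gcongr
    exact add_le_add_right (le_add_self : _ ≤ h1Int Q u) _)
  have hQu : sqInt (column L γ (Ioo (s₀ - a) (s₀ + a)) (Icc H (2 * H))) u ≤ Z :=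
    (sqInt_mono_set (T := Q) (fun y hy => ⟨Ioo_subset_Icc_self hy.1, hy.2⟩) u).trans
      (le_trans (le_self_add : _ ≤ h1Int Q u) le_add_self)
  have hQg : sqInt (column L γ (Ioo (s₀ - a) (s₀ + a)) (Ioo 0 (2 * H))) (grad u) ≤ (C + 1) * Z := by
    refine (sqInt_mono_set (T := P ∪ Q) (fun y hy => ?_) _).trans
      ((sqInt_union_le P Q (grad u)).trans ?_)
    · rcases lt_or_ge (height L γ y) H with h | h
      · exact Or.inl ⟨hy.1, hy.2.1, h⟩
      · exact Or.inr ⟨Ioo_subset_Icc_self hy.1, h, hy.2.2.le⟩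
    · rw [add_mul, one_mul]
      exact add_le_add hg (le_trans (le_add_self : _ ≤ h1Int Q u) le_add_self)
  have hR : 2 * sqInt (column L γ (Ioo (s₀ - a) (s₀ + a)) (Icc H (2 * H))) u
      + ENNReal.ofReal (4 * H ^ 2)
        * sqInt (column L γ (Ioo (s₀ - a) (s₀ + a)) (Ioo 0 (2 * H))) (grad u) ≤ M * Z := by
    calc _ ≤ 2 * Z + ENNReal.ofReal (4 * H ^ 2) * ((C + 1) * Z) := by gcongr
      _ = _ := by
          rw [hM, hb]
          push_cast
          change _ = (2 + ENNReal.ofReal (4 * H ^ 2) * (C + 1)) * Z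
          ring
  have hu2 := (sqInt_column_le L hu1 hγ.continuous measurableSet_Ioo hH
    (I := Ioo (s₀ - a) (s₀ + a))).trans hR
  have htr := (mul_lintegral_graph_le L hu1 hγ (measurableSet_Ioo (a := s₀ - a) (b := s₀ + a))
    hH).trans (mul_le_mul_right hR _)
  constructor
  · calc h1Int P u ≤ M * Z + C * Z := add_le_add hu2 hg
      _ ≤ M * Z + C * Z + H⁻¹.toNNReal * ((1 + K : NNReal) * M) * Z := le_self_add
      _ = _ := by
          push_cast
          ring
  · have hp : ENNReal.ofReal H ≠ 0 := by simpa using hH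
    rw [← ENNReal.mul_le_mul_iff_right hp ENNReal.ofReal_ne_top]
    refine htr.trans ?_
    have h1 : ENNReal.ofReal H * (H⁻¹.toNNReal : ℝ≥0∞) = 1 := by
      change ENNReal.ofReal H * ENNReal.ofReal H⁻¹ = 1
      rw [← ENNReal.ofReal_mul hH.le, mul_inv_cancel₀ hH.ne', ENNReal.ofReal_one]
    calc _ = ENNReal.ofReal H * H⁻¹.toNNReal * ((1 + K : NNReal) * (M * Z)) := by rw [h1, one_mul]
      _ ≤ ENNReal.ofReal H * ((C + M) * Z)
          + ENNReal.ofReal H * H⁻¹.toNNReal * ((1 + K : NNReal) * (M * Z)) := le_add_self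
      _ = _ := by
          push_cast
          ring

end Boundary

/-! ### Korn's inequality in Lipschitz domains -/

/-- A boundary point lies on the graph: positive height would place it in the open set, and negative
height would keep the set away from it. The tripled column provides the room that the estimates near
the graph require. -/
lemma exists_boundary_column {U : Set Plane} (hU : IsLipschitzDomain U) {x : Plane}
    (hx : x ∈ frontier U) :
    ∃ (L : Plane ≃ₗᵢ[ℝ] Plane) (K : NNReal) (γ : ℝ → ℝ) (s₀ a : ℝ), LipschitzWith K γ ∧ 0 < a ∧
      x ∈ column L γ (Ioo (s₀ - a) (s₀ + a)) (Ioo (-a) a) ∧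
      ∀ y ∈ column L γ (Ioo (s₀ - 3 * a) (s₀ + 3 * a)) (Ioo (-(3 * a)) (3 * a)),
        (y ∈ U ↔ 0 < height L γ y) := by
  obtain ⟨L, K, γ, hγ, hev⟩ := hU.graph x hx
  have hev' : ∀ᶠ y in 𝓝 x, (y ∈ U ↔ 0 < height L γ y) := by
    filter_upwards [hev] with y hy
    rw [hy, height, sub_pos]
  rw [hU.isOpen.frontier_eq] at hx
  have hx0 : height L γ x = 0 := by
    refine le_antisymm (not_lt.1 fun h => hx.2 (hev'.self_of_nhds.2 h)) (not_lt.1 fun h => ?_)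
    have h1 : ∀ᶠ y in 𝓝 x, height L γ y < 0 :=
      (continuous_height L hγ.continuous).continuousAt.eventually_lt continuousAt_const h
    obtain ⟨y, hyU, hy, hy'⟩ := ((mem_closure_iff_frequently.1 hx.1).and_eventually
      (hev'.and h1)).exists
    exact absurd (hy.1 hyU) (not_lt.2 hy'.le)
  have hxc : chart L γ (L x 0, 0) = x := by
    conv_rhs => rw [← chart_base_height L γ x, hx0]
  have hev2 : ∀ᶠ p in 𝓝 (L x 0, (0 : ℝ)), (chart L γ p ∈ U ↔ 0 < height L γ (chart L γ p)) := by
    have hc := (continuous_chart L hγ.continuous).tendsto (L x 0, (0 : ℝ))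
    rw [hxc] at hc
    exact hc.eventually hev'
  obtain ⟨δ, hδ, hball⟩ := Metric.eventually_nhds_iff.1 hev2
  refine ⟨L, K, γ, L x 0, δ / 3, hγ, by positivity, ⟨⟨by linarith, by linarith⟩, ?_⟩, ?_⟩
  · rw [hx0]
    exact ⟨by linarith, by linarith⟩
  · rintro y ⟨hy1, hy2⟩
    rw [mul_div_cancel₀ _ three_ne_zero] at hy1 hy2
    have h := @hball (L y 0, height L γ y) (by
      rw [Prod.dist_eq, max_lt_iff, Real.dist_eq, Real.dist_eq, abs_lt, abs_lt]
      exact ⟨⟨by linarith [hy1.1], by linarith [hy1.2]⟩, by linarith [hy2.1], by linarith [hy2.2]⟩)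
    rwa [chart_base_height] at h

lemma isOpen_column (L : Plane ≃ₗᵢ[ℝ] Plane) {γ : ℝ → ℝ} (hγ : Continuous γ) {I J : Set ℝ}
    (hI : IsOpen I) (hJ : IsOpen J) : IsOpen (column L γ I J) := by
  have h0 : Continuous fun y => L y 0 := by fun_prop
  exact (hI.preimage h0).inter (hJ.preimage (continuous_height L hγ))

lemma isCompact_column (L : Plane ≃ₗᵢ[ℝ] Plane) {γ : ℝ → ℝ} (hγ : Continuous γ) {I J : Set ℝ}
    (hI : IsCompact I) (hJ : IsCompact J) : IsCompact (column L γ I J) := by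
  have h0 : Continuous fun y => L y 0 := by fun_prop
  refine Metric.isCompact_of_isClosed_isBounded ?_ (isBounded_column L hγ hI.isBounded hJ.isBounded)
  exact (hI.isClosed.preimage h0).inter (hJ.isClosed.preimage (continuous_height L hγ))

/-- Near each boundary point of a Lipschitz domain, a field and its trace are controlled by the
strain and the values in a fixed ball. -/
lemma exists_boundary_estimate {U : Set Plane} (hU : IsLipschitzDomain U) {p : Plane} {ρ₀ : ℝ}
    (hρ₀ : 0 < ρ₀) (hp : Metric.ball p ρ₀ ⊆ U) {x : Plane} (hx : x ∈ frontier U) :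
    ∃ N ∈ 𝓝 x, ∃ C : NNReal, ∀ u : Plane → Plane, ContDiff ℝ ∞ u →
      h1Int (N ∩ U) u ≤ C * (sqInt U (strainField u) + sqInt (Metric.ball p ρ₀) u) ∧
      ∫⁻ y in N ∩ frontier U, ‖u y‖ₑ ^ 2 ∂(Measure.hausdorffMeasure 1)
        ≤ C * (sqInt U (strainField u) + sqInt (Metric.ball p ρ₀) u) := by
  obtain ⟨L, K, γ, s₀, a, hγ, ha, hxN, hiff⟩ := exists_boundary_column hU hx
  have hsub : column L γ (Ioo (s₀ - 3 * a) (s₀ + 3 * a)) (Ioo 0 (3 * a)) ⊆ U := fun y hy =>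
    (hiff y ⟨hy.1, by linarith [hy.2.1], hy.2.2⟩).2 hy.2.1
  obtain ⟨C₁, h₁⟩ := exists_h1Int_column_le L hγ ha le_rfl hU.isOpen.measurableSet hsub
  have hQc : IsCompact (column L γ (Icc (s₀ - a) (s₀ + a)) (Icc a (2 * a))) :=
    isCompact_column L hγ.continuous isCompact_Icc isCompact_Icc
  have hQU : column L γ (Icc (s₀ - a) (s₀ + a)) (Icc a (2 * a)) ⊆ U := fun y hy =>
    hsub ⟨⟨by linarith [hy.1.1], by linarith [hy.1.2]⟩, by linarith [hy.2.1], by linarith [hy.2.2]⟩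
  -- The upper layer is a compact subset of `U`, so the interior estimate disposes of the remainder
  -- left by the boundary layer.
  obtain ⟨C₂, h₂⟩ := exists_h1Int_compact_le hU.isOpen hU.isConnected.isPreconnected hρ₀ hp hQc hQU
  have hNo : IsOpen (column L γ (Ioo (s₀ - a) (s₀ + a)) (Ioo (-a) a)) :=
    isOpen_column L hγ.continuous isOpen_Ioo isOpen_Ioo
  have hNsub : ∀ y ∈ column L γ (Ioo (s₀ - a) (s₀ + a)) (Ioo (-a) a),
      (y ∈ U ↔ 0 < height L γ y) := fun y hy =>
    hiff y ⟨⟨by linarith [hy.1.1], by linarith [hy.1.2]⟩, by linarith [hy.2.1], by linarith [hy.2.2]⟩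
  refine ⟨_, hNo.mem_nhds hxN, C₁ * (1 + C₂), fun u hu => ?_⟩
  obtain ⟨k₁, k₂⟩ := h₁ u hu
  have k₃ := h₂ u hu
  set Z := sqInt U (strainField u) + sqInt (Metric.ball p ρ₀) u with hZ
  have k₄ : (C₁ : ℝ≥0∞) * (sqInt U (strainField u)
      + h1Int (column L γ (Icc (s₀ - a) (s₀ + a)) (Icc a (2 * a))) u)
      ≤ (C₁ * (1 + C₂) : NNReal) * Z := by
    calc _ ≤ (C₁ : ℝ≥0∞) * (Z + C₂ * Z) := by
          gcongr
          exact le_self_add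
      _ = _ := by
          push_cast
          ring
  constructor
  · refine (h1Int_mono_set (fun y hy => ?_) u).trans (k₁.trans k₄)
    exact ⟨hy.1.1, (hNsub y hy.1).1 hy.2, hy.1.2.2⟩
  · refine (lintegral_mono_set fun y hy => ?_).trans (k₂.trans k₄)
    refine ⟨hy.1.1, ?_⟩
    have hyf := hy.2
    rw [hU.isOpen.frontier_eq] at hyf
    refine le_antisymm (not_lt.1 fun h => hyf.2 ((hNsub y hy.1).2 h)) (not_lt.1 fun h => ?_)
    have h1 : ∀ᶠ z in 𝓝 y, height L γ z < 0 :=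
      (continuous_height L hγ.continuous).continuousAt.eventually_lt continuousAt_const h
    obtain ⟨z, hzU, hz, hzN⟩ := ((mem_closure_iff_frequently.1 hyf.1).and_eventually
      (h1.and (hNo.mem_nhds hy.1))).exists
    exact absurd ((hNsub z hzN).1 hzU) (not_lt.2 hz.le)

/-- Compactness of the closure: finitely many interior and boundary neighbourhoods suffice, and
their constants add up. -/
lemma exists_h1Int_le_ball {U : Set Plane} (hU : IsLipschitzDomain U) {p : Plane} {ρ₀ : ℝ}
    (hρ₀ : 0 < ρ₀) (hp : Metric.ball p ρ₀ ⊆ U) :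
    ∃ C : NNReal, ∀ u : Plane → Plane, ContDiff ℝ ∞ u →
      h1Int U u ≤ C * (sqInt U (strainField u) + sqInt (Metric.ball p ρ₀) u) := by
  have hK : IsCompact (closure U) := hU.isBounded.isCompact_closure
  have key : ∃ C : NNReal, ∀ u : Plane → Plane, ContDiff ℝ ∞ u →
      h1Int (closure U ∩ U) u ≤ C * (sqInt U (strainField u) + sqInt (Metric.ball p ρ₀) u) := by
    refine hK.induction_on (p := fun S => ∃ C : NNReal, ∀ u : Plane → Plane, ContDiff ℝ ∞ u →
      h1Int (S ∩ U) u ≤ C * (sqInt U (strainField u) + sqInt (Metric.ball p ρ₀) u)) ?_ ?_ ?_ ?_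
    · exact ⟨0, fun u _ => by simp [h1Int, sqInt]⟩
    · rintro S T hST ⟨C, h⟩
      exact ⟨C, fun u hu => (h1Int_mono_set (inter_subset_inter_left U hST) u).trans (h u hu)⟩
    · rintro S T ⟨C, h⟩ ⟨C', h'⟩
      refine ⟨C + C', fun u hu => ?_⟩
      rw [union_inter_distrib_right, ENNReal.coe_add, add_mul]
      exact (h1Int_union_le _ _ u).trans (add_le_add (h u hu) (h' u hu))
    · intro x hx
      by_cases hxU : x ∈ U
      · obtain ⟨ρ, hρ, C, h⟩ := exists_h1Int_le_of_mem hU.isOpen hU.isConnected.isPreconnected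
          hρ₀ hp hxU
        exact ⟨_, mem_nhdsWithin_of_mem_nhds (Metric.ball_mem_nhds x hρ), C, fun u hu =>
          (h1Int_mono_set inter_subset_left u).trans (h u hu)⟩
      · have hxf : x ∈ frontier U := by
          rw [hU.isOpen.frontier_eq]
          exact ⟨hx, hxU⟩
        obtain ⟨N, hN, C, h⟩ := exists_boundary_estimate hU hρ₀ hp hxf
        exact ⟨N, mem_nhdsWithin_of_mem_nhds hN, C, fun u hu => (h u hu).1⟩
  rwa [inter_eq_right.2 subset_closure] at key

lemma exists_trace_le_ball {U : Set Plane} (hU : IsLipschitzDomain U) {p : Plane} {ρ₀ : ℝ}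
    (hρ₀ : 0 < ρ₀) (hp : Metric.ball p ρ₀ ⊆ U) :
    ∃ C : NNReal, ∀ u : Plane → Plane, ContDiff ℝ ∞ u →
      ∫⁻ y, ‖u y‖ₑ ^ 2 ∂(bdryMeasure U)
        ≤ C * (sqInt U (strainField u) + sqInt (Metric.ball p ρ₀) u) := by
  have hK : IsCompact (frontier U) := hU.isBounded.isCompact_closure.of_isClosed_subset
    isClosed_frontier frontier_subset_closure
  have key : ∃ C : NNReal, ∀ u : Plane → Plane, ContDiff ℝ ∞ u →
      ∫⁻ y in frontier U ∩ frontier U, ‖u y‖ₑ ^ 2 ∂(Measure.hausdorffMeasure 1)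
        ≤ C * (sqInt U (strainField u) + sqInt (Metric.ball p ρ₀) u) := by
    refine hK.induction_on (p := fun S => ∃ C : NNReal, ∀ u : Plane → Plane, ContDiff ℝ ∞ u →
      ∫⁻ y in S ∩ frontier U, ‖u y‖ₑ ^ 2 ∂(Measure.hausdorffMeasure 1)
        ≤ C * (sqInt U (strainField u) + sqInt (Metric.ball p ρ₀) u)) ?_ ?_ ?_ ?_
    · exact ⟨0, fun u _ => by simp⟩
    · rintro S T hST ⟨C, h⟩
      exact ⟨C, fun u hu =>
        (lintegral_mono_set (inter_subset_inter_left _ hST)).trans (h u hu)⟩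
    · rintro S T ⟨C, h⟩ ⟨C', h'⟩
      refine ⟨C + C', fun u hu => ?_⟩
      rw [union_inter_distrib_right, ENNReal.coe_add, add_mul]
      exact (lintegral_union_le _ _ _).trans (add_le_add (h u hu) (h' u hu))
    · intro x hx
      obtain ⟨N, hN, C, h⟩ := exists_boundary_estimate hU hρ₀ hp hx
      exact ⟨N, mem_nhdsWithin_of_mem_nhds hN, C, fun u hu => (h u hu).2⟩
  rwa [inter_self] at key

/-! ### Rigid displacements and Korn's inequality with a boundary term -/

lemma exists_ball_subset {U : Set Plane} (hU : IsLipschitzDomain U) :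
    ∃ (p : Plane) (ρ₀ : ℝ), 0 < ρ₀ ∧ Metric.ball p ρ₀ ⊆ U := by
  obtain ⟨p, hp⟩ := hU.isConnected.nonempty
  obtain ⟨ρ, hρ, h⟩ := Metric.isOpen_iff.1 hU.isOpen p hp
  exact ⟨p, ρ, hρ, h⟩

lemma strainField_const (v : Plane) : strainField (fun _ => v) = 0 := by
  funext x
  have : grad (fun _ => v) x = 0 := by
    ext p
    simp [grad]
  rw [strainField, this, map_zero]
  rfl

/-- The trace estimate for a constant unit field, whose strain vanishes, bounds the length of the
boundary. -/
lemma isFiniteMeasure_bdryMeasure {U : Set Plane} (hU : IsLipschitzDomain U) :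
    IsFiniteMeasure (bdryMeasure U) := by
  obtain ⟨p, ρ, hρ, hp⟩ := exists_ball_subset hU
  obtain ⟨C, hC⟩ := exists_trace_le_ball hU hρ hp
  have h := hC (fun _ => unitVec 0) contDiff_const
  have h1 : ‖unitVec 0‖ₑ = 1 := by
    rw [← ofReal_norm, norm_unitVec, ENNReal.ofReal_one]
  rw [h1, one_pow, lintegral_one] at h
  refine ⟨h.trans_lt (ENNReal.mul_lt_top ENNReal.coe_lt_top (ENNReal.add_lt_top.2 ⟨?_, ?_⟩))⟩
  · rw [strainField_const]
    simp [sqInt]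
  · exact sqInt_lt_top Metric.isBounded_ball continuous_const

/-- Rescaling by `ρ / 2` reduces this to the ball of radius two. The rigid displacement is recentred
at `p` accordingly. -/
lemma exists_rigid_sqInt_ball_le (p : Plane) {ρ : ℝ} (hρ : 0 < ρ) : ∃ C : NNReal,
    ∀ u : Plane → Plane, ContDiff ℝ 1 u → ∃ (A : Plane) (θ : ℝ),
      sqInt (Metric.ball p ρ) (u - rigid A θ) ≤ C * sqInt (Metric.ball p ρ) (strainField u) := by
  obtain ⟨C, hC⟩ := exists_rigid_sqInt_le
  obtain ⟨t, ht⟩ : ∃ t : ℝ, t = ρ / 2 := ⟨_, rfl⟩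
  have ht0 : 0 < t := by linarith
  have hρt : 2 * t = ρ := by linarith
  refine ⟨C * ‖t‖₊ ^ 2, fun u hu => ?_⟩
  have hv1 : ContDiff ℝ 1 fun y => u (p + t • y) :=
    hu.comp (contDiff_const.add (contDiff_id.const_smul t))
  obtain ⟨A, θ, h⟩ := hC _ hv1
  refine ⟨A - (θ / t) • quarterTurn p, θ / t, ?_⟩
  have e1 : (fun y => u (p + t • y)) - rigid A θ
      = fun y => (u - rigid (A - (θ / t) • quarterTurn p) (θ / t)) (p + t • y) := by
    funext y
    simp only [Pi.sub_apply, rigid, map_add, map_smul, smul_add, smul_smul,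
      div_mul_cancel₀ θ ht0.ne']
    abel
  have e2 : strainField (fun y => u (p + t • y)) = fun y => t • strainField u (p + t • y) := by
    funext y
    have hd : HasFDerivAt (fun y : Plane => p + t • y) (t • ContinuousLinearMap.id ℝ Plane) y :=
      ((hasFDerivAt_id y).const_smul t).const_add p
    have hd2 := (hu.differentiable (by simp) (p + t • y)).hasFDerivAt.comp y hd
    have hg : grad (fun y => u (p + t • y)) y = t • grad u (p + t • y) := by
      ext q
      simp only [grad]
      rw [show fderiv ℝ (fun y => u (p + t • y)) y = _ from hd2.fderiv]
      simp
    rw [strainField, hg, map_smul, strainField]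
  rw [e1, e2, sqInt_const_smul, sqInt_ball_comp_add_smul
    (hu.continuous.sub (contDiff_rigid (n := 0) _ _).continuous) p ht0,
    sqInt_ball_comp_add_smul (continuous_strainField hu) p ht0, hρt] at h
  have hq0 : ENNReal.ofReal (t ^ 2)⁻¹ ≠ 0 := by
    rw [Ne, ENNReal.ofReal_eq_zero, not_le]
    positivity
  rw [← ENNReal.mul_le_mul_iff_right hq0 ENNReal.ofReal_ne_top]
  refine h.trans (le_of_eq ?_)
  rw [ENNReal.coe_mul, ENNReal.coe_pow]
  change _ = _ * (C * ‖t‖ₑ ^ 2 * _)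
  ring

lemma eLpNorm_two_sq {α E : Type*} [MeasurableSpace α] [NormedAddCommGroup E] (f : α → E)
    (μ : Measure α) : eLpNorm f 2 μ ^ 2 = ∫⁻ x, ‖f x‖ₑ ^ 2 ∂μ := by
  rw [eLpNorm_eq_lintegral_rpow_enorm_toReal (by simp) (by simp), ← ENNReal.rpow_natCast,
    ← ENNReal.rpow_mul]
  simp

lemma memLp_rigid {ν : Measure Plane} [IsFiniteMeasure ν] {S : Set Plane}
    (hS : Bornology.IsBounded S) (hν : ∀ᵐ x ∂ν, x ∈ S) (A : Plane) (θ : ℝ) :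
    MemLp (rigid A θ) 2 ν := by
  have hc : Continuous (rigid A θ) := (contDiff_rigid (n := 0) A θ).continuous
  obtain ⟨M, hM⟩ := hS.isCompact_closure.exists_bound_of_continuousOn hc.continuousOn
  refine MemLp.of_bound hc.aestronglyMeasurable M ?_
  filter_upwards [hν] with x hx using hM x (subset_closure hx)

/-- A rigid displacement is controlled by its restriction to a bounded set carrying a nontrivial
measure without atoms. -/
lemma exists_rigid_le {ν : Measure Plane} [IsFiniteMeasure ν] [NullSingletonClass ν] (hν0 : ν ≠ 0)
    {S : Set Plane} (hS : Bornology.IsBounded S) (hν : ∀ᵐ x ∂ν, x ∈ S) :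
    ∃ C : NNReal, ∀ (A : Plane) (θ : ℝ),
      ‖(A, θ)‖ₑ ^ 2 ≤ C * ∫⁻ x, ‖rigid A θ x‖ₑ ^ 2 ∂ν := by
  let T : Plane × ℝ →ₗ[ℝ] Lp Plane 2 ν :=
    { toFun := fun p => (memLp_rigid hS hν p.1 p.2).toLp _
      map_add' := by
        intro p q
        rw [← MemLp.toLp_add]
        refine MemLp.toLp_congr _ _ (Eventually.of_forall fun x => ?_)
        simp only [rigid, Prod.fst_add, Prod.snd_add, Pi.add_apply]
        module
      map_smul' := by
        intro c p
        rw [RingHom.id_apply, ← MemLp.toLp_const_smul]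
        refine MemLp.toLp_congr _ _ (Eventually.of_forall fun x => ?_)
        simp only [rigid, Prod.smul_fst, Prod.smul_snd, Pi.smul_apply, smul_eq_mul]
        module }
  have hT : LinearMap.ker T = ⊥ := by
    rw [LinearMap.ker_eq_bot']
    rintro ⟨A, θ⟩ h
    have h0 : ∀ᵐ x ∂ν, rigid A θ x = 0 := by
      have h1 : (memLp_rigid hS hν A θ).toLp _ = 0 := h
      have h2 := (memLp_rigid hS hν A θ).coeFn_toLp
      rw [h1] at h2
      filter_upwards [h2, Lp.coeFn_zero Plane 2 ν] with x hx hx'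
      rw [← hx, hx']
      rfl
    have : (ae ν).NeBot := ae_neBot.2 hν0
    obtain ⟨x, hx⟩ := h0.exists
    -- With a nonzero rotation the displacement vanishes at one point only, and a nontrivial measure
    -- without atoms cannot be carried by a single point.
    have hθ : θ = 0 := by
      by_contra hθ
      have h3 : ∀ᵐ y ∂ν, y = x := by
        filter_upwards [h0] with y hy
        have h4 : θ • quarterTurn (y - x) = 0 := by
          have h5 : rigid A θ y - rigid A θ x = 0 := by rw [hx, hy, sub_zero]
          rwa [rigid, rigid, add_sub_add_left_eq_sub, ← smul_sub, ← map_sub] at h5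
        have h6 := norm_quarterTurn (y - x)
        rw [(smul_eq_zero.1 h4).resolve_left hθ, norm_zero] at h6
        exact sub_eq_zero.1 (norm_eq_zero.1 h6.symm)
      have h7 : ∀ᵐ y ∂ν, y ≠ x := by
        rw [ae_iff]
        simp
      obtain ⟨y, hy, hy'⟩ := (h3.and h7).exists
      exact hy' hy
    have hA : A = 0 := by
      rw [rigid, hθ, zero_smul, add_zero] at hx
      exact hx
    rw [hA, hθ]
    rfl
  -- An injective linear map on a finite-dimensional space is bounded below.
  obtain ⟨C, _, hC⟩ := T.exists_antilipschitzWith hT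
  refine ⟨C ^ 2, fun A θ => ?_⟩
  have h := hC.le_mul_dist (A, θ) 0
  rw [dist_zero_right, map_zero, dist_zero_right] at h
  have hn : ‖T (A, θ)‖ₑ ^ 2 = ∫⁻ x, ‖rigid A θ x‖ₑ ^ 2 ∂ν := by
    rw [← eLpNorm_two_sq, Lp.enorm_def]
    exact congrArg (· ^ 2) (eLpNorm_congr_ae (memLp_rigid hS hν A θ).coeFn_toLp)
  rw [← hn, ENNReal.coe_pow, ← mul_pow]
  gcongr
  rw [← ofReal_norm, ← ofReal_norm, ← ENNReal.ofReal_coe_nnreal (p := C),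
    ← ENNReal.ofReal_mul C.coe_nonneg]
  exact ENNReal.ofReal_le_ofReal h

lemma exists_h1Int_rigid_le {U : Set Plane} (hU : Bornology.IsBounded U) :
    ∃ C : NNReal, ∀ (A : Plane) (θ : ℝ), h1Int U (rigid A θ) ≤ C * ‖(A, θ)‖ₑ ^ 2 := by
  obtain ⟨D, hD0, hD⟩ := hU.exists_pos_norm_le
  have hV : volume U ≠ ⊤ := hU.measure_lt_top.ne
  refine ⟨((1 + D.toNNReal) ^ 2 + ‖skewUnit‖₊ ^ 2) * (volume U).toNNReal, fun A θ => ?_⟩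
  have hA : ‖A‖ₑ ≤ ‖(A, θ)‖ₑ := by
    rw [← ofReal_norm, ← ofReal_norm]
    exact ENNReal.ofReal_le_ofReal (norm_fst_le (A, θ))
  have hθ : ‖θ‖ₑ ≤ ‖(A, θ)‖ₑ := by
    rw [← ofReal_norm, ← ofReal_norm]
    exact ENNReal.ofReal_le_ofReal (norm_snd_le (A, θ))
  have h1 : sqInt U (rigid A θ) ≤ ((1 + D.toNNReal) * ‖(A, θ)‖ₑ) ^ 2 * volume U := by
    rw [← setLIntegral_const]
    refine setLIntegral_mono measurable_const fun x hx => ?_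
    gcongr
    calc ‖rigid A θ x‖ₑ ≤ ‖A‖ₑ + ‖θ‖ₑ * ‖x‖ₑ := by
          refine (enorm_add_le _ _).trans ?_
          gcongr
          rw [enorm_smul]
          gcongr
          rw [← ofReal_norm, norm_quarterTurn, ofReal_norm]
      _ ≤ ‖(A, θ)‖ₑ + ‖(A, θ)‖ₑ * D.toNNReal := by
          gcongr
          rw [← ofReal_norm]
          exact ENNReal.ofReal_le_ofReal (hD x hx)
      _ = _ := by ring
  have h2 : sqInt U (grad (rigid A θ)) ≤ (‖(A, θ)‖ₑ * ‖skewUnit‖ₑ) ^ 2 * volume U := by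
    rw [← setLIntegral_const]
    refine setLIntegral_mono measurable_const fun x hx => ?_
    rw [grad_rigid, enorm_smul]
    gcongr
  refine (add_le_add h1 h2).trans (le_of_eq ?_)
  push_cast
  rw [ENNReal.coe_toNNReal hV]
  change _ = ((1 + (D.toNNReal : ℝ≥0∞)) ^ 2 + ‖skewUnit‖ₑ ^ 2) * volume U * _
  ring

lemma h1Int_add_le {S : Set Plane} {f g : Plane → Plane} (hf : ContDiff ℝ 1 f)
    (hg : ContDiff ℝ 1 g) : h1Int S (f + g) ≤ 2 * h1Int S f + 2 * h1Int S g := by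
  unfold h1Int
  rw [grad_add hf hg]
  refine (add_le_add (sqInt_add_le hf.continuous) (sqInt_add_le (continuous_grad hf))).trans
    (le_of_eq ?_)
  ring

/-- Korn's inequality in a Lipschitz domain for fields which are small on a part of the boundary of
positive length. -/
lemma exists_korn {U S : Set Plane} (hU : IsLipschitzDomain U) (hSU : S ⊆ frontier U)
    (hS : MeasurableSet S) (hS0 : 0 < Measure.hausdorffMeasure 1 S) :
    ∃ C : NNReal, ∀ u : Plane → Plane, ContDiff ℝ ∞ u → h1Int U u
      ≤ C * (sqInt U (strainField u) + ∫⁻ x in S, ‖u x‖ₑ ^ 2 ∂(Measure.hausdorffMeasure 1)) := by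
  obtain ⟨p, ρ, hρ, hp⟩ := exists_ball_subset hU
  obtain ⟨C₁, h₁⟩ := exists_h1Int_le_ball hU hρ hp
  obtain ⟨C₂, h₂⟩ := exists_trace_le_ball hU hρ hp
  obtain ⟨C₃, h₃⟩ := exists_rigid_sqInt_ball_le p hρ
  have hfin := isFiniteMeasure_bdryMeasure hU
  set ν : Measure Plane := (Measure.hausdorffMeasure 1).restrict S with hν
  have hle : ν ≤ bdryMeasure U := Measure.restrict_mono hSU le_rfl
  have : IsFiniteMeasure ν := isFiniteMeasure_of_le _ hle
  have : NullSingletonClass (Measure.hausdorffMeasure 1 : Measure Plane) :=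
    Measure.nullSingletonClass_hausdorff Plane one_pos
  have hν0 : ν ≠ 0 := by
    rw [Ne, Measure.restrict_eq_zero]
    exact hS0.ne'
  have hSb : Bornology.IsBounded S :=
    hU.isBounded.isCompact_closure.isBounded.subset (hSU.trans frontier_subset_closure)
  obtain ⟨C₄, h₄⟩ := exists_rigid_le hν0 hSb (ae_restrict_mem hS)
  obtain ⟨C₅, h₅⟩ := exists_h1Int_rigid_le hU.isBounded
  refine ⟨2 * (C₁ * (1 + C₃)) + 2 * (C₅ * (C₄ * (2 + 2 * (C₂ * (1 + C₃))))), fun u hu => ?_⟩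
  have hu1 : ContDiff ℝ 1 u := hu.of_le (by simp)
  obtain ⟨A, θ, hA⟩ := h₃ u hu1
  set w := u - rigid A θ with hw
  have hwc : ContDiff ℝ ∞ w := hu.sub (contDiff_rigid A θ)
  have hws : strainField w = strainField u := strainField_sub_rigid hu1 A θ
  set I := sqInt U (strainField u) with hI
  set J := ∫⁻ x, ‖u x‖ₑ ^ 2 ∂ν with hJ
  have k0 : sqInt U (strainField w) + sqInt (Metric.ball p ρ) w ≤ (1 + C₃) * I := by
    rw [hws, add_mul, one_mul]
    gcongr
    exact hA.trans (by gcongr; exact sqInt_mono_set hp _)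
  have k1 : h1Int U w ≤ C₁ * ((1 + C₃) * I) := (h₁ w hwc).trans (by gcongr)
  have k2 : ∫⁻ x, ‖w x‖ₑ ^ 2 ∂ν ≤ C₂ * ((1 + C₃) * I) :=
    (lintegral_mono' hle le_rfl).trans ((h₂ w hwc).trans (by gcongr))
  -- On `S` the rigid part is read off from `u` and from the trace of the remainder `w`, which the
  -- strain already controls.
  have hr : rigid A θ = u + -w := by
    rw [hw]
    abel
  have k3 : ∫⁻ x, ‖rigid A θ x‖ₑ ^ 2 ∂ν ≤ 2 * J + 2 * (C₂ * ((1 + C₃) * I)) := by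
    calc ∫⁻ x, ‖rigid A θ x‖ₑ ^ 2 ∂ν ≤ ∫⁻ x, (2 * ‖u x‖ₑ ^ 2 + 2 * ‖w x‖ₑ ^ 2) ∂ν := by
          refine lintegral_mono fun x => ?_
          have h := enorm_add_sq_le (u x) (-w x)
          rw [enorm_neg] at h
          rwa [hr]
      _ = 2 * J + 2 * ∫⁻ x, ‖w x‖ₑ ^ 2 ∂ν := by
          have huc := hu.continuous
          rw [lintegral_add_left (Measurable.const_mul (Continuous.measurable (by fun_prop)) 2),
            lintegral_const_mul' _ _ (by simp), lintegral_const_mul' _ _ (by simp)]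
      _ ≤ _ := by gcongr
  have k4 : h1Int U (rigid A θ) ≤ C₅ * (C₄ * (2 * J + 2 * (C₂ * ((1 + C₃) * I)))) :=
    (h₅ A θ).trans (by
      gcongr
      exact (h₄ A θ).trans (by gcongr))
  have hsum : u = w + rigid A θ := by
    rw [hw]
    abel
  calc h1Int U u ≤ 2 * h1Int U w + 2 * h1Int U (rigid A θ) := by
        conv_lhs => rw [hsum]
        exact h1Int_add_le (hwc.of_le (by simp)) (contDiff_rigid A θ)
    _ ≤ 2 * (C₁ * ((1 + C₃) * (I + J)))
        + 2 * (C₅ * (C₄ * (2 * (I + J) + 2 * (C₂ * ((1 + C₃) * (I + J)))))) := by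
        gcongr
        · exact k1.trans (by gcongr; exact le_self_add)
        · refine k4.trans ?_
          gcongr
          · exact le_add_self
          · exact le_self_add
    _ = _ := by
        push_cast
        ring

/-! ### Smooth fields in `H¹` -/

lemma integral_coord_mul_fderiv {φ : Plane → Plane} (hφ : ContDiff ℝ ∞ φ) {ψ : Plane → ℝ}
    (hψ : ContDiff ℝ ∞ ψ) (hc : HasCompactSupport ψ) {U : Set Plane} (hs : tsupport ψ ⊆ U)
    (i j : Fin 2) :
    ∫ x in U, φ x i * fderiv ℝ ψ x (unitVec j) = -∫ x in U, grad φ x (i, j) * ψ x := by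
  have h1 : ∀ x ∉ U, φ x i * fderiv ℝ ψ x (unitVec j) = 0 := by
    intro x hx
    rw [image_eq_zero_of_notMem_tsupport (f := fderiv ℝ ψ)
      fun h => hx (hs (tsupport_fderiv_subset ℝ h))]
    simp
  have h2 : ∀ x ∉ U, grad φ x (i, j) * ψ x = 0 := by
    intro x hx
    rw [image_eq_zero_of_notMem_tsupport (f := ψ) fun h => hx (hs h), mul_zero]
  rw [setIntegral_eq_integral_of_forall_compl_eq_zero h1,
    setIntegral_eq_integral_of_forall_compl_eq_zero h2]
  have hφi := contDiff_coord hφ i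
  have hφi' := hφi.continuous_fderiv (by simp)
  have hψ' := hψ.continuous_fderiv (by simp)
  simp only [grad_apply_eq_fderiv_coord (hφ.differentiable (by simp) _)]
  refine integral_mul_fderiv_eq_neg_fderiv_mul_of_integrable ?_ ?_ ?_
    (fun x _ => hφi.differentiable (by simp) x) (fun x _ => hψ.differentiable (by simp) x)
  · exact Continuous.integrable_of_hasCompactSupport
      ((hφi'.clm_apply continuous_const).mul hψ.continuous) hc.mul_left
  · exact Continuous.integrable_of_hasCompactSupport
      (hφi.continuous.mul (hψ'.clm_apply continuous_const)) (hc.fderiv_apply ℝ _).mul_left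
  · exact Continuous.integrable_of_hasCompactSupport (hφi.continuous.mul hψ.continuous) hc.mul_left

lemma memLp_gradOf_coord {U : Set Plane} (w : H1 U) (p : Fin 2 × Fin 2) :
    MemLp (fun x => gradOf w x p) 2 (volume.restrict U) :=
  (EuclideanSpace.proj (𝕜 := ℝ) p).comp_memLp' (Lp.memLp w.1.snd)

lemma continuous_grad_coord {φ : Plane → Plane} (hφ : ContDiff ℝ 1 φ) (p : Fin 2 × Fin 2) :
    Continuous fun x => grad φ x p :=
  (EuclideanSpace.proj (𝕜 := ℝ) p).continuous.comp (continuous_grad hφ)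

/-- Uniqueness of the weak gradient: the difference integrates to zero against every test function,
hence vanishes almost everywhere in the open set. -/
lemma gradOf_eq_grad {U : Set Plane} (hU : IsOpen U) {w : H1 U} {φ : Plane → Plane}
    (hφ : ContDiff ℝ ∞ φ) (hw : fieldOf w =ᵐ[volume.restrict U] φ) :
    gradOf w =ᵐ[volume.restrict U] grad φ := by
  have hcomp : ∀ p : Fin 2 × Fin 2, ∀ᵐ x ∂(volume.restrict U), gradOf w x p - grad φ x p = 0 := by
    rintro ⟨i, j⟩
    have hG := memLp_gradOf_coord w (i, j)
    have hgi := continuous_grad_coord (φ := φ) (hφ.of_le (by simp)) (i, j)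
    have l1 : LocallyIntegrable (fun x => gradOf w x (i, j)) (volume.restrict U) :=
      hG.locallyIntegrable one_le_two
    have l2 : LocallyIntegrable (fun x => grad φ x (i, j)) (volume.restrict U) :=
      hgi.locallyIntegrable
    have hloc : LocallyIntegrable (fun x => gradOf w x (i, j) - grad φ x (i, j))
        (volume.restrict U) := l1.sub l2
    have h := hU.ae_eq_zero_of_integral_contDiff_smul_eq_zero (μ := volume.restrict U)
      (hloc.locallyIntegrableOn U) (fun ψ hψ hc hs => ?_)
    · filter_upwards [h, ae_restrict_mem hU.measurableSet] with x hx hxU using hx hxU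
    · have e1 := w.2 ψ hψ hc hs i j
      have e2 := integral_coord_mul_fderiv hφ hψ hc hs i j
      have e3 : ∫ x in U, w.1.fst x i * fderiv ℝ ψ x (unitVec j)
          = ∫ x in U, φ x i * fderiv ℝ ψ x (unitVec j) := by
        refine integral_congr_ae ?_
        filter_upwards [hw] with x hx
        rw [← hx]
        rfl
      rw [e3, e2, neg_inj] at e1
      have i1 : Integrable (fun x => gradOf w x (i, j) * ψ x) (volume.restrict U) :=
        integrable_coord_mul w.1.snd (i, j) hψ.continuous hc
      have i2 : Integrable (fun x => grad φ x (i, j) * ψ x) (volume.restrict U) :=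
        (hgi.mul hψ.continuous).integrable_of_hasCompactSupport hc.mul_left
      have e4 : ∀ x, ψ x • (gradOf w x (i, j) - grad φ x (i, j))
          = gradOf w x (i, j) * ψ x - grad φ x (i, j) * ψ x := by
        intro x
        rw [smul_eq_mul]
        ring
      simp_rw [e4]
      rw [integral_sub i1 i2, e1]
      exact sub_self _
  filter_upwards [ae_all_iff.2 hcomp] with x hx
  ext p
  exact sub_eq_zero.1 (hx p)

lemma memLp_of_isBounded {E : Type*} [NormedAddCommGroup E] {U : Set Plane}
    (hb : Bornology.IsBounded U) {f : Plane → E} [SecondCountableTopologyEither Plane E]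
    (hf : Continuous f) : MemLp f 2 (volume.restrict U) := by
  refine ⟨hf.aestronglyMeasurable, ?_⟩
  have h := sqInt_lt_top hb hf
  rw [sqInt, ← eLpNorm_two_sq] at h
  exact (ENNReal.pow_lt_top_iff.1 h).resolve_right (by norm_num)

/-- The element of `H¹(U; ℝ²)` given by a smooth field. -/
lemma exists_h1_of_contDiff {U : Set Plane} (hb : Bornology.IsBounded U) {φ : Plane → Plane}
    (hφ : ContDiff ℝ ∞ φ) : ∃ w : H1 U, fieldOf w =ᵐ[volume.restrict U] φ ∧
      gradOf w =ᵐ[volume.restrict U] grad φ := by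
  have m1 := memLp_of_isBounded hb hφ.continuous
  have m2 := memLp_of_isBounded hb (continuous_grad (φ := φ) (hφ.of_le (by simp)))
  refine ⟨⟨WithLp.toLp 2 (m1.toLp _, m2.toLp _), ?_⟩, m1.coeFn_toLp, m2.coeFn_toLp⟩
  intro ψ hψ hc hs i j
  have e1 : ∫ x in U, m1.toLp _ x i * fderiv ℝ ψ x (unitVec j)
      = ∫ x in U, φ x i * fderiv ℝ ψ x (unitVec j) := by
    refine integral_congr_ae ?_
    filter_upwards [m1.coeFn_toLp] with x hx
    rw [hx]
  have e2 : ∫ x in U, m2.toLp _ x (i, j) * ψ x = ∫ x in U, grad φ x (i, j) * ψ x := by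
    refine integral_congr_ae ?_
    filter_upwards [m2.coeFn_toLp] with x hx
    rw [hx]
  exact e1.trans ((integral_coord_mul_fderiv hφ hψ hc hs i j).trans (congrArg _ e2.symm))

lemma enorm_h1_sq {U : Set Plane} (w : H1 U) :
    ‖w‖ₑ ^ 2 = sqInt U (fieldOf w) + sqInt U (gradOf w) := by
  have h : ‖w‖ ^ 2 = ‖w.1.fst‖ ^ 2 + ‖w.1.snd‖ ^ 2 := WithLp.prod_norm_sq_eq_of_L2 w.1
  have h1 : sqInt U (fieldOf w) = ‖w.1.fst‖ₑ ^ 2 := by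
    rw [sqInt, ← eLpNorm_two_sq, Lp.enorm_def]
    rfl
  have h2 : sqInt U (gradOf w) = ‖w.1.snd‖ₑ ^ 2 := by
    rw [sqInt, ← eLpNorm_two_sq, Lp.enorm_def]
    rfl
  rw [h1, h2, enorm_sq_eq_ofReal, enorm_sq_eq_ofReal, enorm_sq_eq_ofReal,
    ← ENNReal.ofReal_add (by positivity) (by positivity), h]

lemma sqInt_congr_ae {E : Type*} [NormedAddCommGroup E] {S : Set Plane} {f g : Plane → E}
    (h : f =ᵐ[volume.restrict S] g) : sqInt S f = sqInt S g := by
  refine lintegral_congr_ae ?_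
  filter_upwards [h] with x hx
  rw [hx]

lemma enorm_h1_sq_eq_h1Int {U : Set Plane} (hU : IsOpen U) {w : H1 U} {φ : Plane → Plane}
    (hφ : ContDiff ℝ ∞ φ) (hw : fieldOf w =ᵐ[volume.restrict U] φ) :
    ‖w‖ₑ ^ 2 = h1Int U φ := by
  rw [enorm_h1_sq, sqInt_congr_ae hw, sqInt_congr_ae (gradOf_eq_grad hU hφ hw), h1Int]

/-- The strain as an operator `H¹ → L²`. -/
def strainOp (U : Set Plane) : H1 U →L[ℝ] Lp GradVal 2 (volume.restrict U) :=
  (symPart.compLpL 2 (volume.restrict U)).comp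
    ((WithLp.sndL 2 ℝ _ _).comp (H1 U).subtypeL)

lemma coeFn_strainOp {U : Set Plane} (w : H1 U) :
    strainOp U w =ᵐ[volume.restrict U] fun x => symPart (gradOf w x) :=
  symPart.coeFn_compLpL w.1.snd

lemma enorm_strainOp_sq {U : Set Plane} (w : H1 U) :
    ‖strainOp U w‖ₑ ^ 2 = sqInt U fun x => symPart (gradOf w x) := by
  rw [← sqInt_congr_ae (coeFn_strainOp w), sqInt, ← eLpNorm_two_sq, Lp.enorm_def]

/-- Korn's inequality for fields vanishing on a part of the boundary. -/
lemma exists_korn_traceGraph {U S : Set Plane} (hU : IsLipschitzDomain U) (hSU : S ⊆ frontier U)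
    (hS : MeasurableSet S) (hS0 : 0 < Measure.hausdorffMeasure 1 S) :
    ∃ C : ℝ, 0 < C ∧ ∀ p ∈ traceGraph U,
      (∀ᵐ x ∂((Measure.hausdorffMeasure 1).restrict S), p.2 x = 0) →
      ‖p.1‖ ^ 2 ≤ C * ‖strainOp U p.1‖ ^ 2 := by
  obtain ⟨C, hC⟩ := exists_korn hU hSU hS hS0
  refine ⟨C + 1, by positivity, fun p hp hp0 => ?_⟩
  -- Smooth fields approximating `p` need not vanish on `S`. The closed condition therefore allows a
  -- defect `‖q.2 - p.2‖ ^ 2`, which dominates the boundary integral over `S` because `p.2` vanishes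
  -- there, and which is zero at `q = p`.
  set F : Set (H1 U × L2Bdry U) :=
    {q | ‖q.1‖ ^ 2 ≤ (C + 1) * (‖strainOp U q.1‖ ^ 2 + ‖q.2 - p.2‖ ^ 2)} with hF
  have hFc : IsClosed F := isClosed_le (by fun_prop) (by fun_prop)
  have hsub : (smoothTracePairs U : Set (H1 U × L2Bdry U)) ⊆ F := by
    rintro q ⟨φ, hφ, h1, h2⟩
    have hle : (Measure.hausdorffMeasure 1).restrict S ≤ bdryMeasure U :=
      Measure.restrict_mono hSU le_rfl
    have k := hC φ hφ
    have k1 : ∫⁻ x in S, ‖φ x‖ₑ ^ 2 ∂(Measure.hausdorffMeasure 1) ≤ ‖q.2 - p.2‖ₑ ^ 2 := by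
      rw [Lp.enorm_def, eLpNorm_two_sq]
      refine le_trans (le_of_eq ?_) (lintegral_mono' hle le_rfl)
      refine lintegral_congr_ae ?_
      filter_upwards [hp0, ae_mono hle h2, ae_mono hle (Lp.coeFn_sub q.2 p.2)] with x x1 x2 x3
      rw [x3, Pi.sub_apply, x1, x2, sub_zero]
    have k2 : sqInt U (strainField φ) = ‖strainOp U q.1‖ₑ ^ 2 := by
      rw [enorm_strainOp_sq]
      refine sqInt_congr_ae ?_
      filter_upwards [gradOf_eq_grad hU.isOpen hφ h1] with x hx
      rw [hx]
      rfl
    rw [← enorm_h1_sq_eq_h1Int hU.isOpen hφ h1, k2] at k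
    have k3 := k.trans (mul_le_mul_right (add_le_add_right k1 _) _)
    simp only [enorm_sq_eq_ofReal] at k3
    rw [← ENNReal.ofReal_add (by positivity) (by positivity),
      ← ENNReal.ofReal_coe_nnreal (p := C), ← ENNReal.ofReal_mul C.coe_nonneg,
      ENNReal.ofReal_le_ofReal_iff (by positivity)] at k3
    refine k3.trans ?_
    gcongr
    linarith
  have hpF : p ∈ F := closure_minimal hsub hFc hp
  simpa [hF] using hpF

/-! ### Completeness of `H¹` -/

lemma continuous_integral_coord_mul {ι : Type*} [Fintype ι] [DecidableEq ι] {μ : Measure Plane}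
    [IsFiniteMeasureOnCompacts μ] (i : ι) {g : Plane → ℝ} (hg : Continuous g)
    (hc : HasCompactSupport g) :
    Continuous fun f : Lp (EuclideanSpace ℝ ι) 2 μ => ∫ x, f x i * g x ∂μ := by
  have hm : MemLp (fun x => g x • EuclideanSpace.single i (1 : ℝ)) 2 μ :=
    Continuous.memLp_of_hasCompactSupport (by fun_prop) hc.smul_right
  have he : (fun f : Lp (EuclideanSpace ℝ ι) 2 μ => ∫ x, f x i * g x ∂μ)
      = fun f => inner ℝ (hm.toLp _) f := by
    funext f
    rw [L2.inner_def]
    refine integral_congr_ae ?_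
    filter_upwards [hm.coeFn_toLp] with x hx
    rw [hx, inner_smul_left, EuclideanSpace.inner_single_left]
    simp [mul_comm]
  rw [he]
  fun_prop

lemma isClosed_h1 (U : Set Plane) : IsClosed (H1 U : Set (L2Pair U)) := by
  have h : (H1 U : Set (L2Pair U)) = ⋂ (φ : Plane → ℝ) (_ : ContDiff ℝ ∞ φ)
      (_ : HasCompactSupport φ) (_ : tsupport φ ⊆ U) (i : Fin 2) (j : Fin 2),
      {p : L2Pair U | ∫ x in U, p.fst x i * fderiv ℝ φ x (EuclideanSpace.single j 1)
        = - ∫ x in U, p.snd x (i, j) * φ x} := by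
    ext p
    simp only [mem_iInter]
    rfl
  rw [h]
  refine isClosed_iInter fun φ => isClosed_iInter fun hφ => isClosed_iInter fun hc =>
    isClosed_iInter fun _ => isClosed_iInter fun i => isClosed_iInter fun j => isClosed_eq ?_ ?_
  · have hd : Continuous fun x => fderiv ℝ φ x (EuclideanSpace.single j 1) :=
      (hφ.continuous_fderiv (by simp)).clm_apply continuous_const
    exact (continuous_integral_coord_mul i hd (hc.fderiv_apply ℝ _)).comp
      (WithLp.fstL 2 ℝ _ _).continuous
  · exact ((continuous_integral_coord_mul (i, j) hφ.continuous hc).comp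
      (WithLp.sndL 2 ℝ _ _).continuous).neg

instance completeSpace_h1 (U : Set Plane) : CompleteSpace (H1 U) :=
  (isClosed_h1 U).completeSpace_coe

/-! ### The elastic energy -/

lemma IsElasticityTensor.mono {U Ω : Set Plane} {C : TensorField} (hC : IsElasticityTensor Ω C)
    (h : U ⊆ Ω) : IsElasticityTensor U C where
  meas i j k l := (hC.meas i j k l).mono_measure (Measure.restrict_mono h le_rfl)
  symm := ae_mono (Measure.restrict_mono h le_rfl) hC.symm
  bounded := by
    obtain ⟨M, hM⟩ := hC.bounded
    exact ⟨M, ae_mono (Measure.restrict_mono h le_rfl) hM⟩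
  stable := by
    obtain ⟨m, hm, hst⟩ := hC.stable
    exact ⟨m, hm, ae_mono (Measure.restrict_mono h le_rfl) hst⟩

lemma memLp_strain {U : Set Plane} (u : H1 U) (i j : Fin 2) :
    MemLp (fun x => strain (gradOf u x) i j) 2 (volume.restrict U) := by
  have h := ((memLp_gradOf_coord u (i, j)).add (memLp_gradOf_coord u (j, i))).const_mul (1 / 2)
  convert h using 1
  funext x
  simp only [strain, Pi.add_apply]
  ring

section Energy

variable {U : Set Plane} {C : TensorField} {ρ : Plane → ℝ} {R : ℝ}

lemma integrable_elastic (hC : IsElasticityTensor U C) (hρm : Measurable ρ)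
    (hρ : ∀ x, |ρ x| ≤ R) (u v : H1 U) :
    Integrable (fun x => ρ x * ddot (C.app x (strain (gradOf u x))) (strain (gradOf v x)))
      (volume.restrict U) := by
  obtain ⟨M, hM⟩ := hC.bounded
  have hterm : ∀ i j k l, Integrable (fun x => ρ x * C x i j k l
      * (strain (gradOf u x) k l * strain (gradOf v x) i j)) (volume.restrict U) := by
    intro i j k l
    refine Integrable.bdd_mul (c := R * M)
      (MemLp.integrable_mul (p := 2) (q := 2) (memLp_strain u k l) (memLp_strain v i j))
      (hρm.aestronglyMeasurable.mul (hC.meas i j k l)) ?_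
    filter_upwards [hM] with x hx
    rw [Real.norm_eq_abs, abs_mul]
    exact mul_le_mul (hρ x) (hx i j k l) (abs_nonneg _) ((abs_nonneg _).trans (hρ x))
  have hsum := integrable_finsetSum Finset.univ fun i (_ : i ∈ Finset.univ) =>
    integrable_finsetSum Finset.univ fun j (_ : j ∈ Finset.univ) =>
      integrable_finsetSum Finset.univ fun k (_ : k ∈ Finset.univ) =>
        integrable_finsetSum Finset.univ fun l (_ : l ∈ Finset.univ) => hterm i j k l
  refine hsum.congr (Eventually.of_forall fun x => ?_)
  simp only [ddot, TensorField.app, Fin.sum_univ_two]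
  ring

lemma gradOf_add (u v : H1 U) :
    ∀ᵐ x ∂(volume.restrict U), gradOf (u + v) x = gradOf u x + gradOf v x :=
  Lp.coeFn_add u.1.snd v.1.snd

lemma gradOf_smul (c : ℝ) (u : H1 U) :
    ∀ᵐ x ∂(volume.restrict U), gradOf (c • u) x = c • gradOf u x :=
  Lp.coeFn_smul c u.1.snd

/-- The elastic energy as a bilinear form. -/
lemma exists_bilin_elasticForm (hC : IsElasticityTensor U C) (hρm : Measurable ρ)
    (hρ : ∀ x, |ρ x| ≤ R) :
    ∃ B : LinearMap.BilinForm ℝ (H1 U), ∀ u v, B u v = elasticForm C ρ u v := by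
  refine ⟨LinearMap.mk₂ ℝ (fun u v => elasticForm C ρ u v) ?_ ?_ ?_ ?_, fun u v => rfl⟩
  · intro u u' v
    unfold elasticForm
    rw [← integral_add (integrable_elastic hC hρm hρ u v) (integrable_elastic hC hρm hρ u' v)]
    refine integral_congr_ae ?_
    filter_upwards [gradOf_add u u'] with x hx
    rw [hx]
    simp only [ddot, TensorField.app, strain, Fin.sum_univ_two, PiLp.add_apply]
    ring
  · intro c u v
    unfold elasticForm
    rw [smul_eq_mul, ← integral_const_mul]
    refine integral_congr_ae ?_
    filter_upwards [gradOf_smul c u] with x hx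
    rw [hx]
    simp only [ddot, TensorField.app, strain, Fin.sum_univ_two, PiLp.smul_apply, smul_eq_mul]
    ring
  · intro u v v'
    unfold elasticForm
    rw [← integral_add (integrable_elastic hC hρm hρ u v) (integrable_elastic hC hρm hρ u v')]
    refine integral_congr_ae ?_
    filter_upwards [gradOf_add v v'] with x hx
    rw [hx]
    simp only [ddot, TensorField.app, strain, Fin.sum_univ_two, PiLp.add_apply]
    ring
  · intro c u v
    unfold elasticForm
    rw [smul_eq_mul, ← integral_const_mul]
    refine integral_congr_ae ?_
    filter_upwards [gradOf_smul c v] with x hx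
    rw [hx]
    simp only [ddot, TensorField.app, strain, Fin.sum_univ_two, PiLp.smul_apply, smul_eq_mul]
    ring

lemma elasticForm_comm (hC : IsElasticityTensor U C) (u v : H1 U) :
    elasticForm C ρ u v = elasticForm C ρ v u := by
  refine integral_congr_ae ?_
  filter_upwards [hC.symm] with x hx
  congr 1
  have h := fun i j k l => (hx i j k l).2
  simp only [ddot, TensorField.app, Fin.sum_univ_two]
  rw [h 0 0 0 1, h 0 0 1 0, h 0 0 1 1, h 0 1 1 0, h 0 1 1 1, h 1 0 1 1]
  ring

lemma isSymm_strain (G : GradVal) : (strain G).IsSymm := by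
  refine Matrix.IsSymm.ext fun i j => ?_
  simp only [strain]
  ring

lemma elasticForm_self_nonneg (hC : IsElasticityTensor U C) (hρ : ∀ x, 0 ≤ ρ x) (u : H1 U) :
    0 ≤ elasticForm C ρ u u := by
  obtain ⟨m, hm, hst⟩ := hC.stable
  refine integral_nonneg_of_ae ?_
  filter_upwards [hst] with x hx
  have h1 := hx _ (isSymm_strain (gradOf u x))
  rw [ddot_strain_self] at h1
  exact mul_nonneg (hρ x) (le_trans (by positivity) h1)

lemma integral_norm_sq_eq {E : Type*} [NormedAddCommGroup E] (f : Lp E 2 (volume.restrict U)) :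
    ∫ x in U, ‖f x‖ ^ 2 = ‖f‖ ^ 2 := by
  have h1 : ‖f‖ₑ ^ 2 = ∫⁻ x in U, ‖f x‖ₑ ^ 2 := by rw [Lp.enorm_def, eLpNorm_two_sq]
  have hm : AEStronglyMeasurable (fun x => ‖f x‖ ^ 2) (volume.restrict U) :=
    (Lp.aestronglyMeasurable f).norm.pow 2
  rw [integral_eq_lintegral_of_nonneg_ae (Eventually.of_forall fun x => by positivity) hm]
  simp_rw [← enorm_sq_eq_ofReal]
  rw [← h1, enorm_sq_eq_ofReal, ENNReal.toReal_ofReal (by positivity)]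

lemma integrable_norm_sq {E : Type*} [NormedAddCommGroup E] (f : Lp E 2 (volume.restrict U)) :
    Integrable (fun x => ‖f x‖ ^ 2) (volume.restrict U) :=
  (Lp.memLp f).integrable_norm_pow two_ne_zero

lemma exists_le_elasticForm_self (hC : IsElasticityTensor U C) :
    ∃ m : ℝ, 0 < m ∧ ∀ u : H1 U, m * ‖strainOp U u‖ ^ 2 ≤ elasticForm C (fun _ => 1) u u := by
  obtain ⟨m, hm, hst⟩ := hC.stable
  refine ⟨m, hm, fun u => ?_⟩
  rw [← integral_norm_sq_eq, ← integral_const_mul]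
  refine integral_mono_ae ((integrable_norm_sq _).const_mul m)
    (integrable_elastic hC measurable_const (R := 1) (by simp) u u) ?_
  filter_upwards [hst, coeFn_strainOp u] with x hx hx'
  rw [hx', one_mul, ← ddot_strain_self]
  exact hx _ (isSymm_strain (gradOf u x))

lemma exists_elasticForm_self_le (hC : IsElasticityTensor U C) (hR : 0 ≤ R) :
    ∃ M : ℝ, 0 ≤ M ∧ ∀ ρ : Plane → ℝ, Measurable ρ → (∀ x, |ρ x| ≤ R) → ∀ u : H1 U,
      elasticForm C ρ u u ≤ M * ‖u‖ ^ 2 := by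
  obtain ⟨M, hM⟩ := hC.bounded
  refine ⟨R * (4 * |M|), by positivity, fun ρ hρm hρ u => ?_⟩
  have hn : ‖strainOp U u‖ ≤ ‖u‖ := by
    have h1 : ‖strainOp U u‖ₑ ^ 2 ≤ ‖u‖ₑ ^ 2 := by
      rw [enorm_strainOp_sq, enorm_h1_sq]
      refine le_trans (lintegral_mono fun x => ?_) le_add_self
      gcongr
      rw [← ofReal_norm, ← ofReal_norm]
      exact ENNReal.ofReal_le_ofReal (norm_symPart_le _)
    rw [enorm_sq_eq_ofReal, enorm_sq_eq_ofReal, ENNReal.ofReal_le_ofReal_iff (by positivity)] at h1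
    exact abs_le_of_sq_le_sq' h1 (norm_nonneg _) |>.2
  calc elasticForm C ρ u u ≤ ∫ x in U, R * (4 * |M|) * ‖strainOp U u x‖ ^ 2 := by
        refine integral_mono_ae (integrable_elastic hC hρm hρ u u)
          ((integrable_norm_sq _).const_mul _) ?_
        filter_upwards [hM, coeFn_strainOp u] with x hx hx'
        rw [hx', ← ddot_strain_self]
        set E := strain (gradOf u x)
        have h1 : |ddot (C.app x E) E| ≤ |M| * (|E 0 0| + |E 0 1| + |E 1 0| + |E 1 1|) ^ 2 := by
          calc |ddot (C.app x E) E| ≤ ∑ i, ∑ j, ∑ k, ∑ l, |C x i j k l| * |E k l| * |E i j| := by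
                simp only [ddot, TensorField.app, Finset.sum_mul]
                refine (Finset.abs_sum_le_sum_abs _ _).trans (Finset.sum_le_sum fun i _ => ?_)
                refine (Finset.abs_sum_le_sum_abs _ _).trans (Finset.sum_le_sum fun j _ => ?_)
                refine (Finset.abs_sum_le_sum_abs _ _).trans (Finset.sum_le_sum fun k _ => ?_)
                refine (Finset.abs_sum_le_sum_abs _ _).trans (Finset.sum_le_sum fun l _ => ?_)
                rw [abs_mul, abs_mul]
            _ ≤ ∑ i, ∑ j, ∑ k, ∑ l, |M| * |E k l| * |E i j| := by
                refine Finset.sum_le_sum fun i _ => Finset.sum_le_sum fun j _ =>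
                  Finset.sum_le_sum fun k _ => Finset.sum_le_sum fun l _ => ?_
                exact mul_le_mul_of_nonneg_right (mul_le_mul_of_nonneg_right
                  ((hx i j k l).trans (le_abs_self M)) (abs_nonneg _)) (abs_nonneg _)
            _ = _ := by
                simp only [Fin.sum_univ_two]
                ring
        have h2 : (|E 0 0| + |E 0 1| + |E 1 0| + |E 1 1|) ^ 2 ≤ 4 * ddot E E := by
          simp only [ddot, Fin.sum_univ_two]
          rw [← abs_mul_abs_self (E 0 0), ← abs_mul_abs_self (E 0 1), ← abs_mul_abs_self (E 1 0),
            ← abs_mul_abs_self (E 1 1)]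
          nlinarith [sq_nonneg (|E 0 0| - |E 0 1|), sq_nonneg (|E 0 0| - |E 1 0|),
            sq_nonneg (|E 0 0| - |E 1 1|), sq_nonneg (|E 0 1| - |E 1 0|),
            sq_nonneg (|E 0 1| - |E 1 1|), sq_nonneg (|E 1 0| - |E 1 1|)]
        calc ρ x * ddot (C.app x E) E ≤ |ρ x| * |ddot (C.app x E) E| := by
              rw [← abs_mul]
              exact le_abs_self _
          _ ≤ R * (|M| * (4 * ddot E E)) := by
              gcongr
              · exact hρ x
              · exact h1.trans (by gcongr)
          _ = _ := by ring
    _ = R * (4 * |M|) * ‖strainOp U u‖ ^ 2 := by rw [integral_const_mul, integral_norm_sq_eq]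
    _ ≤ _ := by gcongr

end Energy

/-! ### Boundary data -/

lemma halfTrace_eq_iff {U : Set Plane} {w w' : H1 U} :
    halfTrace U w = halfTrace U w' ↔ w - w' ∈ traceKer U :=
  Submodule.Quotient.eq (traceKer U)

lemma norm_halfTrace_le {U : Set Plane} (w : H1 U) : ‖halfTrace U w‖ ≤ ‖w‖ :=
  Submodule.Quotient.norm_mk_le (traceKer U) w

lemma exists_halfTrace_eq {U : Set Plane} (ψ : HalfSpace U) {ε : ℝ} (hε : 0 < ε) :
    ∃ w : H1 U, halfTrace U w = ψ ∧ ‖w‖ < ‖ψ‖ + ε :=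
  Submodule.Quotient.norm_mk_lt (S := traceKer U) ψ hε

lemma halfTrace_eq_of_traces {U : Set Plane} {w w' : H1 U} {h h' : L2Bdry U}
    (hw : (w, h) ∈ traceGraph U) (hw' : (w', h') ∈ traceGraph U) (hh : h = h') :
    halfTrace U w = halfTrace U w' := by
  rw [halfTrace_eq_iff]
  have := (traceGraph U).sub_mem hw hw'
  rwa [Prod.mk_sub_mk, hh, sub_self] at this

/-- The choice in `halfDatum` is immaterial: two fields with the same trace differ by an element of
`traceKer`, so they define the same class. -/
lemma halfDatum_eq {U : Set Plane} {w : H1 U} {h : L2Bdry U} {g : Plane → Plane}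
    (hw : (w, h) ∈ traceGraph U) (hg : h =ᵐ[bdryMeasure U] g) :
    halfDatum U g = halfTrace U w := by
  have hex : ∃ ψ, IsHalfDatum U g ψ := ⟨_, w, h, hw, hg, rfl⟩
  rw [halfDatum, dif_pos hex]
  obtain ⟨w', h', hw', hg', he⟩ := hex.choose_spec
  rw [← he]
  exact halfTrace_eq_of_traces hw' hw (Lp.ext (hg'.trans hg.symm))

/-! ### Steklov–Poincaré operators -/

section Steklov

variable {U : Set Plane} {C : TensorField}

/-- The default value of `steklovPoincare` is zero, which is also nonnegative and bounded. The later
estimates thus need no separate proof that the operator exists. -/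
lemma isSteklovPoincare_or_eq_zero (C : TensorField) (ρ : Plane → ℝ) (U : Set Plane) :
    IsSteklovPoincare C ρ U (steklovPoincare C ρ U) ∨ steklovPoincare C ρ U = 0 := by
  by_cases h : ∃ A, IsSteklovPoincare C ρ U A
  · left
    rw [steklovPoincare, dif_pos h]
    exact h.choose_spec
  · right
    rw [steklovPoincare, dif_neg h]

lemma steklovPoincare_self_nonneg (hC : IsElasticityTensor U C) {ρ : Plane → ℝ}
    (hρ : ∀ x, 0 ≤ ρ x) (ψ : HalfSpace U) : 0 ≤ steklovPoincare C ρ U ψ ψ := by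
  rcases isSteklovPoincare_or_eq_zero C ρ U with h | h
  · obtain ⟨w, hw, hA⟩ := h ψ
    have h1 := hA w
    rw [hw.1] at h1
    rw [h1]
    exact elasticForm_self_nonneg hC hρ w
  · simp [h]

/-- Dirichlet principle: the solution is orthogonal in energy to `w - w'`, so the energy of `w'`
exceeds its own by the energy of the difference. -/
lemma elasticForm_self_le_of_isDirichletSolution (hC : IsElasticityTensor U C) {ρ : Plane → ℝ}
    {R : ℝ} (hρm : Measurable ρ) (hρ0 : ∀ x, 0 ≤ ρ x) (hρ : ∀ x, ρ x ≤ R) {w w' : H1 U}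
    (hw : IsDirichletSolution C ρ U (halfTrace U w') w) :
    elasticForm C ρ w w ≤ elasticForm C ρ w' w' := by
  obtain ⟨B, hB⟩ := exists_bilin_elasticForm hC hρm (R := R)
    fun x => (abs_of_nonneg (hρ0 x)).trans_le (hρ x)
  have h0 := hw.2 _ (halfTrace_eq_iff.1 hw.1)
  have h1 := elasticForm_self_nonneg hC hρ0 (w - w')
  have h2 := elasticForm_comm (ρ := ρ) hC w' w
  simp only [← hB, map_sub, LinearMap.sub_apply] at h0 h1 h2 ⊢
  linarith

lemma elasticForm_sq_le (hC : IsElasticityTensor U C) {ρ : Plane → ℝ}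
    {R : ℝ} (hρm : Measurable ρ) (hρ0 : ∀ x, 0 ≤ ρ x) (hρ : ∀ x, ρ x ≤ R) (w φ : H1 U) :
    elasticForm C ρ w φ ^ 2 ≤ elasticForm C ρ w w * elasticForm C ρ φ φ := by
  obtain ⟨B, hB⟩ := exists_bilin_elasticForm hC hρm (R := R)
    fun x => (abs_of_nonneg (hρ0 x)).trans_le (hρ x)
  have h := LinearMap.BilinForm.apply_mul_apply_le_of_forall_zero_le B
    (fun x => by rw [hB]; exact elasticForm_self_nonneg hC hρ0 x) w φ
  simp only [hB] at h
  rwa [elasticForm_comm hC φ w, ← sq] at h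

/-- Steklov–Poincaré operators are bounded uniformly with respect to the density. -/
lemma exists_norm_steklovPoincare_le (hC : IsElasticityTensor U C) {R : ℝ} (hR : 0 ≤ R) :
    ∃ M : ℝ, 0 ≤ M ∧ ∀ ρ : Plane → ℝ, Measurable ρ → (∀ x, 0 ≤ ρ x) → (∀ x, ρ x ≤ R) →
      ‖steklovPoincare C ρ U‖ ≤ M := by
  obtain ⟨M, hM0, hM⟩ := exists_elasticForm_self_le hC hR
  refine ⟨M, hM0, fun ρ hρm hρ0 hρ => ?_⟩
  rcases isSteklovPoincare_or_eq_zero C ρ U with h | h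
  · refine ContinuousLinearMap.opNorm_le_bound₂ _ hM0 fun ψ η => ?_
    -- The norm on `HalfSpace` is an infimum over representatives. Nearly optimal ones are taken,
    -- and then `ε` tends to zero.
    have key : ∀ ε > 0,
        ‖steklovPoincare C ρ U ψ η‖ ≤ M * (‖ψ‖ + ε) * (‖η‖ + ε) := by
      intro ε hε
      obtain ⟨w', rfl, hw'⟩ := exists_halfTrace_eq ψ hε
      obtain ⟨φ, rfl, hφ⟩ := exists_halfTrace_eq η hε
      obtain ⟨w, hw, hA⟩ := h (halfTrace U w')
      have hρa : ∀ x, |ρ x| ≤ R := fun x => (abs_of_nonneg (hρ0 x)).trans_le (hρ x)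
      have h1 := elasticForm_sq_le hC hρm hρ0 hρ w φ
      have h2 := (elasticForm_self_le_of_isDirichletSolution hC hρm hρ0 hρ hw).trans
        (hM ρ hρm hρa w')
      have h3 := hM ρ hρm hρa φ
      have h4 : elasticForm C ρ w φ ^ 2 ≤ (M * ‖w'‖ * ‖φ‖) ^ 2 :=
        calc _ ≤ (M * ‖w'‖ ^ 2) * (M * ‖φ‖ ^ 2) := h1.trans
              (mul_le_mul h2 h3 (elasticForm_self_nonneg hC hρ0 φ) (by positivity))
          _ = _ := by ring
      rw [hA φ, Real.norm_eq_abs]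
      refine (abs_le_of_sq_le_sq h4 (by positivity)).trans ?_
      gcongr
    have hlim : Tendsto (fun ε : ℝ => M * (‖ψ‖ + ε) * (‖η‖ + ε)) (𝓝[>] 0)
        (𝓝 (M * (‖ψ‖ + 0) * (‖η‖ + 0))) :=
      (Continuous.tendsto (by fun_prop) 0).mono_left nhdsWithin_le_nhds
    rw [add_zero, add_zero] at hlim
    exact ge_of_tendsto hlim (by filter_upwards [self_mem_nhdsWithin] with ε hε using key ε hε)
  · rw [h, ContinuousLinearMap.opNorm_zero]
    exact hM0

end Steklov

lemma measurable_contrast (x₀ : Plane) (r ζ : ℝ) : Measurable (contrast x₀ r ζ) :=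
  Measurable.ite measurableSet_ball measurable_const measurable_const

lemma contrast_nonneg (x₀ : Plane) {r : ℝ} (hr : 0 ≤ r) (ζ : ℝ) (x : Plane) :
    0 ≤ contrast x₀ r ζ x := by
  unfold contrast
  split_ifs
  · exact hr
  · exact zero_le_one

lemma contrast_le (x₀ : Plane) (r ζ : ℝ) (x : Plane) : contrast x₀ r ζ x ≤ max 1 r := by
  unfold contrast
  split_ifs
  · exact le_max_right _ _
  · exact le_max_left _ _

section Inversion

open EuclideanGeometry

/-! ### Extension into the ball by inversion -/

lemma abs_det_smul_reflection (K : Submodule ℝ Plane) (c : ℝ) :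
    |(c • (K.reflection : Plane →L[ℝ] Plane)).det| = c ^ 2 := by
  have h : LinearMap.det (K.reflection.toLinearMap) = (-1) ^ Module.finrank ℝ Kᗮ :=
    K.det_reflection
  have h2 : (c • (K.reflection : Plane →L[ℝ] Plane)).det
      = c ^ 2 * LinearMap.det (K.reflection.toLinearMap) := by
    rw [ContinuousLinearMap.det, ContinuousLinearMap.toLinearMap_smul, LinearMap.det_smul,
      finrank_euclideanSpace_fin]
    rfl
  rw [h2, h, abs_mul, abs_pow, abs_neg_one_pow, mul_one, sq_abs]

/-- Inside the circle the inversion expands areas: the Jacobian is the fourth power of `R / dist x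
x₀`, which is at least one. -/
lemma setLIntegral_comp_inversion_le {x₀ : Plane} {R : ℝ} (hR : 0 < R) {S : Set Plane}
    (hS : MeasurableSet S) (hSR : S ⊆ Metric.closedBall x₀ R \ {x₀}) (f : Plane → ℝ≥0∞) :
    ∫⁻ x in S, f (inversion x₀ R x) ≤ ∫⁻ x in inversion x₀ R '' S, f x := by
  rw [lintegral_image_eq_lintegral_abs_det_fderiv_mul volume hS
    (fun x hx => (hasFDerivAt_inversion (hSR hx).2).hasFDerivWithinAt)
    (inversion_injective x₀ hR.ne').injOn]
  refine setLIntegral_mono' hS fun x hx => ?_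
  rw [abs_det_smul_reflection]
  refine le_mul_of_one_le_left zero_le ?_
  rw [ENNReal.one_le_ofReal]
  have hd : 0 < dist x x₀ := dist_pos.2 (hSR hx).2
  have h1 : 1 ≤ R / dist x x₀ := (one_le_div hd).2 (hSR hx).1
  exact one_le_pow₀ (one_le_pow₀ h1)

/-- The derivative of the inversion is a reflection scaled by `(R / dist x x₀) ^ 2`. The factor `2`
counts the two columns of the gradient. -/
lemma norm_grad_comp_inversion_sq_le {x₀ x : Plane} (R : ℝ) (hx : x ≠ x₀) {φ : Plane → Plane}
    (hφ : ContDiff ℝ ∞ φ) :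
    ‖grad (fun y => φ (inversion x₀ R y)) x‖ ^ 2
      ≤ 2 * ((R / dist x x₀) ^ 2) ^ 2 * ‖grad φ (inversion x₀ R x)‖ ^ 2 := by
  set L : Plane →L[ℝ] Plane :=
    (R / dist x x₀) ^ 2 • ((Submodule.span ℝ {x - x₀})ᗮ.reflection : Plane →L[ℝ] Plane) with hL
  have hd : HasFDerivAt (fun y => φ (inversion x₀ R y))
      ((fderiv ℝ φ (inversion x₀ R x)).comp L) x :=
    (hφ.differentiable (by simp) _).hasFDerivAt.comp x (hasFDerivAt_inversion hx)
  have hcol : ∀ k : Fin 2, ‖fderiv ℝ (fun y => φ (inversion x₀ R y)) x (unitVec k)‖ ^ 2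
      ≤ ((R / dist x x₀) ^ 2) ^ 2 * ‖grad φ (inversion x₀ R x)‖ ^ 2 := by
    intro k
    rw [hd.fderiv, ContinuousLinearMap.comp_apply]
    have h1 := norm_fderiv_apply_le φ (inversion x₀ R x) (L (unitVec k))
    have h2 : ‖L (unitVec k)‖ = (R / dist x x₀) ^ 2 := by
      have h3 : L (unitVec k) = (R / dist x x₀) ^ 2 •
        (Submodule.span ℝ {x - x₀})ᗮ.reflection (unitVec k) := rfl
      rw [h3, norm_smul, LinearIsometryEquiv.norm_map, norm_unitVec, mul_one, Real.norm_eq_abs,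
        abs_of_nonneg (sq_nonneg _)]
    rw [h2] at h1
    calc _ ≤ (‖grad φ (inversion x₀ R x)‖ * (R / dist x x₀) ^ 2) ^ 2 := by gcongr
      _ = _ := by ring
  have h0 := hcol 0
  have h1 := hcol 1
  rw [norm_plane_sq] at h0 h1
  rw [norm_gradVal_sq]
  simp only [grad_apply]
  unfold unitVec at h0 h1
  linarith

lemma exists_closedBall_subset {Ω : Set Plane} (hΩ : IsOpen Ω) {x₀ : Plane} {R : ℝ} (hR : 0 < R)
    (hball : Metric.closedBall x₀ R ⊆ Ω) : ∃ R' > R, Metric.closedBall x₀ R' ⊆ Ω := by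
  obtain ⟨δ, hδ, h⟩ := (isCompact_closedBall x₀ R).exists_cthickening_subset_open hΩ hball
  rw [cthickening_closedBall hδ.le hR.le] at h
  exact ⟨δ + R, by linarith, h⟩

/-- Multiplication of the inverted field by a cutoff function. -/
def inversionExtension (x₀ : Plane) (R : ℝ) (χ : Plane → ℝ) :
    (Plane → Plane) →ₗ[ℝ] (Plane → Plane) where
  toFun φ x := χ x • φ (inversion x₀ R x)
  map_add' φ ψ := by
    funext x
    exact smul_add (χ x) _ _
  map_smul' c φ := by
    funext x
    exact smul_comm (χ x) c _

/-- Smooth fields outside a ball extend into the ball with control of the `H¹` norm. -/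
lemma exists_smooth_extension {Ω : Set Plane} (hΩ : IsOpen Ω) {x₀ : Plane} {R : ℝ} (hR : 0 < R)
    (hball : Metric.closedBall x₀ R ⊆ Ω) :
    ∃ (C : NNReal) (E : (Plane → Plane) →ₗ[ℝ] (Plane → Plane)), ∀ φ, ContDiff ℝ ∞ φ →
      ContDiff ℝ ∞ (E φ) ∧ (∀ x ∈ Metric.sphere x₀ R, E φ x = φ x) ∧
      h1Int (Metric.ball x₀ R) (E φ) ≤ C * h1Int (truncated Ω x₀ R) φ := by
  obtain ⟨R', hR', hR'Ω⟩ := exists_closedBall_subset hΩ hR hball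
  have hR'0 : 0 < R' := hR.trans hR'
  -- The inversion exchanges the circles of radii `R₁` and `R'`, so the annulus between `R₁` and `R`
  -- is sent into the part of `Ω` outside the ball.
  set R₁ : ℝ := R ^ 2 / R' with hR₁
  have hR₁0 : 0 < R₁ := by positivity
  have hR₁R : R₁ < R := by
    rw [hR₁, div_lt_iff₀ hR'0]
    nlinarith
  let b : ContDiffBump x₀ := ⟨R₁, R, hR₁0, hR₁R⟩
  -- The factor vanishes around the centre, where the inversion is singular, and equals one on the
  -- circle, which the inversion fixes.
  set χ : Plane → ℝ := fun x => 1 - b x with hχ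
  have hχs : ContDiff ℝ ∞ χ := contDiff_const.sub b.contDiff
  have hχ0 : ∀ x ∈ Metric.ball x₀ R₁, χ x = 0 := fun x hx => by
    rw [hχ]
    simp only
    rw [b.one_of_mem_closedBall (Metric.ball_subset_closedBall hx), sub_self]
  have hχ1 : ∀ x ∈ Metric.sphere x₀ R, χ x = 1 := fun x hx => by
    rw [hχ]
    simp only
    rw [b.zero_of_le_dist (Metric.mem_sphere.1 hx).ge, sub_zero]
  have hχb : ∀ x, |χ x| ≤ 1 := fun x => by
    rw [abs_le]
    constructor <;> simp only [hχ] <;> linarith [b.nonneg (x := x), b.le_one (x := x)]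
  obtain ⟨K, hK⟩ := (isCompact_closedBall x₀ R).exists_bound_of_continuousOn
    (hχs.continuous_fderiv (by simp)).continuousOn
  have hK0 : 0 ≤ K := (norm_nonneg _).trans (hK x₀ (Metric.mem_closedBall_self hR.le))
  set k : ℝ := (R / R₁) ^ 2 with hk
  set W : Set Plane := Metric.ball x₀ R \ Metric.ball x₀ R₁ with hW
  have hWm : MeasurableSet W := measurableSet_ball.diff measurableSet_ball
  have hW0 : W ⊆ Metric.closedBall x₀ R \ {x₀} := by
    rintro x ⟨h1, h2⟩
    refine ⟨Metric.ball_subset_closedBall h1, ?_⟩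
    rintro rfl
    exact h2 (Metric.mem_ball_self hR₁0)
  have hWU : inversion x₀ R '' W ⊆ truncated Ω x₀ R := by
    rintro _ ⟨x, hx, rfl⟩
    have hd : 0 < dist x x₀ := dist_pos.2 (hW0 hx).2
    have hd1 : dist x x₀ < R := hx.1
    have hd2 : R₁ ≤ dist x x₀ := not_lt.1 hx.2
    refine ⟨hR'Ω ?_, ?_⟩
    · rw [Metric.mem_closedBall, dist_inversion_center, div_le_iff₀ hd]
      rw [hR₁, div_le_iff₀ hR'0] at hd2
      linarith
    · rw [Metric.mem_closedBall, dist_inversion_center, not_le, lt_div_iff₀ hd]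
      nlinarith
  refine ⟨(1 + 8 * K ^ 2 + 4 * k ^ 2).toNNReal, inversionExtension x₀ R χ, fun φ hφ => ?_⟩
  have hzero : ∀ x ∈ Metric.ball x₀ R₁, inversionExtension x₀ R χ φ =ᶠ[𝓝 x] fun _ => 0 := by
    intro x hx
    filter_upwards [Metric.isOpen_ball.mem_nhds hx] with y hy
    change χ y • φ _ = 0
    rw [hχ0 y hy, zero_smul]
  have hcomp : ∀ x, x ≠ x₀ → ContDiffAt ℝ ∞ (fun y => φ (inversion x₀ R y)) x := fun x hx =>
    hφ.contDiffAt.comp x (contDiffAt_const.inversion contDiffAt_const contDiffAt_id hx)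
  refine ⟨?_, ?_, ?_⟩
  · refine contDiff_iff_contDiffAt.2 fun x => ?_
    by_cases hx : x = x₀
    · subst hx
      exact contDiffAt_const.congr_of_eventuallyEq (hzero x (Metric.mem_ball_self hR₁0))
    · exact hχs.contDiffAt.smul (hcomp x hx)
  · intro x hx
    change χ x • φ _ = φ x
    rw [hχ1 x hx, one_smul, inversion_of_mem_sphere hx]
  · have hpt : ∀ x ∈ Metric.ball x₀ R, ‖inversionExtension x₀ R χ φ x‖ₑ ^ 2
        + ‖grad (inversionExtension x₀ R χ φ) x‖ₑ ^ 2
        ≤ W.indicator (fun x => ENNReal.ofReal (1 + 8 * K ^ 2 + 4 * k ^ 2)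
          * (‖φ (inversion x₀ R x)‖ₑ ^ 2 + ‖grad φ (inversion x₀ R x)‖ₑ ^ 2)) x := by
      intro x hx
      by_cases hx1 : x ∈ Metric.ball x₀ R₁
      · have h1 := (hzero x hx1).eq_of_nhds
        have h2 : grad (inversionExtension x₀ R χ φ) x = 0 := by
          ext p
          simp only [grad]
          rw [(hzero x hx1).fderiv_eq]
          simp
        rw [h1, h2]
        simp
      · have hxW : x ∈ W := ⟨hx, hx1⟩
        have hne : x ≠ x₀ := (hW0 hxW).2
        have hd : 0 < dist x x₀ := dist_pos.2 hne
        have hd2 : R₁ ≤ dist x x₀ := not_lt.1 hx1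
        rw [indicator_of_mem hxW]
        have hg : grad (inversionExtension x₀ R χ φ) x
            = χ x • grad (fun y => φ (inversion x₀ R y)) x
              + tensor (φ (inversion x₀ R x)) (fderiv ℝ χ x) :=
          grad_smul (hχs.differentiable (by simp) x)
            ((hcomp x hne).differentiableAt (by simp))
        have hg1 := norm_grad_comp_inversion_sq_le R hne hφ
        have hkd : (R / dist x x₀) ^ 2 ≤ k := by
          rw [hk]
          gcongr
        have hf : ‖inversionExtension x₀ R χ φ x‖ ≤ ‖φ (inversion x₀ R x)‖ := by
          change ‖χ x • φ (inversion x₀ R x)‖ ≤ _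
          rw [norm_smul]
          exact mul_le_of_le_one_left (norm_nonneg _) (hχb x)
        have ht : ‖tensor (φ (inversion x₀ R x)) (fderiv ℝ χ x)‖
            ≤ 2 * K * ‖φ (inversion x₀ R x)‖ := by
          refine (norm_tensor_le _ _).trans ?_
          gcongr
          exact hK x (Metric.ball_subset_closedBall hx)
        have hs : ‖χ x • grad (fun y => φ (inversion x₀ R y)) x‖ ^ 2
            ≤ 2 * k ^ 2 * ‖grad φ (inversion x₀ R x)‖ ^ 2 := by
          rw [norm_smul, mul_pow]
          calc _ ≤ 1 * ‖grad (fun y => φ (inversion x₀ R y)) x‖ ^ 2 := by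
                gcongr
                exact pow_le_one₀ (norm_nonneg _) (hχb x)
            _ ≤ _ := by
                rw [one_mul]
                refine hg1.trans ?_
                gcongr
        have hgrad : ‖grad (inversionExtension x₀ R χ φ) x‖ ^ 2
            ≤ 4 * k ^ 2 * ‖grad φ (inversion x₀ R x)‖ ^ 2
              + 8 * K ^ 2 * ‖φ (inversion x₀ R x)‖ ^ 2 := by
          rw [hg]
          set A := χ x • grad (fun y => φ (inversion x₀ R y)) x
          set T := tensor (φ (inversion x₀ R x)) (fderiv ℝ χ x)
          have h1 : ‖A + T‖ ^ 2 ≤ (‖A‖ + ‖T‖) ^ 2 := by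
            gcongr
            exact norm_add_le _ _
          have h2 : ‖T‖ ^ 2 ≤ (2 * K * ‖φ (inversion x₀ R x)‖) ^ 2 := by gcongr
          nlinarith [sq_nonneg (‖A‖ - ‖T‖)]
        have hf2 : ‖inversionExtension x₀ R χ φ x‖ ^ 2 ≤ ‖φ (inversion x₀ R x)‖ ^ 2 := by gcongr
        simp only [enorm_sq_eq_ofReal]
        rw [← ENNReal.ofReal_add (by positivity) (by positivity),
          ← ENNReal.ofReal_add (by positivity) (by positivity),
          ← ENNReal.ofReal_mul (by positivity)]
        refine ENNReal.ofReal_le_ofReal ?_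
        have hp1 := mul_nonneg (sq_nonneg K) (sq_nonneg ‖grad φ (inversion x₀ R x)‖)
        have hp2 := mul_nonneg (sq_nonneg k) (sq_nonneg ‖φ (inversion x₀ R x)‖)
        nlinarith [sq_nonneg ‖grad φ (inversion x₀ R x)‖]
    have hgm : Measurable fun x => ‖φ x‖ₑ ^ 2 := hφ.continuous.enorm.measurable.pow_const 2
    have hsplit : ∀ S, h1Int S φ = ∫⁻ x in S, (‖φ x‖ₑ ^ 2 + ‖grad φ x‖ₑ ^ 2) := fun S =>
      (lintegral_add_left hgm _).symm
    have hEm : Measurable (fun x => ‖inversionExtension x₀ R χ φ x‖ₑ ^ 2) := by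
      have : Measurable (inversionExtension x₀ R χ φ) := by
        have hi : Measurable (inversion x₀ R) := by
          unfold inversion
          fun_prop
        exact hχs.continuous.measurable.smul (hφ.continuous.measurable.comp hi)
      exact this.enorm.pow_const 2
    calc h1Int (Metric.ball x₀ R) (inversionExtension x₀ R χ φ)
        = ∫⁻ x in Metric.ball x₀ R, (‖inversionExtension x₀ R χ φ x‖ₑ ^ 2
          + ‖grad (inversionExtension x₀ R χ φ) x‖ₑ ^ 2) := (lintegral_add_left hEm _).symm
      _ ≤ ∫⁻ x in Metric.ball x₀ R, W.indicator (fun x =>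
          ENNReal.ofReal (1 + 8 * K ^ 2 + 4 * k ^ 2)
          * (‖φ (inversion x₀ R x)‖ₑ ^ 2 + ‖grad φ (inversion x₀ R x)‖ₑ ^ 2)) x :=
          setLIntegral_mono' measurableSet_ball hpt
      _ ≤ ∫⁻ x in W, ENNReal.ofReal (1 + 8 * K ^ 2 + 4 * k ^ 2)
          * (‖φ (inversion x₀ R x)‖ₑ ^ 2 + ‖grad φ (inversion x₀ R x)‖ₑ ^ 2) := by
          refine (setLIntegral_le_lintegral _ _).trans ?_
          rw [lintegral_indicator hWm]
      _ = ENNReal.ofReal (1 + 8 * K ^ 2 + 4 * k ^ 2)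
          * ∫⁻ x in W, (‖φ (inversion x₀ R x)‖ₑ ^ 2 + ‖grad φ (inversion x₀ R x)‖ₑ ^ 2) :=
          lintegral_const_mul' _ _ ENNReal.ofReal_ne_top
      _ ≤ ENNReal.ofReal (1 + 8 * K ^ 2 + 4 * k ^ 2) * h1Int (truncated Ω x₀ R) φ := by
          gcongr
          refine (setLIntegral_comp_inversion_le hR hWm hW0
            fun x => ‖φ x‖ₑ ^ 2 + ‖grad φ x‖ₑ ^ 2).trans ?_
          rw [hsplit]
          exact lintegral_mono_set hWU

end Inversion

/-! ### Traces on the circle from outside and from inside -/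

/-- An `L²` function with respect to a measure is one with respect to any smaller measure. -/
lemma exists_lp_of_measure_le {μ ν : Measure Plane} (h : μ ≤ ν) :
    ∃ T : Lp Plane 2 ν →L[ℝ] Lp Plane 2 μ, ∀ f, T f =ᵐ[μ] f := by
  have hm : ∀ f : Lp Plane 2 ν, MemLp f 2 μ := fun f => (Lp.memLp f).mono_measure h
  have hac : μ ≪ ν := Measure.absolutelyContinuous_of_le h
  refine ⟨LinearMap.mkContinuous
    { toFun := fun f => (hm f).toLp f
      map_add' := fun f g => Lp.ext ?_
      map_smul' := fun c f => Lp.ext ?_ } 1 fun f => ?_, fun f => (hm f).coeFn_toLp⟩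
  · filter_upwards [(hm (f + g)).coeFn_toLp, Lp.coeFn_add ((hm f).toLp f) ((hm g).toLp g),
      (hm f).coeFn_toLp, (hm g).coeFn_toLp, hac.ae_le (Lp.coeFn_add f g)] with x h1 h2 h3 h4 h5
    rw [h1, h2, h5, Pi.add_apply, Pi.add_apply, h3, h4]
  · filter_upwards [(hm (c • f)).coeFn_toLp, Lp.coeFn_smul c ((hm f).toLp f),
      (hm f).coeFn_toLp, hac.ae_le (Lp.coeFn_smul c f)] with x h1 h2 h3 h4
    rw [RingHom.id_apply, h1, h2, h4, Pi.smul_apply, Pi.smul_apply, h3]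
  · change ‖(hm f).toLp f‖ ≤ 1 * ‖f‖
    rw [one_mul, Lp.norm_toLp, Lp.norm_def]
    exact ENNReal.toReal_mono (Lp.memLp f).2.ne (eLpNorm_mono_measure f h)

lemma isOpen_truncated {Ω : Set Plane} (hΩ : IsOpen Ω) (x₀ : Plane) (R : ℝ) :
    IsOpen (truncated Ω x₀ R) :=
  hΩ.sdiff Metric.isClosed_closedBall

lemma sphere_subset_frontier_truncated {Ω : Set Plane} (hΩ : IsOpen Ω) {x₀ : Plane} {R : ℝ}
    (hR : 0 < R) (hball : Metric.closedBall x₀ R ⊆ Ω) :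
    Metric.sphere x₀ R ⊆ frontier (truncated Ω x₀ R) := by
  intro x hx
  have hxc : x ∈ Metric.closedBall x₀ R := Metric.sphere_subset_closedBall hx
  rw [(isOpen_truncated hΩ x₀ R).frontier_eq]
  refine ⟨hΩ.inter_closure ⟨hball hxc, ?_⟩, fun h => h.2 hxc⟩
  change x ∈ closure (Metric.closedBall x₀ R)ᶜ
  rw [closure_compl, interior_closedBall _ hR.ne']
  exact fun h => (Metric.mem_ball.1 h).ne (Metric.mem_sphere.1 hx)

lemma norm_le_of_enorm_sq_le {E F : Type*} [NormedAddCommGroup E] [NormedAddCommGroup F]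
    {C : NNReal} {a : E} {b : F} (h : ‖a‖ₑ ^ 2 ≤ C * ‖b‖ₑ ^ 2) : ‖a‖ ≤ √C * ‖b‖ := by
  rw [enorm_sq_eq_ofReal, enorm_sq_eq_ofReal, ← ENNReal.ofReal_coe_nnreal,
    ← ENNReal.ofReal_mul C.coe_nonneg, ENNReal.ofReal_le_ofReal_iff (by positivity)] at h
  refine abs_le_of_sq_le_sq' ?_ (by positivity) |>.2
  rwa [mul_pow, Real.sq_sqrt C.coe_nonneg]

lemma cauchySeq_of_norm_sub_le {E F : Type*} [NormedAddCommGroup E] [NormedAddCommGroup F]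
    {a : ℕ → E} {b : ℕ → F} {C : ℝ} (hC : 0 ≤ C) (hb : CauchySeq b)
    (h : ∀ n m, ‖a n - a m‖ ≤ C * ‖b n - b m‖) : CauchySeq a := by
  rw [Metric.cauchySeq_iff]
  intro ε hε
  obtain ⟨N, hN⟩ := Metric.cauchySeq_iff.1 hb (ε / (C + 1)) (by positivity)
  refine ⟨N, fun m hm n hn => ?_⟩
  have h3 := hN m hm n hn
  rw [dist_eq_norm] at h3 ⊢
  rw [lt_div_iff₀ (by positivity)] at h3
  nlinarith [norm_nonneg (b m - b n), h m n]

set_option maxHeartbeats 800000 in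
/-- The trace on `∂B_R` of a field on the truncated domain is the trace of a field on `B_R`. -/
lemma exists_extension_traceGraph {Ω : Set Plane} (hΩ : IsOpen Ω) {x₀ : Plane} {R : ℝ}
    (hR : 0 < R) (hball : Metric.closedBall x₀ R ⊆ Ω) :
    ∃ C : ℝ, 0 ≤ C ∧ ∀ p ∈ traceGraph (truncated Ω x₀ R),
      ∃ q ∈ traceGraph (Metric.ball x₀ R), q.2 =ᵐ[bdryMeasure (Metric.ball x₀ R)] p.2 ∧
        ‖q.1‖ ≤ C * ‖p.1‖ := by
  obtain ⟨C, E, hE⟩ := exists_smooth_extension hΩ hR hball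
  have hfr : frontier (Metric.ball x₀ R) = Metric.sphere x₀ R := frontier_ball _ hR.ne'
  have hle : bdryMeasure (Metric.ball x₀ R) ≤ bdryMeasure (truncated Ω x₀ R) :=
    Measure.restrict_mono (hfr ▸ sphere_subset_frontier_truncated hΩ hR hball) le_rfl
  obtain ⟨T, hT⟩ := exists_lp_of_measure_le hle
  refine ⟨√C, by positivity, fun p hp => ?_⟩
  obtain ⟨s, hs, hsp⟩ := mem_closure_iff_seq_limit.1 hp
  choose φ hφ h1 h2 using hs
  choose w hw _ using fun n => exists_h1_of_contDiff (U := Metric.ball x₀ R) Metric.isBounded_ball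
    (hE (φ n) (hφ n)).1
  have hwT : ∀ n, (w n, T (s n).2) ∈ smoothTracePairs (Metric.ball x₀ R) := by
    intro n
    refine ⟨E (φ n), (hE (φ n) (hφ n)).1, hw n, ?_⟩
    have hm : ∀ᵐ x ∂(bdryMeasure (Metric.ball x₀ R)), x ∈ Metric.sphere x₀ R := by
      rw [bdryMeasure, hfr]
      exact ae_restrict_mem Metric.isClosed_sphere.measurableSet
    filter_upwards [hT (s n).2, ae_mono hle (h2 n), hm] with x x1 x2 x3
    rw [x1, x2, (hE (φ n) (hφ n)).2.1 x x3]
  have hU := isOpen_truncated hΩ x₀ R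
  have hn : ∀ n, ‖w n‖ ≤ √C * ‖(s n).1‖ := by
    intro n
    refine norm_le_of_enorm_sq_le ?_
    rw [enorm_h1_sq_eq_h1Int Metric.isOpen_ball (hE (φ n) (hφ n)).1 (hw n),
      enorm_h1_sq_eq_h1Int hU (hφ n) (h1 n)]
    exact (hE (φ n) (hφ n)).2.2
  -- Linearity of the extension gives the same bound for differences. The extended fields are
  -- therefore Cauchy and converge, `H1` being complete.
  have hnm : ∀ n m, ‖w n - w m‖ ≤ √C * ‖(s n).1 - (s m).1‖ := by
    intro n m
    have hs1 : ContDiff ℝ ∞ (φ n - φ m) := (hφ n).sub (hφ m)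
    have hs2 := hE _ hs1
    refine norm_le_of_enorm_sq_le ?_
    rw [enorm_h1_sq_eq_h1Int Metric.isOpen_ball hs2.1
      (?_ : fieldOf (w n - w m) =ᵐ[_] E (φ n - φ m)), enorm_h1_sq_eq_h1Int hU hs1
      (?_ : fieldOf ((s n).1 - (s m).1) =ᵐ[_] φ n - φ m)]
    · exact hs2.2.2
    · exact (Lp.coeFn_sub (s n).1.1.fst (s m).1.1.fst).trans ((h1 n).sub (h1 m))
    · rw [map_sub]
      exact (Lp.coeFn_sub (w n).1.fst (w m).1.fst).trans ((hw n).sub (hw m))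
  have hs1 : Tendsto (fun n => (s n).1) atTop (𝓝 p.1) := hsp.fst_nhds
  have hs2 : Tendsto (fun n => T (s n).2) atTop (𝓝 (T p.2)) :=
    (T.continuous.tendsto p.2).comp hsp.snd_nhds
  have hcau : CauchySeq w := cauchySeq_of_norm_sub_le (by positivity) hs1.cauchySeq hnm
  obtain ⟨w₀, hw₀⟩ := cauchySeq_tendsto_of_complete hcau
  refine ⟨(w₀, T p.2), ?_, hT p.2, le_of_tendsto_of_tendsto' hw₀.norm (hs1.norm.const_mul _) hn⟩
  exact mem_closure_of_tendsto (hw₀.prodMk_nhds hs2) (Eventually.of_forall hwT)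

/-! ### The truncated domain -/

lemma frontier_subset_frontier_truncated {Ω : Set Plane} (hΩ : IsOpen Ω) {x₀ : Plane} {R : ℝ}
    (hball : Metric.closedBall x₀ R ⊆ Ω) : frontier Ω ⊆ frontier (truncated Ω x₀ R) := by
  intro x hx
  rw [hΩ.frontier_eq] at hx
  rw [(isOpen_truncated hΩ x₀ R).frontier_eq]
  refine ⟨?_, fun h => hx.2 h.1⟩
  have h := (Metric.isClosed_closedBall (x := x₀) (ε := R)).isOpen_compl.inter_closure
    ⟨fun h => hx.2 (hball h), hx.1⟩
  rw [inter_comm] at h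
  exact h

lemma isConnected_annulus (x₀ : Plane) {R R' : ℝ} (hR : 0 < R) (hR' : R < R') :
    IsConnected {x : Plane | R < dist x x₀ ∧ dist x x₀ < R'} := by
  have hs : IsConnected (Metric.sphere (0 : Plane) 1) :=
    isConnected_sphere (by rw [← Module.finrank_eq_rank, finrank_euclideanSpace_fin]; norm_num)
      0 zero_le_one
  have h := ((isConnected_Ioo hR').prod hs).image (fun p : ℝ × Plane => x₀ + p.1 • p.2)
    (by fun_prop)
  convert h using 1
  ext x
  constructor
  · rintro ⟨h1, h2⟩
    have hd : 0 < dist x x₀ := hR.trans h1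
    refine ⟨(dist x x₀, (dist x x₀)⁻¹ • (x - x₀)), ⟨⟨h1, h2⟩, ?_⟩, ?_⟩
    · rw [mem_sphere_zero_iff_norm, norm_smul, norm_inv, Real.norm_of_nonneg hd.le,
        ← dist_eq_norm, inv_mul_cancel₀ hd.ne']
    · simp [smul_smul, mul_inv_cancel₀ hd.ne']
  · rintro ⟨⟨t, v⟩, ⟨ht, hv⟩, rfl⟩
    have ht0 : 0 < t := hR.trans ht.1
    have hd : dist (x₀ + t • v) x₀ = t := by
      rw [dist_eq_norm, add_sub_cancel_left, norm_smul, mem_sphere_zero_iff_norm.1 hv, mul_one,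
        Real.norm_of_nonneg ht0.le]
    simpa [hd] using ht

/-- A thin annulus around the hole is connected, so it lies on one side of any separation of the
truncated domain. Adding the ball to that side would separate `Ω` itself. -/
lemma isConnected_truncated {Ω : Set Plane} (hΩ : IsOpen Ω) (hc : IsConnected Ω) {x₀ : Plane}
    {R : ℝ} (hR : 0 < R) (hball : Metric.closedBall x₀ R ⊆ Ω) :
    IsConnected (truncated Ω x₀ R) := by
  obtain ⟨R', hR', hR'Ω⟩ := exists_closedBall_subset hΩ hR hball
  have hA := isConnected_annulus x₀ hR hR'
  set A := {x : Plane | R < dist x x₀ ∧ dist x x₀ < R'}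
  have hAU : A ⊆ truncated Ω x₀ R := fun x hx => ⟨hR'Ω hx.2.le, not_le.2 hx.1⟩
  have hUA : truncated Ω x₀ R ∩ Metric.ball x₀ R' ⊆ A := fun x hx => ⟨not_le.1 hx.1.2, hx.2⟩
  have hU := isOpen_truncated hΩ x₀ R
  have key : ∀ u v : Set Plane, IsOpen u → IsOpen v → truncated Ω x₀ R ⊆ u ∪ v →
      truncated Ω x₀ R ∩ (u ∩ v) = ∅ → A ⊆ u → truncated Ω x₀ R ⊆ u := by
    intro u v hu hv hsub hdis hAu
    have h := isPreconnected_iff_subset_of_disjoint.1 hc.isPreconnected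
      ((u ∩ truncated Ω x₀ R) ∪ Metric.ball x₀ R') (v ∩ truncated Ω x₀ R)
      ((hu.inter hU).union Metric.isOpen_ball) (hv.inter hU) ?_ ?_
    · rcases h with h | h
      · intro x hx
        rcases h hx.1 with h | h
        · exact h.1
        · exact hAu (hUA ⟨hx, h⟩)
      · have h0 := (h (hball (Metric.mem_closedBall_self hR.le))).2.2
        exact (h0 (Metric.mem_closedBall_self hR.le)).elim
    · intro x hx
      by_cases hxb : x ∈ Metric.closedBall x₀ R
      · exact Or.inl (Or.inr (Metric.closedBall_subset_ball hR' hxb))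
      · rcases hsub ⟨hx, hxb⟩ with h | h
        · exact Or.inl (Or.inl ⟨h, hx, hxb⟩)
        · exact Or.inr ⟨h, hx, hxb⟩
    · refine eq_empty_of_forall_notMem fun x hx => ?_
      have hxU := hx.2.2.2
      have hxu : x ∈ u := hx.2.1.elim (fun h => h.1) fun h => hAu (hUA ⟨hxU, h⟩)
      have : x ∈ truncated Ω x₀ R ∩ (u ∩ v) := ⟨hxU, hxu, hx.2.2.1⟩
      rw [hdis] at this
      exact this
  refine ⟨hA.nonempty.mono hAU, isPreconnected_iff_subset_of_disjoint.2
    fun u v hu hv hsub hdis => ?_⟩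
  have hdA : A ∩ (u ∩ v) = ∅ :=
    subset_empty_iff.1 (hdis ▸ inter_subset_inter_left _ hAU)
  rcases isPreconnected_iff_subset_of_disjoint.1 hA.isPreconnected u v hu hv
    (hAU.trans hsub) hdA with h | h
  · exact Or.inl (key u v hu hv hsub hdis h)
  · exact Or.inr (key v u hv hu (union_comm u v ▸ hsub) (inter_comm u v ▸ hdis) h)

/-- Clamping the abscissa to half the radius keeps the arc away from its vertical tangents, where it
is not Lipschitz, and makes the function globally defined. -/
lemma lipschitzWith_circleArc {R : ℝ} (hR : 0 < R) (a c : ℝ) :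
    LipschitzWith 1 fun s : ℝ => c + √(R ^ 2 - max (-(R / 2)) (min (R / 2) (s - a)) ^ 2) := by
  have h1 : LipschitzWith 1 fun s : ℝ => max (-(R / 2)) (min (R / 2) (s - a)) :=
    ((LipschitzWith.of_dist_le_mul fun x y => by simp).const_min (R / 2)).const_max (-(R / 2))
  refine LipschitzWith.of_dist_le_mul fun s t => ?_
  have h2 := h1.dist_le_mul s t
  have hp : ∀ s : ℝ, |max (-(R / 2)) (min (R / 2) (s - a))| ≤ R / 2 := fun s =>
    abs_le.2 ⟨le_max_left _ _, max_le (by linarith) (min_le_left _ _)⟩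
  have hps := hp s
  have hpt := hp t
  simp only [NNReal.coe_one, one_mul] at h2 ⊢
  set p := max (-(R / 2)) (min (R / 2) (s - a))
  set q := max (-(R / 2)) (min (R / 2) (t - a))
  have hlow : ∀ p : ℝ, |p| ≤ R / 2 → R / 2 ≤ √(R ^ 2 - p ^ 2) ∧ 0 ≤ R ^ 2 - p ^ 2 := by
    intro p hp
    have : p ^ 2 ≤ (R / 2) ^ 2 := by
      rw [← sq_abs p]
      gcongr
    exact ⟨Real.le_sqrt_of_sq_le (by nlinarith), by nlinarith⟩
  obtain ⟨a1, a2⟩ := hlow p hps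
  obtain ⟨b1, b2⟩ := hlow q hpt
  refine le_trans ?_ h2
  rw [dist_add_left, Real.dist_eq, Real.dist_eq]
  have e : (√(R ^ 2 - p ^ 2) - √(R ^ 2 - q ^ 2)) * (√(R ^ 2 - p ^ 2) + √(R ^ 2 - q ^ 2))
      = (q - p) * (q + p) := by
    have := Real.sq_sqrt a2
    have := Real.sq_sqrt b2
    nlinarith
  have e' := congrArg abs e
  rw [abs_mul, abs_mul, abs_sub_comm q p,
    abs_of_nonneg (by linarith : 0 ≤ √(R ^ 2 - p ^ 2) + √(R ^ 2 - q ^ 2))] at e'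
  have h3 : |q + p| ≤ R := (abs_add_le q p).trans (by linarith)
  have h4 : |√(R ^ 2 - p ^ 2) - √(R ^ 2 - q ^ 2)| * R ≤ |p - q| * R := by
    calc _ ≤ |√(R ^ 2 - p ^ 2) - √(R ^ 2 - q ^ 2)| * (√(R ^ 2 - p ^ 2) + √(R ^ 2 - q ^ 2)) := by
          gcongr
          linarith
      _ = |p - q| * |q + p| := e'
      _ ≤ _ := by gcongr
  exact le_of_mul_le_mul_right h4 hR

/-- Near a point of a circle, the exterior is the strict epigraph of a Lipschitz function. -/
lemma exists_graph_exterior_ball {x₀ x : Plane} {R : ℝ} (hR : 0 < R)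
    (hx : x ∈ Metric.sphere x₀ R) : ∃ (L : Plane ≃ₗᵢ[ℝ] Plane) (K : NNReal) (γ : ℝ → ℝ),
      LipschitzWith K γ ∧ ∀ᶠ y in 𝓝 x, (R < dist y x₀ ↔ γ (L y 0) < L y 1) := by
  have hn : ‖x - x₀‖ = ‖R • unitVec 1‖ := by
    rw [norm_smul, norm_unitVec, mul_one, Real.norm_of_nonneg hR.le, ← dist_eq_norm]
    exact hx
  -- This reflection carries the given boundary point to the top of the circle, so that the exterior
  -- lies locally above the graph.
  set L : Plane ≃ₗᵢ[ℝ] Plane := (Submodule.span ℝ {(x - x₀) - R • unitVec 1})ᗮ.reflection with hL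
  have hLx : L (x - x₀) = R • unitVec 1 := Submodule.reflection_sub hn
  refine ⟨L, 1, _, lipschitzWith_circleArc hR (L x₀ 0) (L x₀ 1), ?_⟩
  have hcoord : ∀ i, Continuous fun y => L (y - x₀) i := fun i =>
    (EuclideanSpace.proj (𝕜 := ℝ) i).continuous.comp
      (L.continuous.comp (continuous_id.sub continuous_const))
  have h0 : L (x - x₀) 0 = 0 := by
    rw [hLx]
    simp [unitVec]
  have h1 : L (x - x₀) 1 = R := by
    rw [hLx]
    simp [unitVec]
  have e0 : ∀ᶠ y in 𝓝 x, L (y - x₀) 0 ∈ Ioo (-(R / 2)) (R / 2) :=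
    (hcoord 0).continuousAt.eventually_mem (isOpen_Ioo.mem_nhds (by rw [h0]; constructor <;> linarith))
  have e1 : ∀ᶠ y in 𝓝 x, L (y - x₀) 1 ∈ Ioi 0 :=
    (hcoord 1).continuousAt.eventually_mem (isOpen_Ioi.mem_nhds (by rw [h1]; exact hR))
  filter_upwards [e0, e1] with y y0 y1
  have hs : ∀ i, L y i - L x₀ i = L (y - x₀) i := fun i => by rw [map_sub]; rfl
  have hd : dist y x₀ ^ 2 = L (y - x₀) 0 ^ 2 + L (y - x₀) 1 ^ 2 := by
    rw [← norm_plane_sq, L.norm_map, dist_eq_norm]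
  rw [hs 0, min_eq_right y0.2.le, max_eq_right y0.1.le, ← lt_sub_iff_add_lt', hs 1,
    Real.sqrt_lt' y1, sub_lt_iff_lt_add', ← hd]
  exact (pow_lt_pow_iff_left₀ hR.le dist_nonneg two_ne_zero).symm

lemma isLipschitzDomain_truncated {Ω : Set Plane} (hΩ : IsLipschitzDomain Ω) {x₀ : Plane}
    {R : ℝ} (hR : 0 < R) (hball : Metric.closedBall x₀ R ⊆ Ω) :
    IsLipschitzDomain (truncated Ω x₀ R) where
  isOpen := isOpen_truncated hΩ.isOpen x₀ R
  isConnected := isConnected_truncated hΩ.isOpen hΩ.isConnected hR hball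
  isBounded := hΩ.isBounded.subset sdiff_subset
  graph := by
    intro x hx
    have hxc : x ∈ closure (truncated Ω x₀ R) := frontier_subset_closure hx
    rw [(isOpen_truncated hΩ.isOpen x₀ R).frontier_eq] at hx
    by_cases hxΩ : x ∈ Ω
    · have hxb : x ∈ Metric.closedBall x₀ R := by
        by_contra h
        exact hx.2 ⟨hxΩ, h⟩
      have hxb' : x ∉ Metric.ball x₀ R := by
        intro h
        obtain ⟨y, hy1, hy2⟩ := mem_closure_iff.1 hxc _ Metric.isOpen_ball h
        exact hy2.2 (Metric.ball_subset_closedBall hy1)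
      obtain ⟨L, K, γ, hγ, h⟩ := exists_graph_exterior_ball hR
        (le_antisymm hxb (not_lt.1 hxb') : dist x x₀ = R)
      refine ⟨L, K, γ, hγ, ?_⟩
      filter_upwards [h, hΩ.isOpen.mem_nhds hxΩ] with y hy hyΩ
      rw [← hy]
      exact ⟨fun h => not_le.1 h.2, fun h => ⟨hyΩ, not_le.2 h⟩⟩
    · obtain ⟨L, K, γ, hγ, h⟩ := hΩ.graph x
        (hΩ.isOpen.frontier_eq ▸ ⟨closure_mono sdiff_subset hxc, hxΩ⟩)
      refine ⟨L, K, γ, hγ, ?_⟩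
      filter_upwards [h, Metric.isClosed_closedBall.isOpen_compl.mem_nhds
        (fun h => hxΩ (hball h) : x ∈ (Metric.closedBall x₀ R)ᶜ)] with y hy hyb
      rw [← hy]
      exact ⟨fun h => h.1, fun h => ⟨h, hyb⟩⟩

/-! ### Comparison of solutions -/

section Comparison

variable {Ω ΓC ΓN ΓD Γ : Set Plane} {C : TensorField} {j : Plane → ℝ → ℝ} {g : Plane → Plane}
  {x₀ : Plane} {R : ℝ}

-- Data on the circle are represented by fields extended into the ball. For the difference, the pair
-- `p - q` is extended afresh: its extension has the same trace as the difference of the two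
-- extensions, but a norm bounded by `‖p.1 - q.1‖`.
set_option maxHeartbeats 1000000 in
lemma exists_norm_halfDatum_le (hΩ : IsOpen Ω) (hR : 0 < R)
    (hball : Metric.closedBall x₀ R ⊆ Ω) :
    ∃ K : ℝ, 0 ≤ K ∧ ∀ p ∈ traceGraph (truncated Ω x₀ R), ∀ q ∈ traceGraph (truncated Ω x₀ R),
      ‖halfDatum (Metric.ball x₀ R) p.2‖ ≤ K * ‖p.1‖ ∧
      ‖halfDatum (Metric.ball x₀ R) p.2 - halfDatum (Metric.ball x₀ R) q.2‖
        ≤ K * ‖p.1 - q.1‖ := by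
  obtain ⟨K, hK, hE⟩ := exists_extension_traceGraph hΩ hR hball
  have hfr : frontier (Metric.ball x₀ R) = Metric.sphere x₀ R := frontier_ball _ hR.ne'
  have hle : bdryMeasure (Metric.ball x₀ R) ≤ bdryMeasure (truncated Ω x₀ R) :=
    Measure.restrict_mono (hfr ▸ sphere_subset_frontier_truncated hΩ hR hball) le_rfl
  refine ⟨K, hK, fun p hp q hq => ?_⟩
  obtain ⟨p', hp', hpp, hpn⟩ := hE p hp
  obtain ⟨q', hq', hqq, -⟩ := hE q hq
  obtain ⟨s, hs, hss, hsn⟩ := hE (p - q) ((traceGraph _).sub_mem hp hq)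
  rw [halfDatum_eq hp' hpp, halfDatum_eq hq' hqq, ← map_sub]
  refine ⟨(norm_halfTrace_le _).trans hpn, ?_⟩
  have hd : s.2 = p'.2 - q'.2 := by
    refine Lp.ext ?_
    filter_upwards [hss, hpp, hqq, ae_mono hle (Lp.coeFn_sub p.2 q.2),
      Lp.coeFn_sub p'.2 q'.2] with x x1 x2 x3 x4 x5
    rw [x1, x5, Pi.sub_apply, x2, x3, Prod.snd_sub, x4, Pi.sub_apply]
  rw [← halfTrace_eq_of_traces (w := s.1) (w' := p'.1 - q'.1) (h := s.2) (h' := p'.2 - q'.2) hs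
    ((traceGraph _).sub_mem hp' hq') hd]
  exact (norm_halfTrace_le _).trans hsn

/-- The clamped part lies on the outer boundary, so it is contained in the boundary of the truncated
domain. There the difference of two admissible fields vanishes and Korn's inequality applies. -/
lemma exists_coercive (hΩ : IsLipschitzDomain Ω) (hΓ : IsBoundaryDecomposition Ω ΓC ΓN ΓD Γ)
    (hC : IsElasticityTensor Ω C) (hR : 0 < R) (hball : Metric.closedBall x₀ R ⊆ Ω) :
    ∃ c : ℝ, 0 < c ∧ ∀ p ∈ V1 Ω ΓC ΓD x₀ R, ∀ q ∈ V1 Ω ΓC ΓD x₀ R,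
      c * ‖p.1 - q.1‖ ^ 2 ≤ elasticForm C (fun _ => 1) (p.1 - q.1) (p.1 - q.1) := by
  have hsub : ΓD ⊆ frontier (truncated Ω x₀ R) := by
    refine Subset.trans ?_ (frontier_subset_frontier_truncated hΩ.isOpen hball)
    rw [hΓ.cover]
    exact fun x hx => Or.inl (Or.inr (subset_closure hx))
  obtain ⟨K, hK, hkorn⟩ := exists_korn_traceGraph (isLipschitzDomain_truncated hΩ hR hball) hsub
    hΓ.measD hΓ.clamped
  obtain ⟨m, hm, hst⟩ := exists_le_elasticForm_self (U := truncated Ω x₀ R)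
    (hC.mono sdiff_subset)
  refine ⟨m / K, by positivity, fun p hp q hq => (le_trans ?_ (hst (p.1 - q.1)))⟩
  have h := hkorn (p - q) ((traceGraph _).sub_mem hp.1 hq.1) ?_
  · rw [div_mul_eq_mul_div, div_le_iff₀ hK, mul_assoc, mul_comm _ K]
    exact mul_le_mul_of_nonneg_left h hm.le
  · filter_upwards [hp.2.1, hq.2.1,
      ae_mono (Measure.restrict_mono hsub le_rfl) (Lp.coeFn_sub p.2 q.2)] with x x1 x2 x3
    rw [Prod.snd_sub, x3, Pi.sub_apply, x1, x2, sub_zero]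

-- Each inequality is tested with the other solution. In the sum the load and friction integrals
-- cancel, being exact negatives of each other, and nonnegativity of `A'` discards its quadratic
-- term.
set_option maxHeartbeats 1000000 in
lemma elasticForm_sub_le (hC : IsElasticityTensor Ω C)
    {A A' : HalfSpace (Metric.ball x₀ R) →L[ℝ] NegHalfSpace (Metric.ball x₀ R)}
    (hA' : ∀ ψ, 0 ≤ A' ψ ψ) {u u' : H1 (truncated Ω x₀ R) × L2Bdry (truncated Ω x₀ R)}
    (hu : IsSolution Ω ΓC ΓN ΓD x₀ R C j g A u) (hu' : IsSolution Ω ΓC ΓN ΓD x₀ R C j g A' u') :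
    elasticForm C (fun _ => 1) (u'.1 - u.1) (u'.1 - u.1)
      ≤ ‖A' - A‖ * ‖halfDatum (Metric.ball x₀ R) u.2‖
        * ‖halfDatum (Metric.ball x₀ R) u'.2 - halfDatum (Metric.ball x₀ R) u.2‖ := by
  obtain ⟨b, hb⟩ := exists_bilin_elasticForm (U := truncated Ω x₀ R) (R := 1)
    (ρ := fun _ => 1) (hC.mono sdiff_subset) measurable_const (by simp)
  have h1 := hu.2 u' hu'.1
  have h2 := hu'.2 u hu.1
  have hg : ∫ x in ΓN, inner ℝ (g x) (u.2 x - u'.2 x) ∂(Measure.hausdorffMeasure 1)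
      = -∫ x in ΓN, inner ℝ (g x) (u'.2 x - u.2 x) ∂(Measure.hausdorffMeasure 1) := by
    rw [← integral_neg]
    congr 1
    funext x
    rw [← inner_neg_right, neg_sub]
  have hj : ∫ x in ΓC, (j x (inner ℝ (u.2 x) (tangent Ω x)) - j x (inner ℝ (u'.2 x) (tangent Ω x)))
          ∂(Measure.hausdorffMeasure 1)
      = -∫ x in ΓC, (j x (inner ℝ (u'.2 x) (tangent Ω x)) - j x (inner ℝ (u.2 x) (tangent Ω x)))
          ∂(Measure.hausdorffMeasure 1) := by
    rw [← integral_neg]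
    congr 1
    funext x
    rw [neg_sub]
  rw [hg, hj] at h2
  set ψ := halfDatum (Metric.ball x₀ R) u.2
  set ψ' := halfDatum (Metric.ball x₀ R) u'.2
  have h3 := hA' (ψ' - ψ)
  have h4 : -((A' - A) ψ (ψ' - ψ)) ≤ ‖A' - A‖ * ‖ψ‖ * ‖ψ' - ψ‖ :=
    (neg_le_abs _).trans ((A' - A).le_opNorm₂ ψ (ψ' - ψ))
  refine le_trans ?_ h4
  simp only [← hb, map_sub, sub_apply, LinearMap.sub_apply] at h1 h2 h3 ⊢
  linarith

set_option maxHeartbeats 1000000 in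
/-- Solutions depend Lipschitz continuously on the boundary operator. -/
lemma exists_norm_sub_le (hΩ : IsLipschitzDomain Ω) (hΓ : IsBoundaryDecomposition Ω ΓC ΓN ΓD Γ)
    (hC : IsElasticityTensor Ω C) (hR : 0 < R) (hball : Metric.closedBall x₀ R ⊆ Ω) :
    ∃ K : ℝ, 0 ≤ K ∧
      ∀ A A' : HalfSpace (Metric.ball x₀ R) →L[ℝ] NegHalfSpace (Metric.ball x₀ R),
      (∀ ψ, 0 ≤ A' ψ ψ) → ∀ u u', IsSolution Ω ΓC ΓN ΓD x₀ R C j g A u →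
      IsSolution Ω ΓC ΓN ΓD x₀ R C j g A' u' →
      ‖u'.1 - u.1‖ ≤ K * ‖A' - A‖ * ‖u.1‖ := by
  obtain ⟨c, hc, hco⟩ := exists_coercive hΩ hΓ hC hR hball
  obtain ⟨K, hK, hE⟩ := exists_norm_halfDatum_le hΩ.isOpen hR hball
  refine ⟨K ^ 2 / c, by positivity, fun A A' hA' u u' hu hu' => ?_⟩
  have h1 := (hco u' hu'.1 u hu.1).trans (elasticForm_sub_le hC hA' hu hu')
  have h2 := (hE u hu.1.1 u hu.1.1).1
  have h3 := (hE u' hu'.1.1 u hu.1.1).2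
  set D := ‖u'.1 - u.1‖
  have hD : 0 ≤ D := norm_nonneg _
  set a := ‖A' - A‖
  have ha : 0 ≤ a := (A' - A).opNorm_nonneg
  have h4 : c * D ^ 2 ≤ a * (K * ‖u.1‖) * (K * D) := by
    refine h1.trans ?_
    gcongr
  -- The inequality is quadratic in `D` on the left and linear on the right, so one factor is
  -- divided out unless `D = 0`.
  rcases hD.eq_or_lt with h | h
  · rw [← h]
    positivity
  · have h5 : c * D ≤ K ^ 2 * a * ‖u.1‖ := by
      refine le_of_mul_le_mul_right ?_ h
      linarith
    rw [div_mul_eq_mul_div, div_mul_eq_mul_div, le_div_iff₀ hc]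
    linarith

end Comparison

/-- A uniformly bounded family with the expansion `A + O(ζ²)` at `0` satisfies the estimate on the
whole interval. -/
lemma exists_norm_sub_le_sq {E : Type*} [SeminormedAddCommGroup E] [NormedSpace ℝ E]
    {F Rem : ℝ → E} {A B : E} {R M : ℝ} (hF : ∀ ζ, ‖F ζ‖ ≤ M) (hA : ‖A‖ ≤ M)
    (hexp : ∀ ζ ∈ Ioo 0 R, F ζ = A - ζ ^ 2 • B + Rem ζ)
    (hRem : (fun ζ : ℝ => ‖Rem ζ‖) =o[𝓝[>] 0] fun ζ : ℝ => ζ ^ 2) :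
    ∃ K : ℝ, 0 ≤ K ∧ ∀ ζ ∈ Ioo 0 R, ‖F ζ - A‖ ≤ K * ζ ^ 2 := by
  obtain ⟨δ, hδ, hsub⟩ := mem_nhdsGT_iff_exists_Ioo_subset.1 (hRem.bound one_pos)
  have hδ0 : 0 < δ := hδ
  -- The first entry serves `ζ < δ`, where the remainder is at most `ζ ^ 2`. The second serves `ζ ≥
  -- δ`, where the uniform bound `2M` is at most `2M / δ² * ζ²`.
  refine ⟨max (‖B‖ + 1) ((M + M) / δ ^ 2), by positivity, fun ζ hζ => ?_⟩
  have hζ0 : 0 < ζ := hζ.1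
  rcases lt_or_ge ζ δ with h | h
  · have h1 : ‖Rem ζ‖ ≤ ζ ^ 2 := by simpa using hsub ⟨hζ0, h⟩
    calc ‖F ζ - A‖ = ‖Rem ζ - ζ ^ 2 • B‖ := by
          rw [hexp ζ hζ]
          congr 1
          abel
      _ ≤ ‖Rem ζ‖ + ‖ζ ^ 2 • B‖ := norm_sub_le _ _
      _ ≤ (‖B‖ + 1) * ζ ^ 2 := by
          rw [norm_smul, Real.norm_of_nonneg (sq_nonneg ζ)]
          linarith
      _ ≤ _ := by
          gcongr
          exact le_max_left _ _
  · calc ‖F ζ - A‖ ≤ M + M := (norm_sub_le _ _).trans (add_le_add (hF ζ) hA)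
      _ = (M + M) / δ ^ 2 * δ ^ 2 := by field_simp
      _ ≤ max (‖B‖ + 1) ((M + M) / δ ^ 2) * ζ ^ 2 := by
          gcongr
          exact le_max_right _ _

end Contact

end

/-! ### The estimate for the solutions -/

theorem mainTheorem7
    (Ω ΓC ΓN ΓD Γ : Set Plane) (hΩ : IsLipschitzDomain Ω)
    (hΓ : IsBoundaryDecomposition Ω ΓC ΓN ΓD Γ)
    (C : TensorField) (hC : IsElasticityTensor Ω C)
    (j : Plane → ℝ → ℝ) (hj : IsFrictionPotential ΓC j)
    (g : Plane → Plane) (hg : MemLp g 2 ((Measure.hausdorffMeasure 1).restrict ΓN))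
    (x₀ : Plane) (R : ℝ) (hR : 0 < R) (hball : Metric.closedBall x₀ R ⊆ Ω)
    (r : ℝ) (hr : 0 < r)
    (B : HalfSpace (Metric.ball x₀ R) →L[ℝ] NegHalfSpace (Metric.ball x₀ R))
    (Rem : ℝ → HalfSpace (Metric.ball x₀ R) →L[ℝ] NegHalfSpace (Metric.ball x₀ R))
    (hexp : ∀ ζ ∈ Set.Ioo 0 R,
      steklovPoincare C (contrast x₀ r ζ) (Metric.ball x₀ R)
        = steklovPoincare C (fun _ => 1) (Metric.ball x₀ R) - ζ ^ 2 • B + Rem ζ)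
    (hRem : (fun ζ : ℝ => ‖Rem ζ‖) =o[𝓝[>] 0] fun ζ : ℝ => ζ ^ 2) :
    ∃ C₀ : ℝ, 0 < C₀ ∧
      ∀ u, IsSolution Ω ΓC ΓN ΓD x₀ R C j g
        (steklovPoincare C (fun _ => 1) (Metric.ball x₀ R)) u →
      ∀ ζ ∈ Set.Ioo 0 R, ∀ uζ, IsSolution Ω ΓC ΓN ΓD x₀ R C j g
        (steklovPoincare C (contrast x₀ r ζ) (Metric.ball x₀ R)) uζ →
      ‖uζ.1 - u.1‖ ≤ C₀ * ζ ^ 2 := by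
  have hCB := hC.mono (Metric.ball_subset_closedBall.trans hball)
  obtain ⟨M, hM0, hM⟩ := exists_norm_steklovPoincare_le hCB
    (le_max_of_le_left zero_le_one : 0 ≤ max 1 r)
  have hA := hM (fun _ => 1) measurable_const (fun _ => zero_le_one) fun _ => le_max_left _ _
  obtain ⟨K, hK, hsq⟩ := exists_norm_sub_le_sq (M := M)
    (E := HalfSpace (Metric.ball x₀ R) →L[ℝ] NegHalfSpace (Metric.ball x₀ R))
    (fun ζ => hM _ (measurable_contrast x₀ r ζ) (contrast_nonneg x₀ hr.le ζ)
      (contrast_le x₀ r ζ)) hA hexp hRem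
  obtain ⟨L, hL, hdiff⟩ := exists_norm_sub_le (j := j) (g := g) hΩ hΓ hC hR hball
  by_cases hex : ∃ u, IsSolution Ω ΓC ΓN ΓD x₀ R C j g
      (steklovPoincare C (fun _ => 1) (Metric.ball x₀ R)) u
  · obtain ⟨u₀, hu₀⟩ := hex
    -- The constant involves one fixed unperturbed solution. The summand `1` only makes it positive.
    refine ⟨L * K * ‖u₀.1‖ + 1, by positivity, fun u hu ζ hζ uζ huζ => ?_⟩
    -- Uniqueness: the comparison estimate with equal operators has right-hand side zero.
    have huu : u.1 = u₀.1 := by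
      have h := hdiff _ _ (steklovPoincare_self_nonneg hCB fun _ => zero_le_one) u₀ u hu₀ hu
      have h0 : ‖steklovPoincare C (fun _ => 1) (Metric.ball x₀ R)
          - steklovPoincare C (fun _ => 1) (Metric.ball x₀ R)‖ = 0 :=
        (congrArg norm (sub_self (G := HalfSpace (Metric.ball x₀ R) →L[ℝ]
          NegHalfSpace (Metric.ball x₀ R)) _)).trans ContinuousLinearMap.opNorm_zero
      rw [h0, mul_zero, zero_mul] at h
      exact sub_eq_zero.1 (norm_le_zero_iff.1 h)
    have h := hdiff _ _ (steklovPoincare_self_nonneg hCB (contrast_nonneg x₀ hr.le ζ)) u uζ hu huζ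
    rw [huu] at h ⊢
    calc _ ≤ L * (K * ζ ^ 2) * ‖u₀.1‖ := by
          refine h.trans ?_
          gcongr
          exact hsq ζ hζ
      _ ≤ _ := by nlinarith [sq_nonneg ζ]
  -- Without an unperturbed solution there is nothing to estimate, so any positive constant does.
  · exact ⟨1, one_pos, fun u hu => (hex ⟨u, hu⟩).elim⟩
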